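/- **Notation.** Let $p\ge q$ be integers, $M(p,q)$ the space of real $p\times q$ matrices and $P^+(q)$ the set of real symmetric positive definite $q\times q$ matrices. For $A\in P^+(q)$ let $A^{1/2}\in P^+(q)$ be its positive definite square root, and for $A,B\in P^+(q)$ put $A\circ B=B^{1/2}AB^{1/2}$. Let $\Gamma_q(a)=\pi^{q(q-1)/4}\prod_{j=1}^q\Gamma(a-\frac{j-1}{2})$. On $P^+(q)$ let $\mu(dS)=(\det S)^{-(q+1)/2}\prod_{i\le j}dS_{ij}$, and for $U\in P^+(p)$ let $$\nu_U(dx)=\frac{\Gamma_q(p/2)}{\pi^{pq/2}}\,\frac{(\det U)^{-q/2}}{\det(x^\top U^{-1}x)^{p/2}}\prod_{i,j}dx_{ij}\qquad\text{on } M(p,q).$$ Let $d\mathsf U$ be the uniform probability distribution on $\mathcal O(p,q)=\{\mathsf U\in M(p,q):\mathsf U^\top\mathsf U=I_q\}$ (the law of the first $q$ columns of a Haar-distributed element of the orthogonal group $\mathcal O(p)$), and let $\mathsf U_1$ denote the first $q$ rows of $\mathsf U$. A Metropolis–Hastings triplet $(\Pi,Q,\xi)$ on a measurable space consists of a $\sigma$-finite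 measure $\xi$, a probability measure $\Pi(dx)=\pi(x)\,\xi(dx)$ (target) and a $\xi$-reversible Markov kernel $Q$ (proposal). Its Metropolis–Hastings kernel is $$P(x,A)=\int_A \alpha(x,y)\,Q(x,dy)+\Big(1-\int\alpha(x,y)\,Q(x,dy)\Big)\delta_x(A),\qquad \alpha(x,y)=\min\{1,\pi(y)/\pi(x)\},$$ with $\alpha(x,y)=1$ if $\pi(x)=0$. Let $\rho\in[0,1)$ and $U\in P^+(p)$. The MpCN proposal kernel $Q=Q(\cdot\,;\rho,U)$ on $M(p,q)$ is given, for $x$ of rank $q$, by $Q(x,\cdot)=$ law of $y=\rho^{1/2}x+(1-\rho)^{1/2}w$, where $V\sim W_q^{-1}(p,x^\top U^{-1}x)$ (Inverse-Wishart) and, given $V$, $w\sim N_{p,q}(0,U,V)$ (Matrix-Normal); here $W_q^{-1}(r,T)$ has density $\frac{(\det T)^{r/2}\exp(-\operatorname{tr}[TS^{-1}]/2)}{2^{rq/2}(\det S)^{r/2}\Gamma_q(r/2)}$ with respect to $\mu(dS)$, and $N_{p,q}(M,\Sigma,T)$ has Lebesgue density $\frac{\exp(-\operatorname{tr}[T^{-1}(X-M)^\top\Sigma^{-1}(X-M)]/2)}{(2\pi)^{pq/2}(\det\Sigma)^{q/2}(\det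 T)^{p/2}}$. On the Lebesgue-null set of matrices $x$ of rank less than $q$, the matrix $x^\top U^{-1}x$ is replaced by $I_q$, in $Q$ and in the target density. Let $\mathcal L=\mathcal L_{\rho,p}$ be the measure on $P^+(q)$ $$\mathcal L(d\epsilon)=(1-\rho)^{pq/2}\,\frac{\Gamma_q(p)}{\Gamma_q(p/2)^2}\;\mu(d\epsilon)\int_{\mathcal O(p,q)}\frac{\det(\epsilon)^{p/2}}{\det\big(I_q+\epsilon-\rho^{1/2}(\mathsf U_1\epsilon^{1/2}+\epsilon^{1/2}\mathsf U_1^\top)\big)^{p}}\,d\mathsf U,$$ and let $\tilde Q=\tilde Q(\cdot\,;\rho,p)$ be the kernel on $P^+(q)$ such that $\tilde Q(S,\cdot)$ is the law of $\epsilon\circ S$ for $\epsilon\sim\mathcal L$. By definition, $\mathcal L$ and $\tilde Q$ do not depend on $U$. **Theorem.** Let $\tilde\Pi(dS)=\tilde\pi(S)\,\mu(dS)$ be a probability measure on $P^+(q)$, with $\tilde\pi\ge 0$ measurable, and let $\Pi(dx)=\tilde\pi(x^\top U^{-1}x)\,\nu_U(dx)$ be the upcast law on $M(p,q)$. Let $(X_n)_{n\ge0}$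 be the MpCN Markov chain on $M(p,q)$ with target $\Pi$ and proposal $Q(\cdot\,;\rho,U)$, i.e. a Markov chain whose transition kernel is the Metropolis–Hastings kernel with $\pi(x)=\tilde\pi(x^\top U^{-1}x)$ and proposal $Q$, started from an $X_0$ that has rank $q$ almost surely. Then: 1. $(\Pi,Q,\nu_U)$ is a Metropolis–Hastings triplet, with density $x\mapsto\tilde\pi(x^\top U^{-1}x)$, and almost surely $S_n:=X_n^\top U^{-1}X_n\in P^+(q)$ for all $n\ge0$. 2. $(\tilde\Pi,\tilde Q,\mu)$ is a Metropolis–Hastings triplet, with density $\tilde\pi$, and $(S_n)_{n\ge0}$ is a Markov chain, with respect to its own filtration, whose transition kernel is the Metropolis–Hastings kernel of this triplet. 3. $\mathcal L$ is a probability measure, and it satisfies $\mathcal L=\mathcal L_{-1}$, where $\mathcal L_{-1}$ is the law of $\epsilon^{-1}$ for $\epsilon\sim\mathcal L$. Moreover $\tilde Q$ is the transition kernel of the random walk $T_n=\epsilon_n\circ T_{n-1}$, $n\ge1$, with $\epsilon_1,\epsilon_2,\dots$ i.i.d. with law $\mathcal L$ and independent of $T_0$: every such $(T_n)$ is a Markov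 chain, with respect to its own filtration, with transition kernel $\tilde Q$. -/

import Mathlib

open MeasureTheory ProbabilityTheory Matrix
open scoped NNReal ENNReal

noncomputable section

namespace MpCN

/-! ### Matrix spaces -/

/-- `M(p,q)`: real `p × q` matrices. -/
abbrev Mat (p q : ℕ) : Type := Matrix (Fin p) (Fin q) ℝ

/-- `P⁺(q)`: real symmetric positive definite `q × q` matrices. -/
abbrev PD (q : ℕ) : Type := {S : Mat q q // S.PosDef}

/-- The product (= Borel) σ-algebra on `M(p,q)`. -/
instance instMeasurableSpaceMat (p q : ℕ) : MeasurableSpace (Mat p q) :=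
  inferInstanceAs (MeasurableSpace (Fin p → Fin q → ℝ))

instance instBorelSpaceMat (p q : ℕ) : BorelSpace (Mat p q) :=
  inferInstanceAs (BorelSpace (Fin p → Fin q → ℝ))

instance instPolishSpaceMat (p q : ℕ) : PolishSpace (Mat p q) :=
  inferInstanceAs (PolishSpace (Fin p → Fin q → ℝ))

/-- Lebesgue measure `∏ᵢⱼ dXᵢⱼ` on `M(p,q)`. -/
def leb (p q : ℕ) : Measure (Mat p q) := (volume : Measure (Fin p → Fin q → ℝ))

instance instSigmaFiniteLeb (p q : ℕ) : SigmaFinite (leb p q) :=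
  inferInstanceAs (SigmaFinite (volume : Measure (Fin p → Fin q → ℝ)))

theorem measurableSet_posDef (q : ℕ) : MeasurableSet {S : Mat q q | S.PosDef} := by
  have h : {S : Mat q q | S.PosDef}
      = {S | S.PosSemidef} ∩ {S | S.det ≠ 0} := by
    ext S
    refine ⟨fun hS => ⟨hS.posSemidef, hS.det_pos.ne'⟩, fun ⟨h1, h2⟩ => ?_⟩
    exact h1.posDef_iff_isUnit.2 ((Matrix.isUnit_iff_isUnit_det S).2 (isUnit_iff_ne_zero.2 h2))
  rw [h]
  refine MeasurableSet.inter ?_ ?_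
  · apply IsClosed.measurableSet
    have h' : {S : Mat q q | S.PosSemidef}
        = {S | Sᴴ = S} ∩ ⋂ x : Fin q → ℝ, {S | 0 ≤ star x ⬝ᵥ (S *ᵥ x)} := by
      ext S
      simp [Matrix.posSemidef_iff_dotProduct_mulVec, Matrix.IsHermitian]
    rw [h']
    refine IsClosed.inter (isClosed_eq (by fun_prop) continuous_id) (isClosed_iInter fun x => ?_)
    exact isClosed_le continuous_const (by fun_prop)
  · exact (isOpen_ne_fun (by fun_prop) continuous_const).measurableSet

instance instStandardBorelSpacePD (q : ℕ) : StandardBorelSpace (PD q) :=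
  (measurableSet_posDef q).standardBorel

/-- The identity matrix in `P⁺(q)`. -/
def PD.one (q : ℕ) : PD q := ⟨1, Matrix.PosDef.one⟩

/-- Matrix inversion on `P⁺(q)`. -/
def PD.inv {q : ℕ} (S : PD q) : PD q := ⟨S.1⁻¹, S.2.inv⟩

section Sqrt
open scoped MatrixOrder

theorem posDef_sqrt {q : ℕ} (S : PD q) : (CFC.sqrt S.1).PosDef := by
  have h : (CFC.sqrt S.1).PosSemidef := (CFC.sqrt_nonneg S.1).posSemidef
  refine h.posDef_iff_isUnit.2 ?_
  have h2 : CFC.sqrt S.1 * CFC.sqrt S.1 = S.1 :=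
    CFC.sqrt_mul_sqrt_self S.1 S.2.posSemidef.nonneg
  exact isUnit_of_mul_isUnit_left (h2 ▸ S.2.isUnit)

/-- `S^{1/2}`, the positive definite square root of `S ∈ P⁺(q)`. -/
def PD.sqrt {q : ℕ} (S : PD q) : PD q := ⟨CFC.sqrt S.1, posDef_sqrt S⟩

theorem PD.sqrt_mul_sqrt {q : ℕ} (S : PD q) : S.sqrt.1 * S.sqrt.1 = S.1 :=
  CFC.sqrt_mul_sqrt_self S.1 S.2.posSemidef.nonneg

theorem PD.eq_sqrt {q : ℕ} {S B : PD q} (h : B.1 * B.1 = S.1) : B = S.sqrt :=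
  Subtype.ext ((CFC.sqrt_unique h B.2.posSemidef.nonneg).symm)

end Sqrt

theorem PD.posDef_mul_mul {q : ℕ} (A B : PD q) : (B.1 * A.1 * B.1).PosDef := by
  have h := (Matrix.IsUnit.posDef_star_left_conjugate_iff (x := A.1) B.2.isUnit).2 A.2
  rwa [Matrix.star_eq_conjTranspose, B.2.isHermitian.eq] at h

/-- `A ∘ B = B^{1/2} A B^{1/2}` on `P⁺(q)`. -/
def PD.circ {q : ℕ} (A B : PD q) : PD q :=
  ⟨B.sqrt.1 * A.1 * B.sqrt.1, PD.posDef_mul_mul A B.sqrt⟩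

theorem measurable_inv_mat (q : ℕ) : Measurable fun S : Mat q q => S⁻¹ := by
  have h : (fun S : Mat q q => S⁻¹) = fun S => Ring.inverse S.det • S.adjugate := by
    ext1 S; rw [Matrix.inv_def]
  rw [h]
  have h1 : Measurable fun S : Mat q q => Ring.inverse S.det := by
    simp only [Ring.inverse_eq_inv']
    exact (by fun_prop : Continuous fun S : Mat q q => S.det).measurable.inv
  have h2 : Measurable fun S : Mat q q => S.adjugate :=
    (by fun_prop : Continuous fun S : Mat q q => S.adjugate).measurable
  exact h1.smul h2

theorem PD.measurable_sqrt (q : ℕ) : Measurable (PD.sqrt : PD q → PD q) := by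
  let f : PD q → PD q := fun B => ⟨B.1 * B.1, by
    have h := PD.posDef_mul_mul (PD.one q) B
    rwa [show (PD.one q).1 = 1 from rfl, mul_one] at h⟩
  have hf : Measurable f := by
    refine Measurable.subtype_mk ?_
    exact (by fun_prop : Continuous fun B : PD q => B.1 * B.1).measurable
  have hr : ∀ S, f (PD.sqrt S) = S := fun S => Subtype.ext (PD.sqrt_mul_sqrt S)
  have hl : ∀ B, PD.sqrt (f B) = B := fun B => (PD.eq_sqrt rfl).symm
  have hemb := hf.measurableEmbedding (Function.LeftInverse.injective hl)
  intro s hs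
  have : PD.sqrt ⁻¹' s = f '' s := by
    ext S
    exact ⟨fun h => ⟨_, h, hr S⟩, by rintro ⟨B, hB, rfl⟩; simpa [hl] using hB⟩
  rw [this]
  exact hemb.measurableSet_image.2 hs

theorem PD.measurable_of_coe {q : ℕ} {α : Type*} [MeasurableSpace α] {f : α → PD q}
    (h : Measurable fun a => (f a).1) : Measurable f :=
  (MeasurableEmbedding.subtype_coe (measurableSet_posDef q)).measurable_comp_iff.1 h

theorem PD.measurable_circ (q : ℕ) :
    Measurable (Function.uncurry (PD.circ : PD q → PD q → PD q)) := by
  refine PD.measurable_of_coe ?_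
  have h1 : Measurable fun z : PD q × PD q => z.2.sqrt.1 :=
    measurable_subtype_coe.comp ((PD.measurable_sqrt q).comp measurable_snd)
  have h2 : Measurable fun z : PD q × PD q => z.1.1 :=
    measurable_subtype_coe.comp measurable_fst
  have h3 : Measurable fun w : Mat q q × Mat q q => w.1 * w.2 * w.1 :=
    (by fun_prop : Continuous fun w : Mat q q × Mat q q => w.1 * w.2 * w.1).measurable
  have h := h3.comp (h1.prodMk h2)
  exact h

open Classical in
/-- `x ↦ xᵀ U⁻¹ x` as a `P⁺(q)`-valued map on the full-rank elements of `M(p,q)`. The value at the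
remaining matrices, which form a Lebesgue-null set when `q ≤ p`, is set to be the identity. -/
def gram {p q : ℕ} (U : PD p) (x : Mat p q) : PD q :=
  if h : (xᵀ * U.1⁻¹ * x).PosDef then ⟨xᵀ * U.1⁻¹ * x, h⟩ else PD.one q

theorem measurable_gram {p q : ℕ} (U : PD p) :
    Measurable (gram U : Mat p q → PD q) := by
  classical
  have hm : Measurable fun x : Mat p q => xᵀ * U.1⁻¹ * x :=
    (by fun_prop : Continuous fun x : Mat p q => xᵀ * U.1⁻¹ * x).measurable
  have hv : Measurable fun x : Mat p q => ((gram U x : PD q) : Mat q q) := by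
    have : (fun x : Mat p q => ((gram U x : PD q) : Mat q q))
        = fun x => if (xᵀ * U.1⁻¹ * x).PosDef then xᵀ * U.1⁻¹ * x else 1 := by
      ext1 x
      unfold gram
      split_ifs <;> rfl
    rw [this]
    exact Measurable.ite (hm (measurableSet_posDef q)) hm measurable_const
  exact hv.subtype_mk

/-! ### Reference measures -/

/-- The multivariate Gamma function
`Γ_q(a) = π^{q(q-1)/4} ∏_{j=1}^q Γ(a - (j-1)/2)`. -/
def mvGamma (q : ℕ) (a : ℝ) : ℝ :=
  Real.pi ^ ((q : ℝ) * ((q : ℝ) - 1) / 4) * ∏ j : Fin q, Real.Gamma (a - (j : ℝ) / 2)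

/-- The measure `ν_U` on `M(p,q)`. -/
def nu {p : ℕ} (q : ℕ) (U : PD p) : Measure (Mat p q) :=
  (leb p q).withDensity fun X => ENNReal.ofReal
    (mvGamma q ((p : ℝ) / 2) / Real.pi ^ ((p : ℝ) * q / 2) *
      (U.1.det ^ (-(q : ℝ) / 2) / (Xᵀ * U.1⁻¹ * X).det ^ ((p : ℝ) / 2)))

/-- The coordinates `(Sᵢⱼ)_{i ≤ j}` of `S ∈ P⁺(q)`. -/
def PD.upper {q : ℕ} (S : PD q) : {ij : Fin q × Fin q // ij.1 ≤ ij.2} → ℝ :=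
  fun ij => S.1 ij.1.1 ij.1.2

theorem PD.measurableEmbedding_upper (q : ℕ) :
    MeasurableEmbedding (PD.upper : PD q → _) := by
  refine Measurable.measurableEmbedding ?_ ?_
  · refine measurable_pi_lambda _ fun ij => ?_
    exact (by fun_prop : Continuous fun S : Mat q q => S ij.1.1 ij.1.2).measurable.comp
      measurable_subtype_coe
  · intro S T h
    have key : ∀ i j : Fin q, i ≤ j → S.1 i j = T.1 i j := fun i j hij =>
      congrFun h ⟨(i, j), hij⟩
    refine Subtype.ext (Matrix.ext fun i j => ?_)
    rcases le_total i j with hij | hij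
    · exact key i j hij
    · have hS := S.2.isHermitian.apply i j
      have hT := T.2.isHermitian.apply i j
      rw [← hS, ← hT, key j i hij]

/-- The measure `∏_{i ≤ j} dSᵢⱼ` on `P⁺(q)`. -/
def lebPD (q : ℕ) : Measure (PD q) :=
  (volume : Measure ({ij : Fin q × Fin q // ij.1 ≤ ij.2} → ℝ)).comap PD.upper

theorem lebPD_apply {q : ℕ} (A : Set (PD q)) : lebPD q A = volume (PD.upper '' A) :=
  (PD.measurableEmbedding_upper q).comap_apply _ _

instance instSigmaFiniteLebPD (q : ℕ) : SigmaFinite (lebPD q) := by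
  refine ⟨⟨⟨fun n => PD.upper ⁻¹' spanningSets volume n, fun _ => trivial, fun n => ?_, ?_⟩⟩⟩
  · rw [lebPD_apply]
    exact (measure_mono (Set.image_preimage_subset _ _)).trans_lt (measure_spanningSets_lt_top _ _)
  · rw [← Set.preimage_iUnion, iUnion_spanningSets, Set.preimage_univ]

/-- The measure `μ(dS) = (det S)^{-(q+1)/2} ∏_{i ≤ j} dSᵢⱼ` on `P⁺(q)`. -/
def mu (q : ℕ) : Measure (PD q) :=
  (lebPD q).withDensity fun S => ENNReal.ofReal (S.1.det ^ (-((q : ℝ) + 1) / 2))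

instance instSigmaFiniteMu (q : ℕ) : SigmaFinite (mu q) :=
  SigmaFinite.withDensity_ofReal _

instance instCompactSpaceOrthogonal (p : ℕ) : CompactSpace (Matrix.orthogonalGroup (Fin p) ℝ) := by
  refine isCompact_iff_compactSpace.1 ?_
  let K : Set (Fin p → Fin p → ℝ) :=
    Set.univ.pi fun _ => Set.univ.pi fun _ => Set.Icc (-1 : ℝ) 1
  have hK : IsCompact K := isCompact_univ_pi fun _ => isCompact_univ_pi fun _ => isCompact_Icc
  have hc : IsClosed ((Matrix.orthogonalGroup (Fin p) ℝ : Set (Matrix (Fin p) (Fin p) ℝ))) :=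
    isClosed_unitary
  refine IsCompact.of_isClosed_subset (X := Mat p p) hK hc ?_
  intro u hu i _ j _
  have := entry_norm_bound_of_unitary hu i j
  rwa [Real.norm_eq_abs, abs_le] at this

instance instBorelSpaceOrthogonal (p : ℕ) : BorelSpace (Matrix.orthogonalGroup (Fin p) ℝ) :=
  Subtype.borelSpace _

/-- The uniform distribution (Haar probability measure) on `𝒪(p)`. -/
def uniformO (p : ℕ) : Measure (Matrix.orthogonalGroup (Fin p) ℝ) :=
  Measure.haarMeasure ⊤

/-- The uniform distribution `d𝖴` on `𝒪(p,q) = {𝖴 ∈ M(p,q) : 𝖴ᵀ𝖴 = I}`, `q ≤ p`, as a measure on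
`M(p,q)`: the law of the first `q` columns of a uniform element of `𝒪(p)`. -/
def uniformStiefel {p q : ℕ} (hqp : q ≤ p) : Measure (Mat p q) :=
  (uniformO p).map fun u => u.1.submatrix id (Fin.castLE hqp)

/-! ### The Matrix-Normal and Inverse-Wishart distributions -/

/-- The Lebesgue density of the Matrix-Normal distribution `N_{p,q}(M, Σ, T)`. -/
def matrixNormalDensity {p q : ℕ} (M : Mat p q) (Sig : PD p) (T : PD q) (X : Mat p q) : ℝ :=
  Real.exp (-(T.1⁻¹ * (X - M)ᵀ * Sig.1⁻¹ * (X - M)).trace / 2) /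
    ((2 * Real.pi) ^ ((p : ℝ) * q / 2) * Sig.1.det ^ ((q : ℝ) / 2) * T.1.det ^ ((p : ℝ) / 2))

/-- The Matrix-Normal distribution `N_{p,q}(M, Σ, T)`. -/
def matrixNormal {p q : ℕ} (M : Mat p q) (Sig : PD p) (T : PD q) : Measure (Mat p q) :=
  (leb p q).withDensity fun X => ENNReal.ofReal (matrixNormalDensity M Sig T X)

/-- The `μ`-density of the Inverse-Wishart distribution `W_q⁻¹(r, T)`. -/
def invWishartDensity {q : ℕ} (r : ℝ) (T S : PD q) : ℝ :=
  T.1.det ^ (r / 2) * Real.exp (-(T.1 * S.1⁻¹).trace / 2) /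
    (2 ^ (r * q / 2) * S.1.det ^ (r / 2) * mvGamma q (r / 2))

/-- The Inverse-Wishart distribution `W_q⁻¹(r, T)`. -/
def invWishart {q : ℕ} (r : ℝ) (T : PD q) : Measure (PD q) :=
  (mu q).withDensity fun S => ENNReal.ofReal (invWishartDensity r T S)

theorem measurable_det_pd (q : ℕ) : Measurable fun S : PD q => S.1.det :=
  (by fun_prop : Continuous fun S : PD q => S.1.det).measurable

theorem measurable_inv_pd (q : ℕ) : Measurable fun S : PD q => S.1⁻¹ :=
  (measurable_inv_mat q).comp measurable_subtype_coe

theorem measurable_invWishartDensity (q : ℕ) (r : ℝ) :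
    Measurable fun z : PD q × PD q => invWishartDensity r z.1 z.2 := by
  unfold invWishartDensity
  have h1 : Measurable fun z : PD q × PD q => z.1.1.det :=
    (measurable_det_pd q).comp measurable_fst
  have h2 : Measurable fun z : PD q × PD q => z.2.1.det :=
    (measurable_det_pd q).comp measurable_snd
  have h3 : Measurable fun z : PD q × PD q => (z.1.1 * z.2.1⁻¹).trace := by
    have hc : Continuous fun w : Mat q q × Mat q q => (w.1 * w.2).trace := by fun_prop
    have ha : Measurable fun z : PD q × PD q => z.1.1 :=
      measurable_subtype_coe.comp measurable_fst
    have hb : Measurable fun z : PD q × PD q => z.2.1⁻¹ :=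
      (measurable_inv_pd q).comp measurable_snd
    have h := hc.measurable.comp (ha.prodMk hb)
    exact h
  exact ((h1.pow_const _).mul ((h3.neg.div_const 2).exp)).div
    (((h2.pow_const _).const_mul _).mul_const _)

theorem measurable_matrixNormalDensity {p q : ℕ} (M : Mat p q) (Sig : PD p) :
    Measurable fun z : PD q × Mat p q => matrixNormalDensity M Sig z.1 z.2 := by
  unfold matrixNormalDensity
  have h1 : Measurable fun z : PD q × Mat p q => z.1.1.det :=
    (measurable_det_pd q).comp measurable_fst
  have h3 : Measurable fun z : PD q × Mat p q =>
      (z.1.1⁻¹ * (z.2 - M)ᵀ * Sig.1⁻¹ * (z.2 - M)).trace := by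
    have hc : Continuous fun w : Mat q q × Mat p q =>
      (w.1 * (w.2 - M)ᵀ * Sig.1⁻¹ * (w.2 - M)).trace := by fun_prop
    have ha : Measurable fun z : PD q × Mat p q => z.1.1⁻¹ :=
      (measurable_inv_pd q).comp measurable_fst
    have h := hc.measurable.comp (ha.prodMk measurable_snd)
    exact h
  exact ((h3.neg.div_const 2).exp).div ((h1.pow_const _).const_mul _)

/-! ### Metropolis–Hastings kernels and Markov chains -/

section MH
variable {E : Type*} [MeasurableSpace E]

open Classical in
/-- The acceptance probability `min {1, π(y)/π(x)}`, equal to `1` where `π(x) = 0`. -/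
def accept (d : E → ℝ≥0) (x y : E) : ℝ≥0 :=
  if d x = 0 then 1 else min 1 (d y / d x)

theorem measurable_accept {d : E → ℝ≥0} (hd : Measurable d) :
    Measurable fun z : E × E => accept d z.1 z.2 := by
  unfold accept
  refine Measurable.ite ((hd.comp measurable_fst) (measurableSet_singleton 0)) measurable_const ?_
  exact measurable_const.min ((hd.comp measurable_snd).div (hd.comp measurable_fst))

/-- The Metropolis–Hastings kernel
`P(x, A) = ∫_A α(x,y) Q(x,dy) + (1 - ∫ α(x,y) Q(x,dy)) δ_x(A)`
with proposal `Q`, where `α(x,y) = min {1, π(y)/π(x)}`. -/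
def mhKernel (Q : Kernel E E) [IsSFiniteKernel Q] (d : E → ℝ≥0) (hd : Measurable d) :
    Kernel E E where
  toFun x := (Q x).withDensity (fun y => (accept d x y : ℝ≥0∞)) +
    (1 - ∫⁻ y, (accept d x y : ℝ≥0∞) ∂(Q x)) • Measure.dirac x
  measurable' := by
    have hα : Measurable (Function.uncurry fun x y => (accept d x y : ℝ≥0∞)) :=
      (measurable_accept hd).coe_nnreal_ennreal
    refine Measure.measurable_of_measurable_coe _ fun A hA => ?_
    simp only [Measure.coe_add, Pi.add_apply, Measure.smul_apply, smul_eq_mul,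
      withDensity_apply _ hA]
    refine Measurable.add ?_ (Measurable.mul ?_ ?_)
    · exact hα.setLIntegral_kernel_prod_right hA
    · exact measurable_const.sub hα.lintegral_kernel_prod_right
    · simp only [Measure.dirac_apply' _ hA]
      exact measurable_one.indicator hA

/-- `(Π, Q, ξ)` is a Metropolis–Hastings triplet with density `d = dΠ/dξ`: `Π` is a probability
measure, `ξ` is σ-finite, `Π(dx) = d(x) ξ(dx)`, and `Q` is a `ξ`-reversible Markov kernel. -/
structure IsMHTriplet (Pi : Measure E) (Q : Kernel E E) (xi : Measure E) (d : E → ℝ≥0) :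
    Prop where
  isProbabilityMeasure : IsProbabilityMeasure Pi
  isMarkovKernel : IsMarkovKernel Q
  sigmaFinite : SigmaFinite xi
  measurable_density : Measurable d
  eq_withDensity : Pi = xi.withDensity fun x => (d x : ℝ≥0∞)
  isReversible : Q.IsReversible xi

/-- Under `P`, the process `X` is a (time-homogeneous) Markov chain with transition kernel `κ`,
with respect to its own filtration `σ(X₀, …, Xₙ)`. -/
structure IsMarkovChain {Ω : Type*} [MeasurableSpace Ω] (P : Measure Ω) (κ : Kernel E E)
    (X : ℕ → Ω → E) : Prop where
  measurable : ∀ n, Measurable (X n)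
  condExp_eq : ∀ (n : ℕ) (A : Set E), MeasurableSet A →
    P[(X (n + 1) ⁻¹' A).indicator (fun _ => (1 : ℝ)) |
        ⨆ k : Fin (n + 1), MeasurableSpace.comap (X k) inferInstance]
      =ᵐ[P] fun ω => (κ (X n ω)).real A

end MH

/-! ### The MpCN proposals -/

theorem mpcn_aux {p q : ℕ} (ρ : ℝ) (U : PD p) {A : Set (Mat p q)} (hA : MeasurableSet A) :
    Measurable fun z : Mat p q × PD q =>
      ((matrixNormal 0 U z.2).map fun w => √ρ • z.1 + √(1 - ρ) • w) A := by
  have hc : Measurable fun z : Mat p q × Mat p q => √ρ • z.1 + √(1 - ρ) • z.2 :=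
    (by fun_prop : Continuous fun z : Mat p q × Mat p q => √ρ • z.1 + √(1 - ρ) • z.2).measurable
  have hg : ∀ x : Mat p q, Measurable fun w : Mat p q => √ρ • x + √(1 - ρ) • w :=
    fun x => hc.comp measurable_prodMk_left
  have h : (fun z : Mat p q × PD q =>
      ((matrixNormal 0 U z.2).map fun w => √ρ • z.1 + √(1 - ρ) • w) A)
      = fun z => ∫⁻ w, (A.indicator 1 (√ρ • z.1 + √(1 - ρ) • w)) *
          ENNReal.ofReal (matrixNormalDensity 0 U z.2 w) ∂(leb p q) := by
    ext1 z
    rw [Measure.map_apply (hg z.1) hA, matrixNormal, withDensity_apply _ (hg z.1 hA),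
      ← lintegral_indicator (hg z.1 hA)]
    refine lintegral_congr fun w => ?_
    by_cases hw : √ρ • z.1 + √(1 - ρ) • w ∈ A <;> simp [Set.indicator, hw]
  rw [h]
  have f1 : Measurable fun y : (Mat p q × PD q) × Mat p q => y.1.1 :=
    measurable_fst.comp measurable_fst
  have f2 : Measurable fun y : (Mat p q × PD q) × Mat p q => y.1.2 :=
    measurable_snd.comp measurable_fst
  have f3 : Measurable fun y : (Mat p q × PD q) × Mat p q => y.2 := measurable_snd
  have m1 : Measurable fun y : (Mat p q × PD q) × Mat p q => √ρ • y.1.1 + √(1 - ρ) • y.2 := by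
    have h := hc.comp (f1.prodMk f3)
    exact h
  have m2 : Measurable fun y : (Mat p q × PD q) × Mat p q =>
      A.indicator (1 : Mat p q → ℝ≥0∞) (√ρ • y.1.1 + √(1 - ρ) • y.2) := by
    have h := (measurable_one.indicator hA : Measurable (A.indicator (1 : Mat p q → ℝ≥0∞))).comp m1
    exact h
  have m3 : Measurable fun y : (Mat p q × PD q) × Mat p q =>
      ENNReal.ofReal (matrixNormalDensity 0 U y.1.2 y.2) := by
    have h := (measurable_matrixNormalDensity (0 : Mat p q) U).comp (f2.prodMk f3)
    exact h.ennreal_ofReal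
  have h := (m2.mul m3).lintegral_prod_right' (ν := leb p q)
  exact h

theorem measurable_mpcn {p q : ℕ} (ρ : ℝ) (U : PD p) :
    Measurable fun x : Mat p q => (invWishart (p : ℝ) (gram U x)).bind fun V =>
      (matrixNormal 0 U V).map fun w => √ρ • x + √(1 - ρ) • w := by
  have g2 : ∀ (x : Mat p q) {A : Set (Mat p q)}, MeasurableSet A → Measurable fun V : PD q =>
      ((matrixNormal 0 U V).map fun w => √ρ • x + √(1 - ρ) • w) A := by
    intro x A hA
    have h := (mpcn_aux ρ U hA).comp (measurable_prodMk_left (x := x))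
    exact h
  have hm : ∀ x : Mat p q, Measurable fun V : PD q =>
      (matrixNormal 0 U V).map fun w => √ρ • x + √(1 - ρ) • w := fun x =>
    Measure.measurable_of_measurable_coe _ fun B hB => g2 x hB
  have hw : Measurable fun z : Mat p q × PD q =>
      ENNReal.ofReal (invWishartDensity (p : ℝ) (gram U z.1) z.2) := by
    have f1 : Measurable fun z : Mat p q × PD q => gram U z.1 :=
      (measurable_gram U).comp measurable_fst
    have h := (measurable_invWishartDensity q p).comp (f1.prodMk measurable_snd)
    exact h.ennreal_ofReal
  have g1 : ∀ x : Mat p q, Measurable fun V : PD q =>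
      ENNReal.ofReal (invWishartDensity (p : ℝ) (gram U x) V) := by
    intro x
    have h := hw.comp (measurable_prodMk_left (x := x))
    exact h
  refine Measure.measurable_of_measurable_coe _ fun A hA => ?_
  have h : (fun x : Mat p q => ((invWishart (p : ℝ) (gram U x)).bind fun V =>
      (matrixNormal 0 U V).map fun w => √ρ • x + √(1 - ρ) • w) A)
      = fun x => ∫⁻ V, ENNReal.ofReal (invWishartDensity (p : ℝ) (gram U x) V) *
        ((matrixNormal 0 U V).map fun w => √ρ • x + √(1 - ρ) • w) A ∂(mu q) := by
    ext1 x
    rw [Measure.bind_apply hA (hm x).aemeasurable, invWishart,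
      lintegral_withDensity_eq_lintegral_mul _ (g1 x) (g2 x hA)]
    rfl
  rw [h]
  have h' := (hw.mul (mpcn_aux ρ U hA)).lintegral_prod_right' (ν := mu q)
  exact h'

/-- The MpCN proposal kernel `Q(·; ρ, U)` on `M(p,q)`: `Q(x, ·)` is the law of
`y = ρ^{1/2} x + (1-ρ)^{1/2} w`, where `w ∼ N_{p,q}(0, U, V)` given `V` and
`V ∼ W_q⁻¹(p, xᵀ U⁻¹ x)`. -/
def mpcnProposal {p q : ℕ} (ρ : ℝ) (U : PD p) : Kernel (Mat p q) (Mat p q) where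
  toFun x := (invWishart (p : ℝ) (gram U x)).bind fun V =>
    (matrixNormal 0 U V).map fun w => √ρ • x + √(1 - ρ) • w
  measurable' := measurable_mpcn ρ U

theorem isSFiniteKernel_of_map {α β γ : Type*} [MeasurableSpace α] [MeasurableSpace β]
    [MeasurableSpace γ] {η : Kernel α β} [IsSFiniteKernel η] {g : α × β → γ} (hg : Measurable g)
    {κ : Kernel α γ} (h : ∀ x, κ x = (η x).map fun b => g (x, b)) : IsSFiniteKernel κ := by
  have key : κ = (η ⊗ₖ Kernel.deterministic g hg).snd := by
    ext x A hA
    have hgx : Measurable fun b => g (x, b) := hg.comp measurable_prodMk_left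
    rw [h, Kernel.snd_apply' _ _ hA, Kernel.compProd_apply (measurable_snd hA),
      Measure.map_apply hgx hA, ← lintegral_indicator_one (hgx hA)]
    refine lintegral_congr fun b => ?_
    exact (Measure.dirac_apply' (g (x, b)) hA).symm
  rw [key]
  infer_instance

theorem isSFiniteKernel_of_bind {α β γ : Type*} [MeasurableSpace α] [MeasurableSpace β]
    [MeasurableSpace γ] {η : Kernel α β} [IsSFiniteKernel η] {θ : Kernel (α × β) γ}
    [IsSFiniteKernel θ] {κ : Kernel α γ} (h : ∀ x, κ x = (η x).bind fun b => θ (x, b)) :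
    IsSFiniteKernel κ := by
  have key : κ = (η ⊗ₖ θ).snd := by
    ext x A hA
    have hθ : Measurable fun b => θ (x, b) := θ.measurable.comp measurable_prodMk_left
    rw [h, Kernel.snd_apply' _ _ hA, Kernel.compProd_apply (measurable_snd hA),
      Measure.bind_apply hA hθ.aemeasurable]
    rfl
  rw [key]
  infer_instance

instance instIsSFiniteKernelMpcnProposal {p q : ℕ} (ρ : ℝ) (U : PD p) :
    IsSFiniteKernel (mpcnProposal ρ U : Kernel (Mat p q) (Mat p q)) := by
  let η : Kernel (Mat p q) (PD q) := Kernel.withDensity (Kernel.const _ (mu q))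
    fun x V => ENNReal.ofReal (invWishartDensity (p : ℝ) (gram U x) V)
  have hη : IsSFiniteKernel η := Kernel.IsSFiniteKernel.withDensity _ fun _ _ =>
    ENNReal.ofReal_ne_top
  let θ₀ : Kernel (Mat p q × PD q) (Mat p q) := Kernel.withDensity (Kernel.const _ (leb p q))
    fun z w => ENNReal.ofReal (matrixNormalDensity 0 U z.2 w)
  have hθ₀ : IsSFiniteKernel θ₀ := Kernel.IsSFiniteKernel.withDensity _ fun _ _ =>
    ENNReal.ofReal_ne_top
  have hη' : ∀ x, η x = invWishart (p : ℝ) (gram U x) := by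
    intro x
    refine (Kernel.withDensity_apply _ ?_ x).trans rfl
    have f1 : Measurable fun z : Mat p q × PD q => gram U z.1 :=
      (measurable_gram U).comp measurable_fst
    have h := (measurable_invWishartDensity q p).comp (f1.prodMk measurable_snd)
    exact h.ennreal_ofReal
  have hθ₀' : ∀ z, θ₀ z = matrixNormal 0 U z.2 := by
    intro z
    refine (Kernel.withDensity_apply _ ?_ z).trans rfl
    have f2 : Measurable fun y : (Mat p q × PD q) × Mat p q => y.1.2 :=
      measurable_snd.comp measurable_fst
    have h := (measurable_matrixNormalDensity (0 : Mat p q) U).comp (f2.prodMk measurable_snd)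
    exact h.ennreal_ofReal
  let θ : Kernel (Mat p q × PD q) (Mat p q) :=
    { toFun := fun z => (matrixNormal 0 U z.2).map fun w => √ρ • z.1 + √(1 - ρ) • w
      measurable' := Measure.measurable_of_measurable_coe _ fun A hA => mpcn_aux ρ U hA }
  have hθ : IsSFiniteKernel θ := by
    have hc : Continuous fun z : Mat p q × Mat p q => √ρ • z.1 + √(1 - ρ) • z.2 := by fun_prop
    have f1 : Measurable fun y : (Mat p q × PD q) × Mat p q => y.1.1 :=
      measurable_fst.comp measurable_fst
    have hg := hc.measurable.comp (f1.prodMk measurable_snd)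
    refine isSFiniteKernel_of_map (η := θ₀) hg fun z => ?_
    rw [hθ₀']
    rfl
  refine isSFiniteKernel_of_bind (η := η) (θ := θ) fun x => ?_
  rw [hη']
  rfl

/-- The law `𝓛` on `P⁺(q)`, for parameters `ρ` and `p ≥ q`: with `𝖴₁` the first `q` rows of `𝖴`,
`𝓛(dε) = (1-ρ)^{pq/2} Γ_q(p)/Γ_q(p/2)² μ(dε)
  ∫_{𝒪(p,q)} det(ε)^{p/2} / det(I + ε - ρ^{1/2}(𝖴₁ ε^{1/2} + ε^{1/2} 𝖴₁ᵀ))^p d𝖴`. -/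
def incrementLaw {p q : ℕ} (hqp : q ≤ p) (ρ : ℝ) : Measure (PD q) :=
  (mu q).withDensity fun e =>
    ENNReal.ofReal ((1 - ρ) ^ ((p : ℝ) * q / 2) * (mvGamma q p / mvGamma q ((p : ℝ) / 2) ^ 2)) *
    ∫⁻ u : Mat p q, ENNReal.ofReal (e.1.det ^ ((p : ℝ) / 2) /
      (1 + e.1 - √ρ • (u.submatrix (Fin.castLE hqp) id * e.sqrt.1 +
        e.sqrt.1 * (u.submatrix (Fin.castLE hqp) id)ᵀ)).det ^ p) ∂(uniformStiefel hqp)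

instance instSFiniteIncrementLaw {p q : ℕ} (hqp : q ≤ p) (ρ : ℝ) :
    SFinite (incrementLaw hqp ρ) := by
  unfold incrementLaw; infer_instance

theorem measurable_map_of_uncurry {α : Type*} [MeasurableSpace α] {f : α → α → α}
    (hf : Measurable (Function.uncurry f)) (L : Measure α) [SFinite L] :
    Measurable fun S : α => L.map fun e => f e S := by
  have hc : Measurable (Function.uncurry fun S e : α => f e S) := hf.comp measurable_swap
  have hS : ∀ S : α, Measurable fun e : α => f e S := fun S =>
    hc.comp measurable_prodMk_left
  refine Measure.measurable_of_measurable_coe _ fun A hA => ?_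
  have h : (fun S : α => (L.map fun e => f e S) A)
      = fun S => L (Prod.mk S ⁻¹' ((Function.uncurry fun S e : α => f e S) ⁻¹' A)) := by
    ext1 S
    rw [Measure.map_apply (hS S) hA]
    rfl
  rw [h]
  exact measurable_measure_prodMk_left (hc hA)

/-- The proposal kernel on `P⁺(q)` for which `Q̃(S, ·)` is the law of `ε ∘ S`, `ε ∼ 𝓛`. -/
def inducedProposal {p q : ℕ} (hqp : q ≤ p) (ρ : ℝ) : Kernel (PD q) (PD q) where
  toFun S := (incrementLaw hqp ρ).map fun e => PD.circ e S
  measurable' := measurable_map_of_uncurry (PD.measurable_circ q) _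

instance instIsSFiniteKernelInducedProposal {p q : ℕ} (hqp : q ≤ p) (ρ : ℝ) :
    IsSFiniteKernel (inducedProposal hqp ρ) :=
  isSFiniteKernel_of_map (η := Kernel.const _ (incrementLaw hqp ρ))
    ((PD.measurable_circ q).comp measurable_swap) fun _ => rfl

/-- Under `P`, `T` is a random walk `Tₙ = εₙ ∘ Tₙ₋₁`, `n ≥ 1`, on `P⁺(q)`: the increments
`ε₁, ε₂, …` have law `L`, and `T₀, ε₁, ε₂, …` are independent. (`ε 0` plays no role.) -/
structure IsRandomWalk {q : ℕ} {Ω : Type*} [MeasurableSpace Ω] (P : Measure Ω)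
    (L : Measure (PD q)) (ε T : ℕ → Ω → PD q) : Prop where
  measurable_zero : Measurable (T 0)
  measurable_increment : ∀ n, 1 ≤ n → Measurable (ε n)
  map_increment : ∀ n, 1 ≤ n → P.map (ε n) = L
  indep : iIndepFun (fun n : ℕ => if n = 0 then T 0 else ε n) P
  step : ∀ n, 1 ≤ n → ∀ ω, T n ω = PD.circ (ε n ω) (T (n - 1) ω)

end MpCN

end

open MeasureTheory ProbabilityTheory Matrix
open scoped NNReal ENNReal

noncomputable section

namespace MpCN

/-! ### Lebesgue measure on matrix spaces -/

/-! The proof rests on one density computation and on orthogonal invariance.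

Let `x` have full rank and `T = xᵀU⁻¹x`. Integrating out `V` is a conjugate computation
(`lintegral_mixture`): `w` has a Lebesgue density proportional to `det(T + wᵀU⁻¹w)^(-p)`. For `y =
√ρ x + √(1-ρ) w`, the matrix `(1-ρ)(T + wᵀU⁻¹w)` expands to `pairMat ρ U x y`, which is symmetric in
`x` and `y`. Relative to `ν_U` the whole proposal density is then symmetric
(`mpcnProposal_eq_withDensity`), and this is the reversibility of `Q`.

The passage to `P⁺(q)` uses that `x ↦ xᵀU⁻¹x` carries `ν_U` to `μ`. This follows from the image of
Lebesgue measure under `x ↦ xᵀx` (`lintegral_gram_mat`), found by adding one column at a time: a new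
column contributes a border and a Schur complement to the Gram matrix, and the Schur complement is a
squared radius in `ℝ^(p-q)`. In polar coordinates `y = U^{1/2} 𝖴 S^{1/2}`, `ν_U` is the product of
`μ` and the uniform law of `𝖴` (`lintegral_nu_polar`). Put `S = ε ∘ T`. The matrices `S^{1/2}` and
`ε^{1/2} T^{1/2}` differ by an orthogonal factor; Haar invariance absorbs it together with the frame
of `x`, and `pairMat` becomes `T^{1/2}(I + ε - √ρ(𝖴₁ε^{1/2} + ε^{1/2}𝖴₁ᵀ))T^{1/2}`. The powers of
`det T` cancel, so the proposed Gram matrix is `ε ∘ T` with `ε ∼ 𝓛` (`lintegral_mpcnProposal_gram`).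
It depends on `x` through `T` only. Consequently `𝓛` has mass one, and `Q̃` inherits reversibility
from `Q`.

The acceptance probability also sees only Gram matrices, so the two Metropolis–Hastings kernels are
intertwined (`map_mhKernel`). A function of a Markov chain whose kernel is so intertwined is again
Markov in its own filtration (`IsMarkovChain.map`). The chain stays at full rank because proposals
charge no null set.

For `𝓛 = 𝓛₋₁`: when `p = q`, `ν_I` is a two-sided Haar measure on the invertible matrices, hence
inversion invariant, and so is its image `μ`. The density of `𝓛` is unchanged under `ε ↦ ε⁻¹`
because this transposes `𝖴₁`, as does `𝖴 ↦ 𝖴⁻¹`, which preserves Haar measure. -/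

theorem measurePreserving_uncurry (p q : ℕ) :
    MeasurePreserving (fun (x : Mat p q) (ij : Fin p × Fin q) => x ij.1 ij.2) (leb p q)
      volume where
  measurable := measurable_pi_lambda _ fun ij =>
    (measurable_pi_apply ij.2).comp (measurable_pi_apply (X := fun _ : Fin p => Fin q → ℝ) ij.1)
  map_eq := by
    refine (Measure.pi_eq fun s hs => ?_).symm
    rw [Measure.map_apply _ (MeasurableSet.univ_pi hs)]
    · have : (fun (x : Mat p q) (ij : Fin p × Fin q) => x ij.1 ij.2) ⁻¹' Set.univ.pi s
          = Set.univ.pi fun i => Set.univ.pi fun j => s (i, j) := by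
        ext x
        exact ⟨fun h i _ j _ => h (i, j) trivial, fun h ij _ => h ij.1 trivial ij.2 trivial⟩
      rw [this, leb]
      erw [Measure.pi_pi]
      simp [volume_pi, Measure.pi_pi, Fintype.prod_prod_type]
    · exact measurable_pi_lambda _ fun ij =>
        (measurable_pi_apply ij.2).comp
          (measurable_pi_apply (X := fun _ : Fin p => Fin q → ℝ) ij.1)

theorem measurePreserving_uncurry_swap (p q : ℕ) :
    MeasurePreserving (fun (x : Mat p q) (ij : Fin q × Fin p) => x ij.2 ij.1) (leb p q)
      volume where
  measurable := measurable_pi_lambda _ fun ij =>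
    (measurable_pi_apply ij.1).comp (measurable_pi_apply (X := fun _ : Fin p => Fin q → ℝ) ij.2)
  map_eq := by
    refine (Measure.pi_eq fun s hs => ?_).symm
    rw [Measure.map_apply _ (MeasurableSet.univ_pi hs)]
    · have : (fun (x : Mat p q) (ij : Fin q × Fin p) => x ij.2 ij.1) ⁻¹' Set.univ.pi s
          = Set.univ.pi fun i => Set.univ.pi fun j => s (j, i) := by
        ext x
        exact ⟨fun h i _ j _ => h (j, i) trivial, fun h ij _ => h ij.2 trivial ij.1 trivial⟩
      rw [this, leb]
      erw [Measure.pi_pi]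
      simp [volume_pi, Measure.pi_pi, Fintype.prod_prod_type_right]
    · exact measurable_pi_lambda _ fun ij =>
        (measurable_pi_apply ij.1).comp
          (measurable_pi_apply (X := fun _ : Fin p => Fin q → ℝ) ij.2)

theorem measurable_transpose_mat (p q : ℕ) : Measurable (Matrix.transpose : Mat p q → Mat q p) :=
  (by fun_prop : Continuous (Matrix.transpose : Mat p q → Mat q p)).measurable

theorem measurePreserving_transpose (p q : ℕ) :
    MeasurePreserving (Matrix.transpose : Mat p q → Mat q p) (leb p q) (leb q p) where
  measurable := measurable_transpose_mat p q
  map_eq := by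
    have h1 := (measurePreserving_uncurry q p)
    have h2 := (measurePreserving_uncurry_swap p q)
    have hm := measurable_transpose_mat p q
    let g : (Fin q × Fin p → ℝ) → Mat q p := fun y => Matrix.of fun i j => y (i, j)
    have hg : Measurable g := measurable_pi_lambda _ fun i => measurable_pi_lambda _ fun j =>
      measurable_pi_apply (i, j)
    have e1 : leb q p = (volume : Measure (Fin q × Fin p → ℝ)).map g := by
      rw [← h1.map_eq, Measure.map_map hg h1.measurable]
      exact (Measure.map_id (μ := leb q p)).symm
    rw [e1, ← h2.map_eq, Measure.map_map hg h2.measurable]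
    rfl

/-- The matrix with first column `v` and remaining columns `z`. -/
def consCol {p q : ℕ} (v : Fin p → ℝ) (z : Mat p q) : Mat p (q + 1) :=
  Matrix.of fun i => Fin.cons (v i) (z i)

theorem measurable_consCol (p q : ℕ) :
    Measurable fun a : (Fin p → ℝ) × Mat p q => consCol a.1 a.2 := by
  refine measurable_pi_lambda _ fun i => measurable_pi_lambda _ fun j => ?_
  refine Fin.cases ?_ (fun j => ?_) j
  · exact (measurable_pi_apply i).comp measurable_fst
  · exact (measurable_pi_apply j).comp
      ((measurable_pi_apply (X := fun _ : Fin p => Fin q → ℝ) i).comp measurable_snd)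

/-- Matrices are stored by rows, so the first column is split off after a transposition that turns
it into the first row. This drives the inductions on the number of columns. -/
theorem lintegral_leb_succ {p q : ℕ} {f : Mat p (q + 1) → ℝ≥0∞} (hf : Measurable f) :
    ∫⁻ x, f x ∂leb p (q + 1) = ∫⁻ z, (∫⁻ v : Fin p → ℝ, f (consCol v z)) ∂leb p q := by
  have h1 := measurePreserving_transpose (q + 1) p
  rw [← h1.lintegral_comp hf]
  have h2 := (volume_preserving_piFinSuccAbove (fun _ : Fin (q + 1) => Fin p → ℝ) 0).symm
  have e2 : ∫⁻ y, f yᵀ ∂leb (q + 1) p = _ :=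
    (h2.lintegral_comp (hf.comp h1.measurable)).symm
  rw [e2]
  have hm : Measurable fun a : (Fin p → ℝ) × Mat p q => f (consCol a.1 a.2) :=
    hf.comp (measurable_consCol p q)
  have h3 := ((MeasurePreserving.id (volume : Measure (Fin p → ℝ))).prod
    (measurePreserving_transpose p q))
  rw [lintegral_lintegral_symm (f := fun z v => f (consCol v z))
    (hm.comp measurable_swap).aemeasurable]
  have h4 := h3.symm (MeasurableEquiv.prodCongr (MeasurableEquiv.refl _)
    ⟨⟨Matrix.transpose, Matrix.transpose, fun x => rfl, fun x => rfl⟩,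
      measurable_transpose_mat p q, measurable_transpose_mat q p⟩)
  rw [← h4.lintegral_comp hm]
  refine lintegral_congr fun a => ?_
  refine congrArg f (Matrix.ext fun i j => ?_)
  refine Fin.cases ?_ (fun j => ?_) j
  · rfl
  · rfl

/-- Right multiplication acts on each of the `p` rows separately by `gᵀ`, so the Jacobian is the
`p`-th power of that of one row. -/
theorem lintegral_leb_mul_right {p q : ℕ} {g : Mat q q} (hg : g.det ≠ 0) {f : Mat p q → ℝ≥0∞}
    (hf : Measurable f) :
    ∫⁻ x, f (x * g) ∂leb p q = ENNReal.ofReal (|g.det|⁻¹ ^ p) * ∫⁻ x, f x ∂leb p q := by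
  have h0 := Real.map_matrix_volume_pi_eq_smul_volume_pi (M := gᵀ) (by rwa [det_transpose])
  have hmeas : Measurable (toLin' gᵀ) := LinearMap.continuous_on_pi _ |>.measurable
  have : ∀ i : Fin p, SigmaFinite ((volume : Measure (Fin q → ℝ)).map (toLin' gᵀ)) := by
    intro i; rw [h0]; exact SMul.sigmaFinite (Real.toNNReal |gᵀ.det⁻¹|)
  have h1 := Measure.pi_map_pi (μ := fun _ : Fin p => (volume : Measure (Fin q → ℝ)))
    (f := fun _ => toLin' gᵀ) (hμ := this) (fun _ => hmeas.aemeasurable)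
  have h2 : (@Measure.pi (Fin p) _ _ _ fun _ : Fin p =>
      (volume : Measure (Fin q → ℝ)).map (toLin' gᵀ))
      = ENNReal.ofReal (|g.det|⁻¹ ^ p) • leb p q := by
    refine @Measure.pi_eq _ _ _ _ _ this _ fun s hs => ?_
    rw [h0]
    have h4 : leb p q (Set.univ.pi s) = ∏ i, (volume : Measure (Fin q → ℝ)) (s i) :=
      Measure.pi_pi _ _
    have h5 : (ENNReal.ofReal (|g.det|⁻¹ ^ p) • leb p q) (Set.univ.pi s)
        = ENNReal.ofReal (|g.det|⁻¹ ^ p) * leb p q (Set.univ.pi s) := rfl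
    refine h5.trans ?_
    rw [h4, ENNReal.ofReal_pow (by positivity)]
    simp [Finset.prod_mul_distrib, abs_inv]
  have h3 : (leb p q).map (fun x : Mat p q => x * g)
      = ENNReal.ofReal (|g.det|⁻¹ ^ p) • leb p q := by
    rw [← h2, ← h1]
    congr 1
    ext x i j
    simp [Matrix.mul_apply, toLin'_apply, mulVec, dotProduct, mul_comm]
  have hm : Measurable fun x : Mat p q => x * g :=
    (by fun_prop : Continuous fun x : Mat p q => x * g).measurable
  rw [← lintegral_map hf hm, h3, lintegral_smul_measure, smul_eq_mul]

theorem lintegral_leb_mul_left {p q : ℕ} {g : Mat p p} (hg : g.det ≠ 0) {f : Mat p q → ℝ≥0∞}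
    (hf : Measurable f) :
    ∫⁻ x, f (g * x) ∂leb p q = ENNReal.ofReal (|g.det|⁻¹ ^ q) * ∫⁻ x, f x ∂leb p q := by
  have hm : Measurable fun x : Mat p q => g * x :=
    (by fun_prop : Continuous fun x : Mat p q => g * x).measurable
  have h1 := measurePreserving_transpose q p
  have h2 := lintegral_leb_mul_right (p := q) (g := gᵀ) (by rwa [det_transpose])
    (hf.comp h1.measurable)
  have h3 := h1.lintegral_comp (hf.comp hm)
  have h4 := h1.lintegral_comp hf
  simp only [Function.comp_def, det_transpose, Matrix.transpose_mul, transpose_transpose] at h2 h3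
  rw [← h3, h2, h4]

/-! ### Radial integration -/

/-- The constant `π^{m/2} / Γ(m/2)`, half the area of the unit sphere of `ℝᵐ`. -/
def sphereConst (m : ℕ) : ℝ := Real.pi ^ ((m : ℝ) / 2) / Real.Gamma ((m : ℝ) / 2)

theorem sphereConst_pos {m : ℕ} (hm : 0 < m) : 0 < sphereConst m := by
  have : (0 : ℝ) < m := by exact_mod_cast hm
  exact div_pos (Real.rpow_pos_of_pos Real.pi_pos _) (Real.Gamma_pos_of_pos (by positivity))

theorem volume_dotProduct_self_le {m : ℕ} (hm : 0 < m) {t : ℝ} (ht : 0 ≤ t) :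
    volume {w : Fin m → ℝ | w ⬝ᵥ w ≤ t}
      = ENNReal.ofReal (Real.pi ^ ((m : ℝ) / 2) / Real.Gamma ((m : ℝ) / 2 + 1) *
        t ^ ((m : ℝ) / 2)) := by
  have : Nonempty (Fin m) := ⟨⟨0, hm⟩⟩
  have h1 := EuclideanSpace.volume_closedBall (Fin m) 0 (√t)
  rw [← (PiLp.volume_preserving_toLp (Fin m)).measure_preimage
    measurableSet_closedBall.nullMeasurableSet] at h1
  have h2 : (WithLp.toLp 2 ⁻¹' Metric.closedBall (0 : EuclideanSpace ℝ (Fin m)) (√t))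
      = {w : Fin m → ℝ | w ⬝ᵥ w ≤ t} := by
    ext w
    simp only [Set.mem_preimage, Metric.mem_closedBall, dist_zero_right, EuclideanSpace.norm_eq,
      Set.mem_ofPred_eq, dotProduct]
    rw [Real.sqrt_le_sqrt_iff ht]
    simp [pow_two]
  rw [h2] at h1
  rw [h1, ← ENNReal.ofReal_pow (Real.sqrt_nonneg _), ← ENNReal.ofReal_mul (by positivity)]
  congr 1
  rw [Fintype.card_fin, Real.sqrt_eq_rpow, Real.sqrt_eq_rpow, ← Real.rpow_natCast,
    ← Real.rpow_mul ht, ← Real.rpow_natCast, ← Real.rpow_mul Real.pi_pos.le,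
    show (1 / 2 : ℝ) * m = m / 2 by ring]
  ring

/-- Both measures are compared on the half-lines `(-∞, t]`, where the left side is the volume of a
ball of radius `√t`. These values are finite, so they determine the measure. -/
theorem map_dotProduct_self {m : ℕ} (hm : 0 < m) :
    (volume : Measure (Fin m → ℝ)).map (fun w => w ⬝ᵥ w)
      = (volume.restrict (Set.Ioi 0)).withDensity fun r =>
        ENNReal.ofReal (sphereConst m * r ^ ((m : ℝ) / 2 - 1)) := by
  have hm' : (0 : ℝ) < m := by exact_mod_cast hm
  have hw : Measurable fun w : Fin m → ℝ => w ⬝ᵥ w :=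
    (by fun_prop : Continuous fun w : Fin m → ℝ => w ⬝ᵥ w).measurable
  have hG : Real.Gamma ((m : ℝ) / 2 + 1) = m / 2 * Real.Gamma ((m : ℝ) / 2) :=
    Real.Gamma_add_one (by positivity)
  have hGp : 0 < Real.Gamma ((m : ℝ) / 2) := Real.Gamma_pos_of_pos (by positivity)
  have key : ∀ t : ℝ, (volume : Measure (Fin m → ℝ)).map (fun w => w ⬝ᵥ w) (Set.Iic t)
      = ((volume.restrict (Set.Ioi 0)).withDensity fun r =>
        ENNReal.ofReal (sphereConst m * r ^ ((m : ℝ) / 2 - 1))) (Set.Iic t) := by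
    intro t
    rw [Measure.map_apply hw measurableSet_Iic, withDensity_apply _ measurableSet_Iic,
      Measure.restrict_restrict measurableSet_Iic]
    change volume {w : Fin m → ℝ | w ⬝ᵥ w ≤ t} = _
    rcases lt_or_ge t 0 with ht | ht
    · have e1 : {w : Fin m → ℝ | w ⬝ᵥ w ≤ t} = ∅ := by
        ext w
        have := dotProduct_star_self_nonneg w
        simp only [star_trivial] at this
        simp; linarith
      have e2 : Set.Iic t ∩ Set.Ioi 0 = ∅ := by
        ext r; simp only [Set.mem_inter_iff, Set.mem_Iic, Set.mem_Ioi, Set.mem_empty_iff_false]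
        exact ⟨fun h => by linarith [h.1, h.2], False.elim⟩
      simp [e1, e2]
    · rw [volume_dotProduct_self_le hm ht, Set.inter_comm, Set.Ioi_inter_Iic]
      have hi : IntervalIntegrable (fun r : ℝ => sphereConst m * r ^ ((m : ℝ) / 2 - 1))
          volume 0 t :=
        (intervalIntegral.intervalIntegrable_rpow' (by linarith)).const_mul _
      rw [intervalIntegrable_iff_integrableOn_Ioc_of_le ht] at hi
      rw [← ofReal_integral_eq_lintegral_ofReal hi]
      · rw [← intervalIntegral.integral_of_le ht, intervalIntegral.integral_const_mul,
          integral_rpow (Or.inl (by linarith)), sub_add_cancel,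
          Real.zero_rpow (by positivity), sub_zero, hG, sphereConst]
        congr 1
        field_simp
      · refine (ae_restrict_iff' measurableSet_Ioc).2 (ae_of_all _ fun r hr => ?_)
        exact mul_nonneg (sphereConst_pos hm).le (Real.rpow_nonneg hr.1.le _)
  refine Measure.ext_of_generateFrom_of_iUnion (Set.range Set.Iic) (fun n : ℕ => Set.Iic (n : ℝ))
    (borel_eq_generateFrom_Iic ℝ ▸ BorelSpace.measurable_eq) isPiSystem_Iic
    ?_ (fun n => ⟨_, rfl⟩) ?_ ?_
  · ext x; simpa using exists_nat_ge x
  · intro n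
    rw [Measure.map_apply hw measurableSet_Iic]
    change volume {w : Fin m → ℝ | w ⬝ᵥ w ≤ n} ≠ _
    rw [volume_dotProduct_self_le hm (Nat.cast_nonneg n)]
    exact ENNReal.ofReal_ne_top
  · rintro _ ⟨t, rfl⟩; exact key t

theorem lintegral_dotProduct_self {m : ℕ} (hm : 0 < m) {f : ℝ → ℝ≥0∞} (hf : Measurable f) :
    ∫⁻ w : Fin m → ℝ, f (w ⬝ᵥ w)
      = ∫⁻ r in Set.Ioi 0, ENNReal.ofReal (sphereConst m * r ^ ((m : ℝ) / 2 - 1)) * f r := by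
  have hw : Measurable fun w : Fin m → ℝ => w ⬝ᵥ w :=
    (by fun_prop : Continuous fun w : Fin m → ℝ => w ⬝ᵥ w).measurable
  rw [← lintegral_map hf hw, map_dotProduct_self hm, lintegral_withDensity_eq_lintegral_mul _ _ hf]
  · rfl
  · exact ((measurable_id.pow_const _).const_mul _).ennreal_ofReal

/-! ### Gaussian integral -/

theorem lintegral_exp_dotProduct (m : ℕ) :
    ∫⁻ w : Fin m → ℝ, ENNReal.ofReal (Real.exp (-(w ⬝ᵥ w)))
      = ENNReal.ofReal (Real.pi ^ ((m : ℝ) / 2)) := by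
  have h := GaussianFourier.integral_rexp_neg_mul_sq_norm (V := EuclideanSpace ℝ (Fin m))
    one_pos
  have hi := (GaussianFourier.integrable_cexp_neg_mul_sq_norm_add_of_euclideanSpace
    (ι := Fin m) (b := 1) (by simp) 0 0).re
  have h1 := ofReal_integral_eq_lintegral_ofReal
    (f := fun v : EuclideanSpace ℝ (Fin m) => Real.exp (-1 * ‖v‖ ^ 2)) (μ := volume) (by
      refine hi.congr (ae_of_all _ fun v => ?_)
      simp [← Complex.ofReal_pow, ← Complex.ofReal_neg, ← Complex.ofReal_exp])
    (ae_of_all _ fun v => (Real.exp_pos _).le)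
  rw [h] at h1
  rw [show (Real.pi ^ ((m : ℝ) / 2)) = (Real.pi / 1) ^
    ((Module.finrank ℝ (EuclideanSpace ℝ (Fin m)) : ℝ) / 2) by simp, h1,
    ← (PiLp.volume_preserving_toLp (Fin m)).lintegral_comp (by fun_prop)]
  refine lintegral_congr fun w => ?_
  congr 2
  rw [EuclideanSpace.norm_sq_eq]
  simp [dotProduct, pow_two]

/-- The trace is the sum of the squared column norms, so the integral factorises over columns. The
normalisations of the Wishart-type integrals below come from this one. -/
theorem lintegral_exp_trace (p q : ℕ) :
    ∫⁻ x, ENNReal.ofReal (Real.exp (-(xᵀ * x).trace)) ∂leb p q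
      = ENNReal.ofReal (Real.pi ^ ((p : ℝ) * q / 2)) := by
  induction q with
  | zero =>
    have : ∀ x : Mat p 0, (xᵀ * x).trace = 0 := fun x => by simp [Matrix.trace]
    have h1 : leb p 0 Set.univ = 1 := by
      rw [leb]; exact (Measure.pi_univ _).trans (by simp [volume_pi])
    simp [h1]
  | succ q ih =>
    have hc : Measurable fun x : Mat p (q + 1) => ENNReal.ofReal (Real.exp (-(xᵀ * x).trace)) :=
      (by fun_prop : Continuous fun x : Mat p (q + 1) =>
        Real.exp (-(xᵀ * x).trace)).measurable.ennreal_ofReal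
    rw [lintegral_leb_succ hc]
    have h1 : ∀ (v : Fin p → ℝ) (z : Mat p q), ((consCol v z)ᵀ * consCol v z).trace
        = v ⬝ᵥ v + (zᵀ * z).trace := by
      intro v z
      simp [Matrix.trace, Fin.sum_univ_succ, Matrix.mul_apply, consCol, dotProduct]
    have hz : Measurable fun z : Mat p q => ENNReal.ofReal (Real.exp (-(zᵀ * z).trace)) :=
      (by fun_prop : Continuous fun x : Mat p q =>
        Real.exp (-(xᵀ * x).trace)).measurable.ennreal_ofReal
    have hv : Measurable fun w : Fin p → ℝ => ENNReal.ofReal (Real.exp (-(w ⬝ᵥ w))) :=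
      (by fun_prop : Continuous fun w : Fin p → ℝ =>
        Real.exp (-(w ⬝ᵥ w))).measurable.ennreal_ofReal
    simp_rw [h1, neg_add, Real.exp_add, ENNReal.ofReal_mul (Real.exp_pos _).le,
      lintegral_mul_const _ hv, lintegral_exp_dotProduct]
    rw [lintegral_const_mul _ hz, ih, ← ENNReal.ofReal_mul (by positivity),
      ← Real.rpow_add Real.pi_pos]
    congr 2
    push_cast; ring

/-! ### Lebesgue measure in the coordinates `i ≤ j` of a symmetric matrix -/

section PiTools
variable {ι κ : Type*}

theorem lintegral_pi_reindex [Fintype ι] [Fintype κ] (σ : ι ≃ κ)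
    {f : (κ → ℝ) → ℝ≥0∞} (hf : Measurable f) :
    ∫⁻ s, f s = ∫⁻ s : ι → ℝ, f (s ∘ σ.symm) := by
  have h := volume_measurePreserving_piCongrLeft (fun _ : κ => ℝ) σ
  rw [← h.lintegral_comp hf]
  refine lintegral_congr fun s => congrArg f ?_
  ext k
  obtain ⟨i, rfl⟩ := σ.surjective k
  rw [MeasurableEquiv.coe_piCongrLeft]
  simp [Equiv.piCongrLeft_apply_apply]

theorem measurable_sumElim :
    Measurable fun a : (ι → ℝ) × (κ → ℝ) => (Sum.elim a.1 a.2 : ι ⊕ κ → ℝ) := by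
  refine measurable_pi_lambda _ fun i => ?_
  rcases i with i | i
  · exact (measurable_pi_apply i).comp measurable_fst
  · exact (measurable_pi_apply i).comp measurable_snd

theorem lintegral_pi_sum [Fintype ι] [Fintype κ] {f : (ι ⊕ κ → ℝ) → ℝ≥0∞} (hf : Measurable f) :
    ∫⁻ s, f s = ∫⁻ a : ι → ℝ, ∫⁻ b : κ → ℝ, f (Sum.elim a b) := by
  have h := volume_measurePreserving_sumPiEquivProdPi_symm (fun _ : ι ⊕ κ => ℝ)
  rw [← h.lintegral_comp hf]
  have hm : Measurable fun a : (ι → ℝ) × (κ → ℝ) => f (Sum.elim a.1 a.2) :=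
    hf.comp measurable_sumElim
  refine Eq.trans ?_ (lintegral_prod _ hm.aemeasurable)
  refine lintegral_congr fun a => congrArg f ?_
  ext k
  rcases k with k | k <;> rfl

theorem lintegral_pi_unit {f : (Unit → ℝ) → ℝ≥0∞} (hf : Measurable f) :
    ∫⁻ s, f s = ∫⁻ t : ℝ, f fun _ => t := by
  have h := (volume_preserving_funUnique Unit ℝ).symm
  rw [← h.lintegral_comp hf]
  rfl

end PiTools

/-- Index set of the coordinates `i ≤ j`. -/
abbrev UpperIdx (q : ℕ) : Type := {ij : Fin q × Fin q // ij.1 ≤ ij.2}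

/-- The symmetric matrix with given coordinates `i ≤ j`. -/
def symMat {q : ℕ} (s : UpperIdx q → ℝ) : Mat q q :=
  Matrix.of fun i j => if h : i ≤ j then s ⟨(i, j), h⟩ else s ⟨(j, i), (le_of_not_ge h)⟩

theorem measurable_symMat (q : ℕ) : Measurable (symMat : (UpperIdx q → ℝ) → Mat q q) := by
  refine measurable_pi_lambda _ fun i => measurable_pi_lambda _ fun j => ?_
  simp only [symMat, Matrix.of_apply]
  split_ifs <;> exact measurable_pi_apply _

theorem symMat_upper {q : ℕ} (S : PD q) : symMat S.upper = S.1 := by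
  ext i j
  simp only [symMat, Matrix.of_apply, PD.upper]
  split_ifs with h
  · rfl
  · exact S.2.isHermitian.apply i j

theorem range_upper (q : ℕ) :
    Set.range (PD.upper : PD q → _) = symMat ⁻¹' {S : Mat q q | S.PosDef} := by
  ext s
  constructor
  · rintro ⟨S, rfl⟩
    rw [Set.mem_preimage, symMat_upper]
    exact S.2
  · intro h
    refine ⟨⟨symMat s, h⟩, funext fun ij => ?_⟩
    simp only [PD.upper, symMat, Matrix.of_apply, dif_pos ij.2]

/-- The cone is traded for an indicator on the full coordinate space, where Fubini applies without
tracking a domain. -/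
theorem lintegral_lebPD {q : ℕ} {f : Mat q q → ℝ≥0∞} (hf : Measurable f) :
    ∫⁻ S, f S.1 ∂lebPD q = ∫⁻ s, {S : Mat q q | S.PosDef}.indicator f (symMat s) := by
  have he := PD.measurableEmbedding_upper q
  have h1 : ∀ S : PD q, f S.1 = (fun s => f (symMat s)) S.upper := fun S => by
    simp only [symMat_upper]
  simp_rw [h1]
  have hs := measurable_symMat q
  rw [← lintegral_map (f := fun s => f (symMat s)) (hf.comp hs) he.measurable, lebPD,
    he.map_comap, range_upper,
    ← lintegral_indicator (hs (measurableSet_posDef q))]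
  rfl

/-- The bordered symmetric matrix with corner `t`, first row and column `b`, and block `A`. -/
def bordered {q : ℕ} (t : ℝ) (b : Fin q → ℝ) (A : Mat q q) : Mat (q + 1) (q + 1) :=
  Matrix.of fun i j => (Fin.cons (α := fun _ => Fin (q + 1) → ℝ) (Fin.cons t b)
    (fun i => Fin.cons (b i) (A i)) : Fin (q + 1) → Fin (q + 1) → ℝ) i j

theorem measurable_bordered (q : ℕ) :
    Measurable fun a : ℝ × (Fin q → ℝ) × Mat q q => bordered a.1 a.2.1 a.2.2 := by
  refine measurable_pi_lambda _ fun i => measurable_pi_lambda _ fun j => ?_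
  have h2 : Measurable fun a : ℝ × (Fin q → ℝ) × Mat q q => a.2.1 :=
    measurable_fst.comp measurable_snd
  have h3 : Measurable fun a : ℝ × (Fin q → ℝ) × Mat q q => a.2.2 :=
    measurable_snd.comp measurable_snd
  refine Fin.cases ?_ (fun i => ?_) i <;> refine Fin.cases ?_ (fun j => ?_) j
  · exact measurable_fst
  · exact (measurable_pi_apply j).comp h2
  · exact (measurable_pi_apply i).comp h2
  · exact (measurable_pi_apply j).comp
      ((measurable_pi_apply (X := fun _ : Fin q => Fin q → ℝ) i).comp h3)

/-- `Fin (q + 1) ≃ Fin q ⊕ Unit`, with `0` sent to the right summand. -/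
def finSuccEquivSum (q : ℕ) : Fin (q + 1) ≃ Fin q ⊕ Unit :=
  (finSuccEquiv q).trans (Equiv.optionEquivSumPUnit (Fin q))

/-- Reindexing moves the corner last, so that `A` sits in the upper left block and the Schur
complement of `A` is a scalar. -/
theorem bordered_eq_submatrix {q : ℕ} (t : ℝ) (b : Fin q → ℝ) (A : Mat q q) :
    bordered t b A = (fromBlocks A (replicateCol Unit b) (replicateCol Unit b)ᴴ
      (Matrix.of fun _ _ => t)).submatrix (finSuccEquivSum q) (finSuccEquivSum q) := by
  ext i j
  refine Fin.cases ?_ (fun i => ?_) i <;> refine Fin.cases ?_ (fun j => ?_) j <;>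
    simp [bordered, finSuccEquivSum]

theorem schur_bordered {q : ℕ} (t : ℝ) (b : Fin q → ℝ) (A : Mat q q) :
    (Matrix.of fun _ _ => t : Matrix Unit Unit ℝ) -
      (replicateCol Unit b)ᴴ * A⁻¹ * replicateCol Unit b
      = Matrix.diagonal fun _ => t - b ⬝ᵥ A⁻¹ *ᵥ b := by
  ext i j
  simp only [Matrix.sub_apply, Matrix.of_apply, diagonal_apply, Matrix.mul_assoc]
  simp [Matrix.mul_apply, dotProduct, mulVec]

theorem det_bordered {q : ℕ} {A : Mat q q} (hA : A.PosDef) (t : ℝ) (b : Fin q → ℝ) :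
    (bordered t b A).det = A.det * (t - b ⬝ᵥ A⁻¹ *ᵥ b) := by
  have := hA.isUnit.invertible
  rw [bordered_eq_submatrix, det_submatrix_equiv_self, det_fromBlocks₁₁, invOf_eq_nonsing_inv,
    schur_bordered]
  simp

/-- `A` is a principal submatrix, and once it is positive definite the sign of the determinant `det
A · (t - bᵀA⁻¹b)` decides. -/
theorem posDef_bordered_iff {q : ℕ} {t : ℝ} {b : Fin q → ℝ} {A : Mat q q} :
    (bordered t b A).PosDef ↔ A.PosDef ∧ b ⬝ᵥ A⁻¹ *ᵥ b < t := by
  constructor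
  · intro h
    have hA : A.PosDef := by
      have h1 := h.submatrix (e := Fin.succ) (Fin.succ_injective q)
      have h2 : A = (bordered t b A).submatrix Fin.succ Fin.succ := by
        ext i j; simp [bordered]
      rwa [← h2] at h1
    refine ⟨hA, ?_⟩
    have h2 := h.det_pos
    rw [det_bordered hA] at h2
    have := pos_of_mul_pos_right h2 hA.det_pos.le
    linarith
  · rintro ⟨hA, ht⟩
    have := hA.isUnit.invertible
    have h1 : (bordered t b A).PosSemidef := by
      rw [bordered_eq_submatrix, posSemidef_submatrix_equiv,
        PosDef.fromBlocks₁₁ _ _ hA, schur_bordered]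
      exact posSemidef_diagonal_iff.2 fun _ => by linarith
    refine h1.posDef_iff_isUnit.2 ((Matrix.isUnit_iff_isUnit_det _).2 (isUnit_iff_ne_zero.2 ?_))
    rw [det_bordered hA]
    exact (mul_pos hA.det_pos (by linarith)).ne'

/-- Splitting of the coordinates of a bordered matrix. -/
def upperIdxSucc (q : ℕ) : Unit ⊕ (Fin q ⊕ UpperIdx q) → UpperIdx (q + 1) :=
  Sum.elim (fun _ => ⟨(0, 0), le_rfl⟩)
    (Sum.elim (fun j => ⟨(0, j.succ), Fin.zero_le _⟩)
      fun ij => ⟨(ij.1.1.succ, ij.1.2.succ), Fin.succ_le_succ_iff.2 ij.2⟩)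

theorem bijective_upperIdxSucc (q : ℕ) : Function.Bijective (upperIdxSucc q) := by
  constructor
  · rintro (a | a | ⟨⟨a, a'⟩, ha⟩) (b | b | ⟨⟨b, b'⟩, hb⟩) h <;>
      simp_all [upperIdxSucc, Fin.succ_ne_zero, (Fin.succ_ne_zero _).symm]
  · rintro ⟨⟨i, j⟩, h⟩
    refine Fin.cases (fun h => ?_) (fun i h => ?_) i h
    · refine Fin.cases (fun h => ?_) (fun j h => ?_) j h
      · exact ⟨Sum.inl (), rfl⟩
      · exact ⟨Sum.inr (Sum.inl j), rfl⟩
    · refine Fin.cases (fun h => ?_) (fun j h => ?_) j h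
      · simp at h
      · exact ⟨Sum.inr (Sum.inr ⟨(i, j), Fin.succ_le_succ_iff.1 h⟩), rfl⟩

theorem symMat_comp_upperIdxSucc {q : ℕ} (t : ℝ) (b : Fin q → ℝ) (a : UpperIdx q → ℝ) :
    symMat (Sum.elim (fun _ : Unit => t) (Sum.elim b a) ∘
      (Equiv.ofBijective _ (bijective_upperIdxSucc q)).symm) = bordered t b (symMat a) := by
  set g := Sum.elim (fun _ : Unit => t) (Sum.elim b a) ∘
      (Equiv.ofBijective _ (bijective_upperIdxSucc q)).symm with hg
  have key : ∀ x, g (upperIdxSucc q x) = Sum.elim (fun _ : Unit => t) (Sum.elim b a) x := by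
    intro x
    rw [hg, Function.comp_apply]
    congr 1
    exact (Equiv.ofBijective _ (bijective_upperIdxSucc q)).symm_apply_apply x
  have k1 := key (Sum.inl ())
  have k2 := fun j => key (Sum.inr (Sum.inl j))
  have k3 := fun j => key (Sum.inr (Sum.inr j))
  simp only [upperIdxSucc, Sum.elim_inl, Sum.elim_inr] at k1 k2 k3
  ext i j
  refine Fin.cases ?_ (fun i => ?_) i <;> refine Fin.cases ?_ (fun j => ?_) j
  · simpa [symMat, bordered] using k1
  · simpa [symMat, bordered] using k2 j
  · simpa [symMat, bordered] using k2 i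
  · by_cases h : i ≤ j
    · simpa [symMat, bordered, h] using k3 ⟨(i, j), h⟩
    · simpa [symMat, bordered, h] using k3 ⟨(j, i), le_of_not_ge h⟩

theorem measurable_bordered_add (q : ℕ) :
    Measurable fun a : ((Mat q q) × (Fin q → ℝ)) × ℝ =>
      bordered (a.1.2 ⬝ᵥ a.1.1⁻¹ *ᵥ a.1.2 + a.2) a.1.2 a.1.1 := by
  have h1 : Measurable fun a : ((Mat q q) × (Fin q → ℝ)) × ℝ => a.1.1 :=
    measurable_fst.comp measurable_fst
  have h2 : Measurable fun a : ((Mat q q) × (Fin q → ℝ)) × ℝ => a.1.2 :=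
    measurable_snd.comp measurable_fst
  have h3 : Measurable fun a : (Mat q q) × (Fin q → ℝ) => a.2 ⬝ᵥ a.1 *ᵥ a.2 :=
    (by fun_prop : Continuous fun a : (Mat q q) × (Fin q → ℝ) => a.2 ⬝ᵥ a.1 *ᵥ a.2).measurable
  have h4 := h3.comp (((measurable_inv_mat q).comp h1).prodMk h2)
  exact (measurable_bordered q).comp ((h4.add measurable_snd).prodMk (h2.prodMk h1))

/-- With the Schur complement `r = t - bᵀS⁻¹b` in place of the corner `t`, the cone in size `q + 1`
becomes the product of the cone in size `q`, `ℝ^q` and `(0, ∞)`. The substitution is a translation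
in `t`, so it has no Jacobian. -/
theorem lintegral_lebPD_succ {q : ℕ} {f : Mat (q + 1) (q + 1) → ℝ≥0∞} (hf : Measurable f) :
    ∫⁻ S, f S.1 ∂lebPD (q + 1) = ∫⁻ S, (∫⁻ b : Fin q → ℝ, ∫⁻ r in Set.Ioi (0 : ℝ),
      f (bordered (b ⬝ᵥ S.1⁻¹ *ᵥ b + r) b S.1)) ∂lebPD q := by
  have hF : Measurable ({S : Mat (q + 1) (q + 1) | S.PosDef}.indicator f) :=
    hf.indicator (measurableSet_posDef _)
  have hs1 := measurable_symMat (q + 1)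
  have hs := measurable_symMat q
  set F := {S : Mat (q + 1) (q + 1) | S.PosDef}.indicator f with hFdef
  have hg : Measurable fun A : Mat q q => ∫⁻ b : Fin q → ℝ, ∫⁻ r in Set.Ioi (0 : ℝ),
      f (bordered (b ⬝ᵥ A⁻¹ *ᵥ b + r) b A) := by
    have h1 := (hf.comp (measurable_bordered_add q)).lintegral_prod_right'
      (ν := (volume : Measure ℝ).restrict (Set.Ioi 0))
    exact h1.lintegral_prod_right'
  have hb : Measurable fun a : ℝ × (Fin q → ℝ) × (UpperIdx q → ℝ) =>
      F (bordered a.1 a.2.1 (symMat a.2.2)) :=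
    hF.comp ((measurable_bordered q).comp (measurable_fst.prodMk
      ((measurable_fst.comp measurable_snd).prodMk
        (hs.comp (measurable_snd.comp measurable_snd)))))
  set σ := Equiv.ofBijective _ (bijective_upperIdxSucc q) with hσ
  have hσm : Measurable fun s : Unit ⊕ (Fin q ⊕ UpperIdx q) → ℝ => F (symMat (s ∘ σ.symm)) :=
    hF.comp (hs1.comp (measurable_pi_lambda _ fun i => measurable_pi_apply _))
  have e1 : ∫⁻ s : UpperIdx (q + 1) → ℝ, F (symMat s)
      = ∫⁻ t : ℝ, ∫⁻ z : (Fin q → ℝ) × (UpperIdx q → ℝ), F (bordered t z.1 (symMat z.2)) := by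
    rw [lintegral_pi_reindex σ (f := fun s => F (symMat s)) (hF.comp hs1), lintegral_pi_sum hσm,
      lintegral_pi_unit (f := fun t => ∫⁻ c : Fin q ⊕ UpperIdx q → ℝ,
        F (symMat (Sum.elim t c ∘ σ.symm))) ((hσm.comp measurable_sumElim).lintegral_prod_right')]
    refine lintegral_congr fun t => ?_
    have h1 : Measurable fun c : Fin q ⊕ UpperIdx q → ℝ =>
        F (symMat (Sum.elim (fun _ : Unit => t) c ∘ σ.symm)) :=
      (hσm.comp measurable_sumElim).comp measurable_prodMk_left
    rw [lintegral_pi_sum h1]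
    refine Eq.trans ?_ (lintegral_prod (fun z : (Fin q → ℝ) × (UpperIdx q → ℝ) =>
      F (bordered t z.1 (symMat z.2))) (hb.comp measurable_prodMk_left).aemeasurable).symm
    simp_rw [hσ, symMat_comp_upperIdxSucc]
  have e2 : ∫⁻ t : ℝ, ∫⁻ z : (Fin q → ℝ) × (UpperIdx q → ℝ), F (bordered t z.1 (symMat z.2))
      = ∫⁻ a : UpperIdx q → ℝ, ∫⁻ b : Fin q → ℝ, ∫⁻ t : ℝ, F (bordered t b (symMat a)) := by
    rw [lintegral_lintegral_swap hb.aemeasurable]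
    exact lintegral_prod_symm' _ ((hb.comp measurable_swap).lintegral_prod_right')
  rw [lintegral_lebPD hf, lintegral_lebPD hg, ← hFdef, e1, e2]
  refine lintegral_congr fun a => ?_
  by_cases hA : (symMat a).PosDef
  · rw [Set.indicator_of_mem (by exact hA)]
    refine lintegral_congr fun b => ?_
    -- Translating the corner variable turns the condition `t > bᵀA⁻¹b` into `r > 0`.
    rw [← lintegral_add_left_eq_self _ (b ⬝ᵥ (symMat a)⁻¹ *ᵥ b),
      ← lintegral_indicator measurableSet_Ioi]
    refine lintegral_congr fun r => ?_
    by_cases hr : 0 < r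
    · rw [Set.indicator_of_mem (by exact hr), hFdef, Set.indicator_of_mem]
      exact posDef_bordered_iff.2 ⟨hA, by linarith⟩
    · rw [Set.indicator_of_notMem (by exact hr), hFdef, Set.indicator_of_notMem]
      exact fun h => hr (by linarith [(posDef_bordered_iff.1 h).2])
  · rw [Set.indicator_of_notMem (by exact hA)]
    have : ∀ b t, F (bordered t b (symMat a)) = 0 := fun b t => by
      rw [hFdef]
      exact Set.indicator_of_notMem (by exact fun h => hA (posDef_bordered_iff.1 h).1) _
    simp [this]

/-! ### Integration over a column given the remaining ones -/

/-- The columns of `z` span at most `q` dimensions, so their orthogonal complement has at least `m`;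
no rank condition on `z` is needed. It serves both the column integration and the completion of
frames to orthogonal matrices. -/
theorem exists_orthonormal_complement {p q m : ℕ} (hpm : q + m = p) (z : Mat p q) :
    ∃ n : Mat p m, nᵀ * n = 1 ∧ zᵀ * n = 0 := by
  let V : Submodule ℝ (EuclideanSpace ℝ (Fin p)) :=
    Submodule.span ℝ (Set.range fun j : Fin q => WithLp.toLp 2 (zᵀ j))
  have hV : Module.finrank ℝ V ≤ q := by
    have := finrank_range_le_card (R := ℝ) (fun j : Fin q => WithLp.toLp 2 (zᵀ j))
    simpa [Set.finrank] using this
  have hV2 : m ≤ Module.finrank ℝ Vᗮ := by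
    have := V.finrank_add_finrank_orthogonal
    rw [finrank_euclideanSpace_fin] at this
    omega
  let B := stdOrthonormalBasis ℝ Vᗮ
  let w : Fin m → EuclideanSpace ℝ (Fin p) := fun k => (B (Fin.castLE hV2 k) : Vᗮ).1
  refine ⟨Matrix.of fun i k => w k i, ?_, ?_⟩
  · ext k l
    have h := orthonormal_iff_ite.1 B.orthonormal (Fin.castLE hV2 l) (Fin.castLE hV2 k)
    rw [Submodule.coe_inner] at h
    simp only [Matrix.mul_apply, transpose_apply, Matrix.of_apply, Matrix.one_apply]
    simp only [PiLp.inner_apply, RCLike.inner_apply, conj_trivial] at h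
    refine h.trans ?_
    simp [eq_comm]
  · ext j k
    have h := (B (Fin.castLE hV2 k)).2
    rw [Submodule.mem_orthogonal] at h
    have h2 := h (WithLp.toLp 2 (zᵀ j)) (Submodule.subset_span ⟨j, rfl⟩)
    simp only [PiLp.inner_apply, RCLike.inner_apply, conj_trivial] at h2
    simp only [Matrix.mul_apply, transpose_apply, Matrix.of_apply, Matrix.zero_apply]
    rw [← h2]
    exact Finset.sum_congr rfl fun i _ => mul_comm _ _

/-- Let the columns of `n` be orthonormal and orthogonal to those of `z`. The change of variables `v
↦ (zᵀv, nᵀv)` has matrix `M` with `M Mᵀ = diag(zᵀz, I)`, whence the factor `det(zᵀz)^(-1/2)`. By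
Pythagoras `v·v` is `bᵀ(zᵀz)⁻¹b` plus the squared radius of `nᵀv`, which is integrated radially. -/
theorem lintegral_column {p q : ℕ} (hqp : q < p) {z : Mat p q} (hz : (zᵀ * z).PosDef)
    {F : (Fin q → ℝ) × ℝ → ℝ≥0∞} (hF : Measurable F) :
    ∫⁻ v : Fin p → ℝ, F (zᵀ *ᵥ v, v ⬝ᵥ v)
      = ∫⁻ b : Fin q → ℝ, ∫⁻ r in Set.Ioi (0 : ℝ),
        ENNReal.ofReal (sphereConst (p - q) * (zᵀ * z).det ^ (-(1 / 2) : ℝ) *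
          r ^ (((p : ℝ) - q) / 2 - 1)) * F (b, b ⬝ᵥ (zᵀ * z)⁻¹ *ᵥ b + r) := by
  obtain ⟨m, rfl⟩ := Nat.exists_eq_add_of_lt hqp
  obtain ⟨n, hn, hzn⟩ := exists_orthonormal_complement (m := m + 1) rfl z
  have hnz : nᵀ * z = 0 := by
    have := congrArg Matrix.transpose hzn
    simpa [Matrix.transpose_mul] using this
  set A := zᵀ * z with hA
  let e : Fin q ⊕ Fin (m + 1) ≃ Fin (q + m + 1) := finSumFinEquiv
  let g : Matrix (Fin (q + m + 1)) (Fin q ⊕ Fin (m + 1)) ℝ := fromCols z n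
  have hgg : gᵀ * g = fromBlocks A 0 0 1 := by
    rw [transpose_fromCols, fromRows_mul_fromCols, hn, hzn, hnz]
  let M : Matrix (Fin (q + m + 1)) (Fin (q + m + 1)) ℝ := gᵀ.submatrix e.symm id
  have hMM : M * Mᵀ = (fromBlocks A 0 0 1).submatrix e.symm e.symm := by
    rw [← hgg]
    ext i j
    simp [M, Matrix.mul_apply]
  have hdet : M.det ^ 2 = A.det := by
    have := congrArg Matrix.det hMM
    rw [det_mul, det_transpose, det_submatrix_equiv_self, det_fromBlocks_zero₁₂, det_one,
      mul_one] at this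
    rw [← this]; ring
  have hM0 : M.det ≠ 0 := by
    intro h
    have := hz.det_pos
    rw [← hdet, h] at this
    simp at this
  have habs : |M.det|⁻¹ = A.det ^ (-(1 / 2) : ℝ) := by
    rw [Real.rpow_neg hz.det_pos.le, ← Real.sqrt_eq_rpow, ← hdet, Real.sqrt_sq_eq_abs]
  -- The two terms are the orthogonal projections onto the span of `z` and onto its complement.
  -- Multiplying by `[z n]ᵀ` fixes `[z n]ᵀ`, and the square matrix `M` obtained from it by
  -- reindexing can be cancelled.
  have hid : z * A⁻¹ * zᵀ + n * nᵀ = 1 := by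
    have hMu : IsUnit M.det := isUnit_iff_ne_zero.2 hM0
    have h1 : M * (z * A⁻¹ * zᵀ + n * nᵀ) = M := by
      have hAu : IsUnit A.det := isUnit_iff_ne_zero.2 hz.det_pos.ne'
      have h2 : gᵀ * (z * A⁻¹ * zᵀ + n * nᵀ) = gᵀ := by
        rw [transpose_fromCols, fromRows_mul]
        congr 1
        · rw [Matrix.mul_add, ← Matrix.mul_assoc, ← Matrix.mul_assoc, ← Matrix.mul_assoc, ← hA,
            Matrix.mul_nonsing_inv _ hAu, hzn]
          simp
        · rw [Matrix.mul_add, ← Matrix.mul_assoc, ← Matrix.mul_assoc, ← Matrix.mul_assoc, hnz, hn]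
          simp
      have h3 : ∀ y : Matrix (Fin (q + m + 1)) (Fin (q + m + 1)) ℝ,
          M * y = (gᵀ * y).submatrix e.symm id := fun y => rfl
      rw [h3, h2]
    have h4 := congrArg (fun y => M⁻¹ * y) h1
    simp only [← Matrix.mul_assoc, Matrix.nonsing_inv_mul _ hMu] at h4
    simpa [Matrix.mul_assoc] using h4
  have hvv : ∀ v : Fin (q + m + 1) → ℝ,
      v ⬝ᵥ v = (zᵀ *ᵥ v) ⬝ᵥ A⁻¹ *ᵥ (zᵀ *ᵥ v) + (nᵀ *ᵥ v) ⬝ᵥ (nᵀ *ᵥ v) := by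
    intro v
    have h1 : v ⬝ᵥ v = v ⬝ᵥ ((z * A⁻¹ * zᵀ + n * nᵀ) *ᵥ v) := by rw [hid, one_mulVec]
    rw [h1, add_mulVec, dotProduct_add]
    congr 1
    · simp only [← mulVec_mulVec]
      rw [dotProduct_mulVec, ← mulVec_transpose]
    · simp only [← mulVec_mulVec]
      rw [dotProduct_mulVec, ← mulVec_transpose]
  let G : (Fin q ⊕ Fin (m + 1) → ℝ) → ℝ≥0∞ := fun s =>
    F (s ∘ Sum.inl, (s ∘ Sum.inl) ⬝ᵥ A⁻¹ *ᵥ (s ∘ Sum.inl) + (s ∘ Sum.inr) ⬝ᵥ (s ∘ Sum.inr))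
  have hG : Measurable G := by
    refine hF.comp ?_
    exact (by fun_prop : Continuous fun s : Fin q ⊕ Fin (m + 1) → ℝ => (s ∘ Sum.inl,
      (s ∘ Sum.inl) ⬝ᵥ A⁻¹ *ᵥ (s ∘ Sum.inl) +
        (s ∘ Sum.inr) ⬝ᵥ (s ∘ Sum.inr))).measurable
  have hG' : Measurable fun u : Fin (q + m + 1) → ℝ => G (u ∘ e) :=
    hG.comp (measurable_pi_lambda _ fun i => measurable_pi_apply _)
  have e1 : ∫⁻ v : Fin (q + m + 1) → ℝ, F (zᵀ *ᵥ v, v ⬝ᵥ v)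
      = ∫⁻ v : Fin (q + m + 1) → ℝ, G ((toLin' M v) ∘ e) := by
    refine lintegral_congr fun v => ?_
    have h1 : (toLin' M v) ∘ e = gᵀ *ᵥ v := by
      ext i
      simp [M, toLin'_apply, mulVec, dotProduct]
    have h2 : gᵀ *ᵥ v = Sum.elim (zᵀ *ᵥ v) (nᵀ *ᵥ v) := by
      rw [transpose_fromCols, fromRows_mulVec]
    simp only [h1, h2, G, Sum.elim_comp_inl, Sum.elim_comp_inr, ← hvv]
  have hMm : Measurable (toLin' M) := (LinearMap.continuous_on_pi _).measurable
  rw [e1, ← lintegral_map hG' hMm, Real.map_matrix_volume_pi_eq_smul_volume_pi hM0,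
    lintegral_smul_measure, lintegral_pi_reindex e hG', abs_inv, habs]
  have e3 : ∫⁻ s : Fin q ⊕ Fin (m + 1) → ℝ, G ((s ∘ e.symm) ∘ e)
      = ∫⁻ b : Fin q → ℝ, ∫⁻ w : Fin (m + 1) → ℝ, F (b, b ⬝ᵥ A⁻¹ *ᵥ b + w ⬝ᵥ w) := by
    simp only [Function.comp_assoc, Equiv.symm_comp_self, Function.comp_id]
    rw [lintegral_pi_sum hG]
    rfl
  have hF2 : Measurable fun a : (Fin q → ℝ) × ℝ => F (a.1, a.1 ⬝ᵥ A⁻¹ *ᵥ a.1 + a.2) := by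
    refine hF.comp ?_
    exact (by fun_prop : Continuous fun a : (Fin q → ℝ) × ℝ =>
      (a.1, a.1 ⬝ᵥ A⁻¹ *ᵥ a.1 + a.2)).measurable
  rw [e3, smul_eq_mul, ← lintegral_const_mul']
  · refine lintegral_congr fun b => ?_
    rw [lintegral_dotProduct_self (Nat.succ_pos m)
      (f := fun r => F (b, b ⬝ᵥ A⁻¹ *ᵥ b + r)) (hF2.comp measurable_prodMk_left),
      ← lintegral_const_mul' _ _ ENNReal.ofReal_ne_top]
    refine setLIntegral_congr_fun measurableSet_Ioi fun r hr => ?_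
    have h0 : q + m + 1 - q = m + 1 := by omega
    have h1 : (((q + m + 1 : ℕ) : ℝ) - q) = ((m + 1 : ℕ) : ℝ) := by push_cast; ring
    simp only [h0, h1]
    rw [← mul_assoc, ← ENNReal.ofReal_mul (Real.rpow_nonneg hz.det_pos.le _)]
    congr 2
    ring
  · exact ENNReal.ofReal_ne_top

/-! ### The image of Lebesgue measure under `x ↦ xᵀ x` -/

theorem mvGamma_pos {q : ℕ} {a : ℝ} (ha : ((q : ℝ) - 1) / 2 < a) : 0 < mvGamma q a := by
  refine mul_pos (Real.rpow_pos_of_pos Real.pi_pos _) (Finset.prod_pos fun j _ => ?_)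
  refine Real.Gamma_pos_of_pos ?_
  have : (j : ℝ) + 1 ≤ q := by exact_mod_cast j.2
  linarith

theorem mvGamma_succ (q : ℕ) (a : ℝ) :
    mvGamma (q + 1) a = mvGamma q a * (Real.pi ^ ((q : ℝ) / 2) * Real.Gamma (a - q / 2)) := by
  have h : Real.pi ^ (((q + 1 : ℕ) : ℝ) * (((q + 1 : ℕ) : ℝ) - 1) / 4)
      = Real.pi ^ ((q : ℝ) * ((q : ℝ) - 1) / 4) * Real.pi ^ ((q : ℝ) / 2) := by
    rw [← Real.rpow_add Real.pi_pos]
    congr 1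
    push_cast; ring
  rw [mvGamma, mvGamma, Fin.prod_univ_castSucc, h]
  simp only [Fin.val_castSucc, Fin.val_last]
  ring

/-- The constant `π^{pq/2} / Γ_q(p/2)`. -/
def gramConst (p q : ℕ) : ℝ := Real.pi ^ ((p : ℝ) * q / 2) / mvGamma q ((p : ℝ) / 2)

theorem gramConst_pos {p q : ℕ} (hqp : q ≤ p) : 0 < gramConst p q := by
  have : (q : ℝ) ≤ p := by exact_mod_cast hqp
  exact div_pos (Real.rpow_pos_of_pos Real.pi_pos _) (mvGamma_pos (by linarith))

theorem gramConst_zero (p : ℕ) : gramConst p 0 = 1 := by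
  simp [gramConst, mvGamma]

/-- The Gamma factor that `Γ_{q+1}(p/2)` has beyond `Γ_q(p/2)` is `Γ((p-q)/2)`, exactly the one in
the radial density on `ℝ^(p-q)`. -/
theorem gramConst_succ {p q : ℕ} (hqp : q < p) :
    gramConst p (q + 1) = gramConst p q * sphereConst (p - q) := by
  have h : Real.pi ^ ((p : ℝ) * ((q + 1 : ℕ) : ℝ) / 2)
      = Real.pi ^ ((p : ℝ) * q / 2) * (Real.pi ^ ((q : ℝ) / 2) *
        Real.pi ^ (((p : ℝ) - q) / 2)) := by
    rw [← Real.rpow_add Real.pi_pos, ← Real.rpow_add Real.pi_pos]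
    congr 1
    push_cast; ring
  have h1 := Real.rpow_pos_of_pos Real.pi_pos ((q : ℝ) / 2)
  rw [gramConst, gramConst, sphereConst, mvGamma_succ, h, Nat.cast_sub hqp.le,
    show (p : ℝ) / 2 - q / 2 = (p - q) / 2 by ring]
  field_simp

theorem measurable_gram_mat (p q : ℕ) : Measurable fun x : Mat p q => xᵀ * x :=
  (by fun_prop : Continuous fun x : Mat p q => xᵀ * x).measurable

theorem measurable_det_mat (q : ℕ) : Measurable fun S : Mat q q => S.det :=
  (by fun_prop : Continuous fun S : Mat q q => S.det).measurable

theorem consCol_transpose_mul_consCol {p q : ℕ} (v : Fin p → ℝ) (z : Mat p q) :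
    (consCol v z)ᵀ * consCol v z = bordered (v ⬝ᵥ v) (zᵀ *ᵥ v) (zᵀ * z) := by
  ext i j
  refine Fin.cases ?_ (fun i => ?_) i <;> refine Fin.cases ?_ (fun j => ?_) j <;>
    simp [Matrix.mul_apply, consCol, bordered, dotProduct, mulVec, mul_comm]

/-- The integral formula is tested on the indicator of the complement of the cone, which vanishes on
the right side. The formula is a hypothesis because the null set is already needed inside the
induction that proves it. -/
theorem ae_posDef_of_lintegral {p q : ℕ} {w : PD q → ℝ≥0∞}
    (h : ∀ f : Mat q q → ℝ≥0∞, Measurable f →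
      ∫⁻ x, f (xᵀ * x) ∂leb p q = ∫⁻ S, w S * f S.1 ∂lebPD q) :
    ∀ᵐ z ∂leb p q, (zᵀ * z).PosDef := by
  have hms := (measurableSet_posDef q).compl
  have hm : Measurable ({S : Mat q q | S.PosDef}ᶜ.indicator (1 : Mat q q → ℝ≥0∞)) :=
    measurable_one.indicator hms
  have h := h _ hm
  have h2 : ∀ S : PD q, w S * {S : Mat q q | S.PosDef}ᶜ.indicator 1 S.1 = 0 := by
    intro S
    rw [Set.indicator_of_notMem (by exact fun h => h S.2), mul_zero]
  simp_rw [h2, lintegral_zero] at h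
  filter_upwards [(lintegral_eq_zero_iff (hm.comp (measurable_gram_mat p q))).1 h] with z hz
  by_contra hc
  have hz' : {S : Mat q q | S.PosDef}ᶜ.indicator (1 : Mat q q → ℝ≥0∞) (zᵀ * z) = 0 := hz
  rw [Set.indicator_of_mem (by exact hc)] at hz'
  simp at hz'

/-- Induction on the number of columns, with `p` fixed: given the other columns `z`, the Gram matrix
of `[v z]` is `zᵀz` bordered by `zᵀv` and `v·v`. `lintegral_column` integrates `v` out, and
`lintegral_lebPD_succ` recognises the result as an integral over the larger cone. -/
theorem lintegral_gram_mat {q : ℕ} : ∀ {p : ℕ}, q ≤ p → ∀ {f : Mat q q → ℝ≥0∞}, Measurable f →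
    ∫⁻ x, f (xᵀ * x) ∂leb p q = ∫⁻ S, ENNReal.ofReal (gramConst p q *
      S.1.det ^ (((p : ℝ) - q - 1) / 2)) * f S.1 ∂lebPD q := by
  induction q with
  | zero =>
    intro p _ f hf
    have h1 : leb p 0 Set.univ = 1 := by
      rw [leb]; exact (Measure.pi_univ _).trans (by simp [volume_pi])
    have h2 : (volume : Measure (UpperIdx 0 → ℝ)) Set.univ = 1 := by
      have : IsEmpty (UpperIdx 0) := ⟨fun ij => ij.1.1.elim0⟩
      exact (Measure.pi_univ _).trans (by simp)
    have h3 : ∀ A : Mat 0 0, A = 1 := fun A => Subsingleton.elim _ _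
    have h4 : ∀ S : PD 0, ENNReal.ofReal (gramConst p 0 *
        S.1.det ^ (((p : ℝ) - (0 : ℕ) - 1) / 2)) * f S.1 = f S.1 := fun S => by
      simp [gramConst_zero]
    simp_rw [h4, lintegral_lebPD hf]
    have h5 : ∀ s : UpperIdx 0 → ℝ, {S : Mat 0 0 | S.PosDef}.indicator f (symMat s) = f 1 := by
      intro s
      rw [h3 (symMat s)]
      exact Set.indicator_of_mem (by exact PosDef.one) _
    simp_rw [h5, fun x : Mat p 0 => h3 (xᵀ * x)]
    simp [h1, h2]
  | succ q ih =>
    intro p hqp f hf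
    have ih' := fun f hf => @ih p (by omega) f hf
    have hnull := ae_posDef_of_lintegral ih'
    let W : Mat q q → ℝ → ℝ≥0∞ := fun A r =>
      ENNReal.ofReal (sphereConst (p - q) * A.det ^ (-(1 / 2) : ℝ) *
          r ^ (((p : ℝ) - q) / 2 - 1))
    let H : Mat q q → ℝ≥0∞ := fun A => ∫⁻ b : Fin q → ℝ, ∫⁻ r in Set.Ioi (0 : ℝ),
      W A r * f (bordered (b ⬝ᵥ A⁻¹ *ᵥ b + r) b A)
    have hH : Measurable H := by
      have h0 : Measurable fun a : ((Mat q q) × (Fin q → ℝ)) × ℝ => W a.1.1 a.2 := by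
        refine Measurable.ennreal_ofReal ?_
        have h1 : Measurable fun a : ((Mat q q) × (Fin q → ℝ)) × ℝ => a.1.1.det :=
          (measurable_det_mat q).comp (measurable_fst.comp measurable_fst)
        exact ((h1.pow_const _).const_mul _).mul (measurable_snd.pow_const _)
      have h1 := (h0.mul (hf.comp (measurable_bordered_add q))).lintegral_prod_right'
        (ν := (volume : Measure ℝ).restrict (Set.Ioi 0))
      exact h1.lintegral_prod_right'
    have hcol : ∀ z : Mat p q, (zᵀ * z).PosDef →
        ∫⁻ v : Fin p → ℝ, f ((consCol v z)ᵀ * consCol v z) = H (zᵀ * z) := by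
      intro z hz
      simp_rw [consCol_transpose_mul_consCol]
      refine lintegral_column (by omega) hz (F := fun a => f (bordered a.2 a.1 (zᵀ * z))) ?_
      exact hf.comp ((measurable_bordered q).comp
        (measurable_snd.prodMk (measurable_fst.prodMk measurable_const)))
    rw [lintegral_leb_succ (f := fun x => f (xᵀ * x)) (hf.comp (measurable_gram_mat p (q + 1))),
      lintegral_congr_ae (hnull.mono hcol), ih' H hH]
    have hRm : Measurable fun S : Mat (q + 1) (q + 1) => ENNReal.ofReal (gramConst p (q + 1) *
        S.det ^ (((p : ℝ) - (q + 1 : ℕ) - 1) / 2)) * f S :=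
      (((measurable_det_mat (q + 1)).pow_const _).const_mul _).ennreal_ofReal.mul hf
    rw [lintegral_lebPD_succ hRm]
    refine lintegral_congr fun S => ?_
    rw [← lintegral_const_mul' _ _ ENNReal.ofReal_ne_top]
    refine lintegral_congr fun b => ?_
    rw [← lintegral_const_mul' _ _ ENNReal.ofReal_ne_top]
    refine setLIntegral_congr_fun measurableSet_Ioi fun r hr => ?_
    have hS := S.2.det_pos
    have hr' : (0 : ℝ) < r := hr
    have hc := gramConst_pos (show q ≤ p by omega)
    simp only [W]
    rw [← mul_assoc, ← ENNReal.ofReal_mul (by positivity), det_bordered S.2, gramConst_succ hqp,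
      add_sub_cancel_left, Real.mul_rpow hS.le hr'.le]
    congr 2
    -- The factor `det^(-1/2)` of the new column lowers the exponent of `det S` to `(p-q-2)/2`,
    -- which is also the exponent of `r`; together they form a power of the bordered determinant
    -- `det S · r`.
    have e1 : (((p : ℝ) - (q + 1 : ℕ) - 1) / 2) = ((p : ℝ) - q - 1) / 2 + (-(1 / 2)) := by
      push_cast; ring
    have e2 : (((p : ℝ) - q) / 2 - 1) = ((p : ℝ) - q - 1) / 2 + (-(1 / 2)) := by ring
    rw [e1, e2, Real.rpow_add hS]
    ring

theorem ae_posDef_gram {p q : ℕ} (hqp : q ≤ p) : ∀ᵐ z ∂leb p q, (zᵀ * z).PosDef :=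
  ae_posDef_of_lintegral fun _ hf => lintegral_gram_mat hqp hf

/-! ### Square roots and Gram matrices -/

theorem PD.transpose_eq {q : ℕ} (S : PD q) : S.1ᵀ = S.1 := S.2.isHermitian.eq

theorem PD.isUnit_det {q : ℕ} (S : PD q) : IsUnit S.1.det := isUnit_iff_ne_zero.2 S.2.det_pos.ne'

theorem PD.det_sqrt_sq {q : ℕ} (S : PD q) : S.sqrt.1.det ^ 2 = S.1.det := by
  rw [pow_two, ← det_mul, S.sqrt_mul_sqrt]

theorem PD.det_sqrt {q : ℕ} (S : PD q) : S.sqrt.1.det = S.1.det ^ (1 / 2 : ℝ) := by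
  rw [← S.det_sqrt_sq, ← Real.sqrt_eq_rpow, Real.sqrt_sq S.sqrt.2.det_pos.le]

theorem PD.sqrt_mul_inv_mul_sqrt {q : ℕ} (S : PD q) : S.sqrt.1 * S.1⁻¹ * S.sqrt.1 = 1 := by
  have h : S.1⁻¹ = S.sqrt.1⁻¹ * S.sqrt.1⁻¹ := by rw [← Matrix.mul_inv_rev, S.sqrt_mul_sqrt]
  rw [h, ← Matrix.mul_assoc, Matrix.mul_nonsing_inv _ S.sqrt.isUnit_det, Matrix.one_mul,
    Matrix.nonsing_inv_mul _ S.sqrt.isUnit_det]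

theorem PD.det_circ {q : ℕ} (A B : PD q) : (PD.circ A B).1.det = A.1.det * B.1.det := by
  rw [PD.circ, det_mul, det_mul, ← B.det_sqrt_sq]; ring

theorem PD.trace_circ {q : ℕ} (A B : PD q) : (PD.circ A B).1.trace = (B.1 * A.1).trace := by
  rw [PD.circ, trace_mul_comm, ← Matrix.mul_assoc, B.sqrt_mul_sqrt]

theorem PD.det_inv {q : ℕ} (S : PD q) : S.inv.1.det = S.1.det⁻¹ := by
  rw [PD.inv, det_nonsing_inv, Ring.inverse_eq_inv']

theorem PD.measurable_inv (q : ℕ) : Measurable (PD.inv : PD q → PD q) :=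
  (measurable_inv_pd q).subtype_mk

theorem PD.measurable_circ_left {q : ℕ} (B : PD q) : Measurable fun A : PD q => PD.circ A B := by
  have h := (PD.measurable_circ q).comp (measurable_prodMk_right (y := B))
  exact h

open Classical in
/-- A positive definite matrix as an element of `P⁺(q)`; other matrices are sent to `1`. -/
def toPD {q : ℕ} (A : Mat q q) : PD q := if h : A.PosDef then ⟨A, h⟩ else PD.one q

theorem toPD_of_posDef {q : ℕ} {A : Mat q q} (h : A.PosDef) : toPD A = ⟨A, h⟩ := dif_pos h

theorem coe_toPD {q : ℕ} {A : Mat q q} (h : A.PosDef) : (toPD A).1 = A := by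
  rw [toPD_of_posDef h]

theorem toPD_coe {q : ℕ} (S : PD q) : toPD S.1 = S := toPD_of_posDef S.2

theorem measurable_toPD (q : ℕ) : Measurable (toPD : Mat q q → PD q) := by
  classical
  refine PD.measurable_of_coe ?_
  have : (fun A : Mat q q => ((toPD A : PD q) : Mat q q))
      = fun A => if A.PosDef then A else 1 := by
    ext1 A
    unfold toPD
    split_ifs <;> rfl
  rw [this]
  exact Measurable.ite (measurableSet_posDef q) measurable_id measurable_const

theorem det_transpose_mul_self_nonneg {p q : ℕ} (z : Mat p q) : 0 ≤ (zᵀ * z).det :=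
  (posSemidef_conjTranspose_mul_self z).det_nonneg

theorem gram_eq_toPD {p q : ℕ} (U : PD p) (x : Mat p q) : gram U x = toPD (xᵀ * U.1⁻¹ * x) := rfl

theorem gram_sqrt_mul_mat {p q : ℕ} (U : PD p) (z : Mat p q) :
    (U.sqrt.1 * z)ᵀ * U.1⁻¹ * (U.sqrt.1 * z) = zᵀ * z := by
  rw [transpose_mul, U.sqrt.transpose_eq]
  calc zᵀ * U.sqrt.1 * U.1⁻¹ * (U.sqrt.1 * z)
      = zᵀ * (U.sqrt.1 * U.1⁻¹ * U.sqrt.1) * z := by simp only [Matrix.mul_assoc]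
    _ = zᵀ * z := by rw [U.sqrt_mul_inv_mul_sqrt, Matrix.mul_one]

theorem gram_sqrt_mul {p q : ℕ} (U : PD p) (z : Mat p q) :
    gram U (U.sqrt.1 * z) = toPD (zᵀ * z) := by
  rw [gram_eq_toPD, gram_sqrt_mul_mat]

/-- The whitening `x = U^{1/2} z` turns `xᵀU⁻¹x` into `zᵀz` and so reduces questions about `U` to `U
= I`. -/
theorem lintegral_leb_sqrt_mul {p q : ℕ} (U : PD p) {f : Mat p q → ℝ≥0∞} (hf : Measurable f) :
    ∫⁻ x, f x ∂leb p q
      = ENNReal.ofReal (U.1.det ^ ((q : ℝ) / 2)) * ∫⁻ z, f (U.sqrt.1 * z) ∂leb p q := by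
  have hU := U.sqrt.2.det_pos
  rw [lintegral_leb_mul_left hU.ne' hf, ← mul_assoc,
    ← ENNReal.ofReal_mul (Real.rpow_nonneg U.2.det_pos.le _)]
  have : U.1.det ^ ((q : ℝ) / 2) = U.sqrt.1.det ^ q := by
    rw [PD.det_sqrt, ← Real.rpow_natCast, ← Real.rpow_mul U.2.det_pos.le]
    congr 1; ring
  rw [this, abs_of_pos hU, inv_pow, mul_inv_cancel₀ (pow_pos hU q).ne']
  simp

theorem ae_posDef_gramU {p q : ℕ} (hqp : q ≤ p) (U : PD p) :
    ∀ᵐ x ∂leb p q, (xᵀ * U.1⁻¹ * x).PosDef := by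
  have hm : Measurable fun x : Mat p q => xᵀ * U.1⁻¹ * x :=
    (by fun_prop : Continuous fun x : Mat p q => xᵀ * U.1⁻¹ * x).measurable
  have hs : MeasurableSet {x : Mat p q | ¬ (xᵀ * U.1⁻¹ * x).PosDef} :=
    (hm (measurableSet_posDef q)).compl
  rw [ae_iff, ← lintegral_indicator_one hs, lintegral_leb_sqrt_mul U (measurable_one.indicator hs)]
  have h : ∀ᵐ z ∂leb p q, {x : Mat p q | ¬ (xᵀ * U.1⁻¹ * x).PosDef}.indicator
      (1 : Mat p q → ℝ≥0∞) (U.sqrt.1 * z) = 0 := by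
    filter_upwards [ae_posDef_gram hqp] with z hz
    refine Set.indicator_of_notMem ?_ _
    simp only [Set.mem_ofPred_eq, not_not, gram_sqrt_mul_mat]
    exact hz
  rw [lintegral_congr_ae h]
  simp

/-! ### The reference measures -/

/-- The Lebesgue density of `ν_U`. -/
def nuDensity {p : ℕ} (q : ℕ) (U : PD p) (X : Mat p q) : ℝ :=
  mvGamma q ((p : ℝ) / 2) / Real.pi ^ ((p : ℝ) * q / 2) *
      (U.1.det ^ (-(q : ℝ) / 2) / (Xᵀ * U.1⁻¹ * X).det ^ ((p : ℝ) / 2))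

theorem measurable_nuDensity {p : ℕ} (q : ℕ) (U : PD p) :
    Measurable fun X : Mat p q => ENNReal.ofReal (nuDensity q U X) := by
  have hm : Measurable fun x : Mat p q => (xᵀ * U.1⁻¹ * x).det :=
    (by fun_prop : Continuous fun x : Mat p q => (xᵀ * U.1⁻¹ * x).det).measurable
  exact ((measurable_const.div (hm.pow_const _)).const_mul _).ennreal_ofReal

theorem nu_eq {p : ℕ} (q : ℕ) (U : PD p) :
    nu q U = (leb p q).withDensity fun X => ENNReal.ofReal (nuDensity q U X) := rfl

instance instSigmaFiniteNu {p : ℕ} (q : ℕ) (U : PD p) : SigmaFinite (nu q U) :=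
  SigmaFinite.withDensity_ofReal _

theorem nu_absolutelyContinuous {p : ℕ} (q : ℕ) (U : PD p) : nu q U ≪ leb p q :=
  withDensity_absolutelyContinuous _ _

/-- The Jacobian of the whitening cancels the power of `det U` in the density, so `ν_U` is the image
of `ν_I` under `z ↦ U^{1/2} z`. -/
theorem lintegral_nu {p q : ℕ} (U : PD p) {f : Mat p q → ℝ≥0∞} (hf : Measurable f) :
    ∫⁻ x, f x ∂nu q U
      = ∫⁻ z, ENNReal.ofReal ((gramConst p q)⁻¹ * (zᵀ * z).det ^ (-(p : ℝ) / 2)) *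
        f (U.sqrt.1 * z) ∂leb p q := by
  rw [nu_eq, lintegral_withDensity_eq_lintegral_mul _ (measurable_nuDensity q U) hf]
  simp only [Pi.mul_apply]
  rw [lintegral_leb_sqrt_mul U (f := fun x => ENNReal.ofReal (nuDensity q U x) * f x)
    ((measurable_nuDensity q U).mul hf), ← lintegral_const_mul' _ _ ENNReal.ofReal_ne_top]
  refine lintegral_congr fun z => ?_
  have hU := U.2.det_pos
  rw [← mul_assoc, ← ENNReal.ofReal_mul (Real.rpow_nonneg hU.le _), nuDensity, gram_sqrt_mul_mat,
    gramConst, inv_div, neg_div, Real.rpow_neg hU.le, neg_div, Real.rpow_neg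
      (det_transpose_mul_self_nonneg z)]
  have h1 := Real.rpow_pos_of_pos hU ((q : ℝ) / 2)
  congr 2
  field_simp

/-- The weight `det^(-p/2)` of `ν_U` turns the exponent `(p-q-1)/2` of the Gram image of Lebesgue
measure into `-(q+1)/2`, and the constant in `ν_U` is the inverse of `gramConst`. -/
theorem lintegral_gram_nu {p q : ℕ} (hqp : q ≤ p) (U : PD p) {f : PD q → ℝ≥0∞}
    (hf : Measurable f) : ∫⁻ x, f (gram U x) ∂nu q U = ∫⁻ S, f S ∂mu q := by
  have hc := gramConst_pos hqp
  rw [lintegral_nu U (f := fun x => f (gram U x)) (hf.comp (measurable_gram U))]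
  simp_rw [gram_sqrt_mul]
  have hF : Measurable fun A : Mat q q =>
      ENNReal.ofReal ((gramConst p q)⁻¹ * A.det ^ (-(p : ℝ) / 2)) * f (toPD A) :=
    (((measurable_det_mat q).pow_const _).const_mul _).ennreal_ofReal.mul
      (hf.comp (measurable_toPD q))
  rw [lintegral_gram_mat hqp hF, mu, lintegral_withDensity_eq_lintegral_mul _
    ((measurable_det_pd q).pow_const _).ennreal_ofReal hf]
  refine lintegral_congr fun S => ?_
  have hS := S.2.det_pos
  have e1 : (-((q : ℝ) + 1) / 2) = ((p : ℝ) - q - 1) / 2 + -(p : ℝ) / 2 := by ring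
  simp only [Pi.mul_apply]
  rw [toPD_coe, ← mul_assoc, ← ENNReal.ofReal_mul (by positivity), e1, Real.rpow_add hS]
  congr 2
  field_simp

theorem measurePreserving_gram {p q : ℕ} (hqp : q ≤ p) (U : PD p) :
    MeasurePreserving (gram U) (nu q U) (mu q) where
  measurable := measurable_gram U
  map_eq := by
    ext A hA
    rw [Measure.map_apply (measurable_gram U) hA,
      ← lintegral_indicator_one (measurable_gram U hA), ← lintegral_indicator_one hA,
      ← lintegral_gram_nu hqp U (measurable_one.indicator hA)]
    rfl

theorem PD.sqrt_one (p : ℕ) : (PD.one p).sqrt = PD.one p :=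
  (PD.eq_sqrt (B := PD.one p) (Matrix.one_mul _)).symm

theorem lintegral_nu_one {p q : ℕ} {f : Mat p q → ℝ≥0∞} (hf : Measurable f) :
    ∫⁻ x, f x ∂nu q (PD.one p)
      = ∫⁻ z, ENNReal.ofReal ((gramConst p q)⁻¹ * (zᵀ * z).det ^ (-(p : ℝ) / 2)) *
        f z ∂leb p q := by
  rw [lintegral_nu _ hf]
  simp_rw [PD.sqrt_one, PD.one, Matrix.one_mul]

theorem lintegral_nu_eq_one {p q : ℕ} (U : PD p) {f : Mat p q → ℝ≥0∞} (hf : Measurable f) :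
    ∫⁻ x, f x ∂nu q U = ∫⁻ z, f (U.sqrt.1 * z) ∂nu q (PD.one p) := by
  have hm : Measurable fun x : Mat p q => U.sqrt.1 * x :=
    (by fun_prop : Continuous fun x : Mat p q => U.sqrt.1 * x).measurable
  rw [lintegral_nu _ hf, lintegral_nu_one (f := fun z => f (U.sqrt.1 * z)) (hf.comp hm)]

theorem measurable_nuOneDensity (p q : ℕ) : Measurable fun z : Mat p q =>
    ENNReal.ofReal ((gramConst p q)⁻¹ * (zᵀ * z).det ^ (-(p : ℝ) / 2)) := by
  have h := (measurable_det_mat q).comp (measurable_gram_mat p q)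
  exact ((h.pow_const _).const_mul _).ennreal_ofReal

theorem gram_one {p q : ℕ} (x : Mat p q) : gram (PD.one p) x = toPD (xᵀ * x) := by
  have h := gram_sqrt_mul (PD.one p) x
  rwa [PD.sqrt_one, PD.one, Matrix.one_mul] at h

/-- The Jacobian `|det g|^p` is compensated by `det(zᵀz)^(-p/2)`. For `p = q` the density is also
transposition invariant, so `ν_I` is a two-sided Haar measure on the invertible matrices. -/
theorem lintegral_nu_mul_right {p q : ℕ} {g : Mat q q} (hg : g.det ≠ 0) {f : Mat p q → ℝ≥0∞}
    (hf : Measurable f) :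
    ∫⁻ x, f (x * g) ∂nu q (PD.one p) = ∫⁻ x, f x ∂nu q (PD.one p) := by
  have hm : Measurable fun x : Mat p q => x * g :=
    (by fun_prop : Continuous fun x : Mat p q => x * g).measurable
  have hF := (measurable_nuOneDensity p q).mul hf
  rw [lintegral_nu_one (f := fun x => f (x * g)) (hf.comp hm), lintegral_nu_one hf]
  have h := lintegral_leb_mul_right hg hF
  have ha : 0 < |g.det| := abs_pos.2 hg
  have h2 : ∫⁻ z, ENNReal.ofReal ((gramConst p q)⁻¹ * (zᵀ * z).det ^ (-(p : ℝ) / 2)) *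
        f (z * g) ∂leb p q = ENNReal.ofReal (|g.det| ^ p) * ∫⁻ z : Mat p q,
        ((fun z : Mat p q => ENNReal.ofReal ((gramConst p q)⁻¹ *
          (zᵀ * z).det ^ (-(p : ℝ) / 2))) * f) (z * g) ∂leb p q := by
    rw [← lintegral_const_mul' _ _ ENNReal.ofReal_ne_top]
    refine lintegral_congr fun z => ?_
    simp only [Pi.mul_apply]
    rw [← mul_assoc, ← ENNReal.ofReal_mul (by positivity)]
    congr 2
    have e1 : ((z * g)ᵀ * (z * g)).det = |g.det| ^ 2 * (zᵀ * z).det := by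
      rw [transpose_mul, show gᵀ * zᵀ * (z * g) = gᵀ * (zᵀ * z) * g by
        simp only [Matrix.mul_assoc], det_mul, det_mul, det_transpose, sq_abs]
      ring
    have e2 : (|g.det| ^ 2) ^ (-(p : ℝ) / 2) = (|g.det| ^ p)⁻¹ := by
      rw [← Real.rpow_natCast, ← Real.rpow_mul ha.le, ← Real.rpow_natCast, ← Real.rpow_neg ha.le]
      congr 1
      push_cast; ring
    rw [e1, Real.mul_rpow (by positivity) (det_transpose_mul_self_nonneg z), e2]
    field_simp
  rw [h2, h, ← mul_assoc, ← ENNReal.ofReal_mul (by positivity), ← mul_pow,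
    mul_inv_cancel₀ ha.ne']
  simp

theorem lintegral_nu_transpose {q : ℕ} {f : Mat q q → ℝ≥0∞} (hf : Measurable f) :
    ∫⁻ x, f xᵀ ∂nu q (PD.one q) = ∫⁻ x, f x ∂nu q (PD.one q) := by
  have h1 := measurePreserving_transpose q q
  have h2 := h1.lintegral_comp ((measurable_nuOneDensity q q).mul hf)
  simp only [Pi.mul_apply] at h2
  rw [lintegral_nu_one (f := fun x => f xᵀ) (hf.comp h1.measurable), lintegral_nu_one hf, ← h2]
  refine lintegral_congr fun z => ?_
  rw [det_mul, det_mul, transpose_transpose, mul_comm zᵀ.det]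

theorem lintegral_nu_mul_left {q : ℕ} {g : Mat q q} (hg : g.det ≠ 0) {f : Mat q q → ℝ≥0∞}
    (hf : Measurable f) :
    ∫⁻ x, f (g * x) ∂nu q (PD.one q) = ∫⁻ x, f x ∂nu q (PD.one q) := by
  have hm : Measurable fun x : Mat q q => g * x :=
    (by fun_prop : Continuous fun x : Mat q q => g * x).measurable
  have ht := measurable_transpose_mat q q
  rw [← lintegral_nu_transpose (f := fun x => f (g * x)) (hf.comp hm), ← lintegral_nu_transpose hf,
    ← lintegral_nu_mul_right (g := gᵀ) (by rwa [det_transpose]) (f := fun x => f xᵀ) (hf.comp ht)]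
  simp

theorem ae_det_ne_zero (q : ℕ) : ∀ᵐ z ∂nu q (PD.one q), z.det ≠ 0 := by
  refine (nu_absolutelyContinuous q (PD.one q)).ae_le ?_
  filter_upwards [ae_posDef_gram (le_refl q)] with z hz h
  have := hz.det_pos
  simp [det_mul, h] at this

/-- A test function whose integral can be cancelled in `lintegral_nu_inv`: its determinant factor
removes the density of `ν_I` and leaves a Gaussian integral. -/
theorem exists_lintegral_nu_ne_zero_ne_top (q : ℕ) : ∃ k : Mat q q → ℝ≥0∞, Measurable k ∧
    ∫⁻ z, k z ∂nu q (PD.one q) ≠ 0 ∧ ∫⁻ z, k z ∂nu q (PD.one q) ≠ ⊤ := by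
  let k : Mat q q → ℝ≥0∞ := fun z =>
    ENNReal.ofReal ((zᵀ * z).det ^ ((q : ℝ) / 2)) * ENNReal.ofReal (Real.exp (-(zᵀ * z).trace))
  have hk1 : Measurable fun z : Mat q q => ENNReal.ofReal ((zᵀ * z).det ^ ((q : ℝ) / 2)) :=
    (((measurable_det_mat q).comp (measurable_gram_mat q q)).pow_const _).ennreal_ofReal
  have hk2 : Measurable fun z : Mat q q => ENNReal.ofReal (Real.exp (-(zᵀ * z).trace)) :=
    (by fun_prop : Continuous fun x : Mat q q =>
        Real.exp (-(xᵀ * x).trace)).measurable.ennreal_ofReal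
  have hk : Measurable k := hk1.mul hk2
  have hc := gramConst_pos (le_refl q)
  have hkL : ∫⁻ z, k z ∂nu q (PD.one q)
      = ENNReal.ofReal ((gramConst q q)⁻¹ * Real.pi ^ ((q : ℝ) * q / 2)) := by
    rw [lintegral_nu_one hk, ENNReal.ofReal_mul (by positivity), ← lintegral_exp_trace,
      ← lintegral_const_mul' _ _ ENNReal.ofReal_ne_top]
    refine lintegral_congr_ae ?_
    filter_upwards [ae_posDef_gram (le_refl q)] with z hz
    have h1 := hz.det_pos
    simp only [k]
    rw [← mul_assoc, ← ENNReal.ofReal_mul (by positivity), mul_assoc, ← Real.rpow_add h1]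
    congr 2
    rw [neg_div, neg_add_cancel, Real.rpow_zero, mul_one]
  refine ⟨k, hk, ?_, ?_⟩
  · rw [hkL]; simp only [ne_eq, ENNReal.ofReal_eq_zero, not_le]; positivity
  · rw [hkL]; exact ENNReal.ofReal_ne_top

/-- The classical argument for unimodular groups, carried by `∬ f(z⁻¹) k(wz)`. Right invariance in
`w` splits off `∫ k`. Replacing `z` by `w⁻¹z` gives `∬ f(z⁻¹w) k(z)`, where left invariance in `w`
splits off `∫ f`. Cancelling `∫ k` leaves the claim. -/
theorem lintegral_nu_inv {q : ℕ} {f : Mat q q → ℝ≥0∞} (hf : Measurable f) :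
    ∫⁻ x, f x⁻¹ ∂nu q (PD.one q) = ∫⁻ x, f x ∂nu q (PD.one q) := by
  obtain ⟨k, hk, hk0, hkt⟩ := exists_lintegral_nu_ne_zero_ne_top q
  set L := nu q (PD.one q) with hL
  have hinv := measurable_inv_mat q
  have m1 : Measurable fun a : Mat q q × Mat q q => a.1 * a.2 :=
    (by fun_prop : Continuous fun a : Mat q q × Mat q q => a.1 * a.2).measurable
  have hne := ae_det_ne_zero q
  have s1 : (∫⁻ x, f x⁻¹ ∂L) * ∫⁻ w, k w ∂L = ∫⁻ z, ∫⁻ w, f z⁻¹ * k (w * z) ∂L ∂L := by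
    rw [← lintegral_mul_const (f := fun x : Mat q q => f x⁻¹) _ (hf.comp hinv)]
    refine lintegral_congr_ae ?_
    filter_upwards [hne] with z hz
    rw [lintegral_const_mul (f := fun w => k (w * z)) _
      (hk.comp (m1.comp measurable_prodMk_right)), lintegral_nu_mul_right hz hk]
  have hm2 : Measurable (Function.uncurry fun z w : Mat q q => f z⁻¹ * k (w * z)) :=
    (hf.comp (hinv.comp measurable_fst)).mul (hk.comp (m1.comp measurable_swap))
  have hm3 : Measurable (Function.uncurry fun w z : Mat q q => f (z⁻¹ * w) * k z) :=
    (hf.comp (m1.comp ((hinv.comp measurable_snd).prodMk measurable_fst))).mul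
      (hk.comp measurable_snd)
  have hm4 : ∀ w : Mat q q, Measurable fun z : Mat q q => f (z⁻¹ * w) * k z := fun w => by
    have h1 : Measurable fun z : Mat q q => z⁻¹ * w := m1.comp (hinv.prodMk measurable_const)
    exact (hf.comp h1).mul hk
  have s2 : ∫⁻ z, ∫⁻ w, f z⁻¹ * k (w * z) ∂L ∂L = ∫⁻ w, ∫⁻ z, f (z⁻¹ * w) * k z ∂L ∂L := by
    rw [lintegral_lintegral_swap hm2.aemeasurable]
    refine lintegral_congr_ae ?_
    filter_upwards [hne] with w hw
    have hwu : IsUnit w.det := isUnit_iff_ne_zero.2 hw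
    rw [← lintegral_nu_mul_left hw (hm4 w)]
    refine lintegral_congr fun z => ?_
    rw [Matrix.mul_inv_rev, Matrix.mul_assoc, Matrix.nonsing_inv_mul _ hwu, Matrix.mul_one]
  have s3 : ∫⁻ w, ∫⁻ z, f (z⁻¹ * w) * k z ∂L ∂L = (∫⁻ x, f x ∂L) * ∫⁻ w, k w ∂L := by
    rw [lintegral_lintegral_swap hm3.aemeasurable, ← lintegral_const_mul _ hk]
    refine lintegral_congr_ae ?_
    filter_upwards [hne] with z hz
    have hz' : z⁻¹.det ≠ 0 := by
      rw [det_nonsing_inv, Ring.inverse_eq_inv']; exact inv_ne_zero hz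
    rw [lintegral_mul_const (f := fun w => f (z⁻¹ * w)) _
      (hf.comp (m1.comp measurable_prodMk_left)), lintegral_nu_mul_left hz' hf]
  exact (ENNReal.mul_left_inj hk0 hkt).1 (s1.trans (s2.trans s3))

/-- Since `(z T^{1/2})ᵀ(z T^{1/2}) = (zᵀz) ∘ T`, this is right invariance of `ν_I` on square
matrices seen through Gram matrices. -/
theorem measurePreserving_circ {q : ℕ} (T : PD q) :
    MeasurePreserving (fun S => PD.circ S T) (mu q) (mu q) where
  measurable := PD.measurable_circ_left T
  map_eq := by
    refine Measure.ext_of_lintegral _ fun f hf => ?_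
    have hm := PD.measurable_circ_left T
    rw [lintegral_map hf hm, ← lintegral_gram_nu (le_refl q) (PD.one q) hf,
      ← lintegral_gram_nu (le_refl q) (PD.one q) (f := fun S => f (PD.circ S T)) (hf.comp hm),
      ← lintegral_nu_mul_right T.sqrt.2.det_pos.ne' (f := fun x => f (gram (PD.one q) x))
        (hf.comp (measurable_gram _))]
    refine lintegral_congr_ae ((nu_absolutelyContinuous q (PD.one q)).ae_le ?_)
    filter_upwards [ae_posDef_gram (le_refl q)] with z hz
    have h1 : (z * T.sqrt.1)ᵀ * (z * T.sqrt.1) = (PD.circ ⟨zᵀ * z, hz⟩ T).1 := by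
      rw [transpose_mul, T.sqrt.transpose_eq, PD.circ]
      simp only [Matrix.mul_assoc]
    simp only [gram_one, toPD_of_posDef hz, h1, toPD_coe]

/-- The Gram matrix of the inverse transpose of `z` is `(zᵀz)⁻¹`, so the transposition and inversion
invariance of `ν_I` descend to `μ`. -/
theorem measurePreserving_inv_mu (q : ℕ) : MeasurePreserving PD.inv (mu q) (mu q) where
  measurable := PD.measurable_inv q
  map_eq := by
    refine Measure.ext_of_lintegral _ fun f hf => ?_
    have hm := PD.measurable_inv q
    have hg : Measurable fun x : Mat q q => f (gram (PD.one q) x) := hf.comp (measurable_gram _)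
    rw [lintegral_map hf hm, ← lintegral_gram_nu (le_refl q) (PD.one q) hf,
      ← lintegral_gram_nu (le_refl q) (PD.one q) (f := fun S => f (PD.inv S)) (hf.comp hm),
      ← lintegral_nu_transpose (f := fun x => f (gram (PD.one q) x)) hg,
      ← lintegral_nu_inv (f := fun x => f (gram (PD.one q) xᵀ))
        (hg.comp (measurable_transpose_mat q q))]
    refine lintegral_congr_ae ((nu_absolutelyContinuous q (PD.one q)).ae_le ?_)
    filter_upwards [ae_posDef_gram (le_refl q)] with z hz
    have h1 : (z⁻¹ᵀ)ᵀ * z⁻¹ᵀ = (PD.inv ⟨zᵀ * z, hz⟩).1 := by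
      rw [transpose_transpose]
      exact (by rw [Matrix.mul_inv_rev, transpose_nonsing_inv] : z⁻¹ * z⁻¹ᵀ = (zᵀ * z)⁻¹)
    simp only [gram_one, toPD_of_posDef hz, h1, toPD_coe]

/-! ### The Siegel integral and the Inverse-Wishart and Matrix-Normal laws -/

theorem measurable_trace_mul_pd {q : ℕ} (B : Mat q q) :
    Measurable fun S : PD q => (B * S.1).trace := by
  have h : Measurable fun S : Mat q q => (B * S).trace :=
    (by fun_prop : Continuous fun S : Mat q q => (B * S).trace).measurable
  exact h.comp measurable_subtype_coe

theorem measurable_siegel {q : ℕ} (a : ℝ) (B : Mat q q) : Measurable fun S : PD q =>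
    ENNReal.ofReal (S.1.det ^ a * Real.exp (-(B * S.1).trace)) :=
  (((measurable_det_pd q).pow_const _).mul (measurable_trace_mul_pd B).neg.exp).ennreal_ofReal

/-- This is the Gaussian integral over `M(r,q)` read through `x ↦ xᵀx`. Integer `r ≥ q` is enough:
the cases used are `r = p` (normalisation) and `r = 2p` (mixture). -/
theorem lintegral_siegel_one {q r : ℕ} (hqr : q ≤ r) :
    ∫⁻ S, ENNReal.ofReal (S.1.det ^ ((r : ℝ) / 2) * Real.exp (-(1 * S.1).trace)) ∂mu q
      = ENNReal.ofReal (mvGamma q ((r : ℝ) / 2)) := by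
  have hc := gramConst_pos hqr
  have hf : Measurable fun A : Mat q q => ENNReal.ofReal (Real.exp (-A.trace)) :=
    (by fun_prop : Continuous fun A : Mat q q => Real.exp (-A.trace)).measurable.ennreal_ofReal
  have h := lintegral_gram_mat hqr hf
  rw [lintegral_exp_trace] at h
  have e0 : mvGamma q ((r : ℝ) / 2) = (gramConst r q)⁻¹ * Real.pi ^ ((r : ℝ) * q / 2) := by
    rw [gramConst, inv_div, div_mul_cancel₀ _ (Real.rpow_pos_of_pos Real.pi_pos _).ne']
  rw [e0, ENNReal.ofReal_mul (by positivity), h, mu,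
    lintegral_withDensity_eq_lintegral_mul _ ((measurable_det_pd q).pow_const _).ennreal_ofReal
      (measurable_siegel _ _), ← lintegral_const_mul' _ _ ENNReal.ofReal_ne_top]
  refine lintegral_congr fun S => ?_
  have hS := S.2.det_pos
  have e1 : ((r : ℝ) - q - 1) / 2 = -((q : ℝ) + 1) / 2 + (r : ℝ) / 2 := by ring
  simp only [Pi.mul_apply]
  rw [Matrix.one_mul, ← mul_assoc, ← ENNReal.ofReal_mul (by positivity),
    ← ENNReal.ofReal_mul (by positivity), ← ENNReal.ofReal_mul (by positivity), e1,
    Real.rpow_add hS]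
  congr 1
  field_simp

theorem lintegral_siegel {q r : ℕ} (hqr : q ≤ r) (B : PD q) :
    ∫⁻ S, ENNReal.ofReal (S.1.det ^ ((r : ℝ) / 2) * Real.exp (-(B.1 * S.1).trace)) ∂mu q
      = ENNReal.ofReal (mvGamma q ((r : ℝ) / 2) * B.1.det ^ (-((r : ℝ) / 2))) := by
  have hB := B.2.det_pos
  rw [mul_comm, ENNReal.ofReal_mul (by positivity), ← lintegral_siegel_one hqr,
    ← (measurePreserving_circ B).lintegral_comp (measurable_siegel ((r : ℝ) / 2) 1),
    ← lintegral_const_mul' _ _ ENNReal.ofReal_ne_top]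
  refine lintegral_congr fun S => ?_
  have hS := S.2.det_pos
  have hb := Real.rpow_pos_of_pos hB ((r : ℝ) / 2)
  rw [← ENNReal.ofReal_mul (by positivity), Matrix.one_mul, PD.trace_circ, PD.det_circ,
    Real.mul_rpow hS.le hB.le, Real.rpow_neg hB.le]
  congr 1
  field_simp

theorem lintegral_siegel_inv {q r : ℕ} (hqr : q ≤ r) (B : PD q) :
    ∫⁻ S, ENNReal.ofReal (S.1.det ^ (-((r : ℝ) / 2)) * Real.exp (-(B.1 * S.1⁻¹).trace)) ∂mu q
      = ENNReal.ofReal (mvGamma q ((r : ℝ) / 2) * B.1.det ^ (-((r : ℝ) / 2))) := by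
  rw [← lintegral_siegel hqr, ← (measurePreserving_inv_mu q).lintegral_comp (measurable_siegel _ _)]
  refine lintegral_congr fun S => ?_
  rw [PD.det_inv, Real.inv_rpow S.2.det_pos.le, Real.rpow_neg S.2.det_pos.le, PD.inv]

/-- Half of a positive definite matrix. -/
def PD.half {q : ℕ} (B : PD q) : PD q := ⟨(1 / 2 : ℝ) • B.1, B.2.smul (by norm_num)⟩

theorem PD.det_half_rpow {q : ℕ} (B : PD q) (a : ℝ) :
    B.half.1.det ^ (-a) = 2 ^ (a * q) * B.1.det ^ (-a) := by
  have h2 : (2 : ℝ) ^ (a * q) = ((2 : ℝ) ^ q) ^ a := by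
    rw [← Real.rpow_natCast, ← Real.rpow_mul zero_le_two, mul_comm]
  rw [PD.half, det_smul, Fintype.card_fin, Real.mul_rpow (by positivity) B.2.det_pos.le, h2,
    one_div, inv_pow, Real.inv_rpow (by positivity), ← Real.rpow_neg (by positivity), neg_neg]

theorem PD.trace_half_mul {q : ℕ} (B : PD q) (A : Mat q q) :
    (B.half.1 * A).trace = (B.1 * A).trace / 2 := by
  rw [PD.half, Matrix.smul_mul, trace_smul, smul_eq_mul]; ring

theorem isProbabilityMeasure_invWishart {p q : ℕ} (hqp : q ≤ p) (T : PD q) :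
    IsProbabilityMeasure (invWishart (p : ℝ) T) := by
  constructor
  have hT := T.2.det_pos
  have hG : 0 < mvGamma q ((p : ℝ) / 2) := mvGamma_pos (by
    have : (q : ℝ) ≤ p := by exact_mod_cast hqp
    linarith)
  have e1 : ∀ S : PD q, ENNReal.ofReal (invWishartDensity (p : ℝ) T S)
      = ENNReal.ofReal (T.1.det ^ ((p : ℝ) / 2) / (2 ^ ((p : ℝ) * q / 2) *
        mvGamma q ((p : ℝ) / 2))) *
        ENNReal.ofReal (S.1.det ^ (-((p : ℝ) / 2)) * Real.exp (-(T.half.1 * S.1⁻¹).trace)) := by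
    intro S
    have hS := S.2.det_pos
    rw [← ENNReal.ofReal_mul (by positivity), PD.trace_half_mul, invWishartDensity,
      Real.rpow_neg hS.le, neg_div]
    congr 1
    have := Real.rpow_pos_of_pos hS ((p : ℝ) / 2)
    field_simp
  rw [invWishart, withDensity_apply _ MeasurableSet.univ, Measure.restrict_univ]
  simp_rw [e1]
  rw [lintegral_const_mul' _ _ ENNReal.ofReal_ne_top, lintegral_siegel_inv hqp, PD.det_half_rpow,
    ← ENNReal.ofReal_mul (by positivity), Real.rpow_neg hT.le, ← ENNReal.ofReal_one]
  congr 1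
  have := Real.rpow_pos_of_pos hT ((p : ℝ) / 2)
  rw [show (p : ℝ) / 2 * q = p * q / 2 by ring]
  field_simp

theorem invWishartDensity_nonneg {p q : ℕ} (hqp : q ≤ p) (T V : PD q) :
    0 ≤ invWishartDensity (p : ℝ) T V := by
  have := T.2.det_pos
  have := V.2.det_pos
  have hG : 0 < mvGamma q ((p : ℝ) / 2) := mvGamma_pos (by
    have : (q : ℝ) ≤ p := by exact_mod_cast hqp
    linarith)
  unfold invWishartDensity
  positivity

theorem isProbabilityMeasure_matrixNormal {p q : ℕ} (U : PD p) (V : PD q) :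
    IsProbabilityMeasure (matrixNormal (0 : Mat p q) U V) := by
  constructor
  have hU := U.2.det_pos
  have hV := V.2.det_pos
  have hVs := V.sqrt.2.det_pos
  have hm : Measurable fun w : Mat p q => ENNReal.ofReal (matrixNormalDensity 0 U V w) :=
    ((measurable_matrixNormalDensity (0 : Mat p q) U).comp
      (measurable_prodMk_left (x := V))).ennreal_ofReal
  rw [matrixNormal, withDensity_apply _ MeasurableSet.univ, Measure.restrict_univ,
    lintegral_leb_sqrt_mul U hm]
  -- The substitution `w = U^{1/2} z (√2 V^{1/2})` reduces the exponent to `-tr(zᵀz)`.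
  set g : Mat q q := √2 • V.sqrt.1 with hg
  have hgd : g.det = √2 ^ q * V.sqrt.1.det := by rw [hg, det_smul, Fintype.card_fin]
  have hgp : 0 < g.det := by rw [hgd]; positivity
  have hm2 : Measurable fun z : Mat p q =>
      ENNReal.ofReal (matrixNormalDensity 0 U V (U.sqrt.1 * z)) :=
    hm.comp (by fun_prop : Continuous fun x : Mat p q => U.sqrt.1 * x).measurable
  have h1 := lintegral_leb_mul_right hgp.ne' hm2
  have e1 : ∀ z : Mat p q, ENNReal.ofReal (matrixNormalDensity 0 U V (U.sqrt.1 * (z * g)))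
      = ENNReal.ofReal (((2 * Real.pi) ^ ((p : ℝ) * q / 2) * U.1.det ^ ((q : ℝ) / 2) *
        V.1.det ^ ((p : ℝ) / 2))⁻¹) * ENNReal.ofReal (Real.exp (-(zᵀ * z).trace)) := by
    intro z
    rw [← ENNReal.ofReal_mul (by positivity), matrixNormalDensity, sub_zero, Matrix.mul_assoc V.1⁻¹,
      Matrix.mul_assoc V.1⁻¹, gram_sqrt_mul_mat]
    have e2 : (V.1⁻¹ * ((z * g)ᵀ * (z * g))).trace = 2 * (zᵀ * z).trace := by
      rw [transpose_mul, hg, transpose_smul, V.sqrt.transpose_eq, Matrix.smul_mul, Matrix.mul_smul,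
        Matrix.smul_mul, Matrix.mul_smul, Matrix.mul_smul, Matrix.mul_smul, smul_smul,
        Real.mul_self_sqrt zero_le_two, trace_smul, smul_eq_mul, trace_mul_comm]
      congr 1
      rw [show V.sqrt.1 * zᵀ * (z * V.sqrt.1) * V.1⁻¹
        = V.sqrt.1 * (zᵀ * z * (V.sqrt.1 * V.1⁻¹)) by simp only [Matrix.mul_assoc],
        trace_mul_comm, show zᵀ * z * (V.sqrt.1 * V.1⁻¹) * V.sqrt.1
        = zᵀ * z * (V.sqrt.1 * V.1⁻¹ * V.sqrt.1) by simp only [Matrix.mul_assoc],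
        V.sqrt_mul_inv_mul_sqrt, Matrix.mul_one]
    rw [e2, show -(2 * (zᵀ * z).trace) / 2 = -(zᵀ * z).trace by ring]
    congr 1
    rw [div_eq_mul_inv, mul_comm]
  have h2 : ∫⁻ z : Mat p q, ENNReal.ofReal (matrixNormalDensity 0 U V (U.sqrt.1 * z)) ∂leb p q
      = ENNReal.ofReal (g.det ^ p) * ∫⁻ z : Mat p q,
        ENNReal.ofReal (matrixNormalDensity 0 U V (U.sqrt.1 * (z * g))) ∂leb p q := by
    rw [h1, ← mul_assoc, ← ENNReal.ofReal_mul (by positivity), abs_of_pos hgp, ← mul_pow,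
      mul_inv_cancel₀ hgp.ne']
    simp
  rw [h2]
  simp_rw [e1]
  rw [lintegral_const_mul' _ _ ENNReal.ofReal_ne_top, lintegral_exp_trace,
    ← ENNReal.ofReal_mul (by positivity), ← ENNReal.ofReal_mul (by positivity),
    ← ENNReal.ofReal_mul (by positivity), ← ENNReal.ofReal_one]
  congr 1
  have e3 : g.det ^ p = 2 ^ ((p : ℝ) * q / 2) * V.1.det ^ ((p : ℝ) / 2) := by
    rw [hgd, mul_pow, V.det_sqrt, ← Real.rpow_natCast (V.1.det ^ _), ← Real.rpow_mul hV.le,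
      Real.sqrt_eq_rpow, ← pow_mul, ← Real.rpow_natCast, ← Real.rpow_mul zero_le_two]
    congr 2
    · push_cast; ring
    · ring
  rw [e3, Real.mul_rpow zero_le_two Real.pi_pos.le]
  have := Real.rpow_pos_of_pos hU ((q : ℝ) / 2)
  have := Real.rpow_pos_of_pos hV ((p : ℝ) / 2)
  field_simp

/-! ### The density of the MpCN proposal -/

/-- The `V`-mixture of the `N_{p,q}(0, U, V)` densities with mixing law `W_q⁻¹(p, T)`. -/
def mixtureDensity {p q : ℕ} (U : PD p) (T : PD q) (w : Mat p q) : ℝ :=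
  mvGamma q p / (mvGamma q ((p : ℝ) / 2) * Real.pi ^ ((p : ℝ) * q / 2)) *
    (U.1.det ^ (-(q : ℝ) / 2) * T.1.det ^ ((p : ℝ) / 2) /
      (T.1 + wᵀ * U.1⁻¹ * w).det ^ p)

theorem posSemidef_gram {p q : ℕ} (U : PD p) (w : Mat p q) : (wᵀ * U.1⁻¹ * w).PosSemidef :=
  U.2.inv.posSemidef.conjTranspose_mul_mul_same w

/-- Conjugacy: as a function of `V`, the product is an unnormalised Inverse-Wishart density with
scale `B = T + wᵀU⁻¹w` and `2p` in place of `p`, each density contributing `det(V)^(-p/2)`. Its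
total mass produces `det(B)^(-p)`. -/
theorem lintegral_mixture {p q : ℕ} (hqp : q ≤ p) (U : PD p) (T : PD q) (w : Mat p q) :
    ∫⁻ V, ENNReal.ofReal (invWishartDensity (p : ℝ) T V) *
      ENNReal.ofReal (matrixNormalDensity 0 U V w) ∂mu q
      = ENNReal.ofReal (mixtureDensity U T w) := by
  have hT := T.2.det_pos
  have hU := U.2.det_pos
  have hqp' : (q : ℝ) ≤ p := by exact_mod_cast hqp
  have hG : 0 < mvGamma q ((p : ℝ) / 2) := mvGamma_pos (by linarith)
  let B : PD q := ⟨T.1 + wᵀ * U.1⁻¹ * w, T.2.add_posSemidef (posSemidef_gram U w)⟩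
  have hB := B.2.det_pos
  have e1 : ∀ V : PD q, ENNReal.ofReal (invWishartDensity (p : ℝ) T V) *
      ENNReal.ofReal (matrixNormalDensity 0 U V w)
      = ENNReal.ofReal (T.1.det ^ ((p : ℝ) / 2) / (2 ^ ((p : ℝ) * q / 2) *
          mvGamma q ((p : ℝ) / 2)) /
          ((2 * Real.pi) ^ ((p : ℝ) * q / 2) * U.1.det ^ ((q : ℝ) / 2))) *
        ENNReal.ofReal (V.1.det ^ (-(((2 * p : ℕ) : ℝ) / 2)) *
          Real.exp (-(B.half.1 * V.1⁻¹).trace)) := by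
    intro V
    have hV := V.2.det_pos
    rw [← ENNReal.ofReal_mul (invWishartDensity_nonneg hqp T V),
      ← ENNReal.ofReal_mul (by positivity), PD.trace_half_mul, invWishartDensity,
      matrixNormalDensity, sub_zero]
    congr 1
    have e2 : (B.1 * V.1⁻¹).trace = (T.1 * V.1⁻¹).trace + (V.1⁻¹ * wᵀ * U.1⁻¹ * w).trace := by
      simp only [B]
      rw [Matrix.add_mul, trace_add, trace_mul_comm (wᵀ * U.1⁻¹ * w)]
      simp only [Matrix.mul_assoc]
    have e3 : V.1.det ^ (-(((2 * p : ℕ) : ℝ) / 2))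
        = (V.1.det ^ ((p : ℝ) / 2))⁻¹ * (V.1.det ^ ((p : ℝ) / 2))⁻¹ := by
      rw [← Real.rpow_neg hV.le, ← Real.rpow_add hV]
      congr 1; push_cast; ring
    rw [e2, e3, add_div, neg_add, Real.exp_add, neg_div, neg_div]
    have := Real.rpow_pos_of_pos hV ((p : ℝ) / 2)
    have := Real.rpow_pos_of_pos hU ((q : ℝ) / 2)
    field_simp
  simp_rw [e1]
  rw [lintegral_const_mul' _ _ ENNReal.ofReal_ne_top,
    lintegral_siegel_inv (show q ≤ 2 * p by omega), PD.det_half_rpow,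
    ← ENNReal.ofReal_mul (by positivity)]
  congr 1
  have e4 : ((2 * p : ℕ) : ℝ) / 2 = p := by push_cast; ring
  have e5 : (2 : ℝ) ^ ((p : ℝ) * q) = 2 ^ ((p : ℝ) * q / 2) * 2 ^ ((p : ℝ) * q / 2) := by
    rw [← Real.rpow_add two_pos]; congr 1; ring
  rw [e4, e5, Real.rpow_neg hB.le, Real.rpow_natCast, mixtureDensity, neg_div, Real.rpow_neg hU.le,
    Real.mul_rpow zero_le_two Real.pi_pos.le]
  simp only [B] at hB ⊢
  have := Real.rpow_pos_of_pos hU ((q : ℝ) / 2)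
  field_simp

theorem measurable_mixtureDensity {p q : ℕ} (U : PD p) (T : PD q) :
    Measurable fun w : Mat p q => ENNReal.ofReal (mixtureDensity U T w) := by
  have h : Measurable fun w : Mat p q => (T.1 + wᵀ * U.1⁻¹ * w).det :=
    (by fun_prop : Continuous fun w : Mat p q => (T.1 + wᵀ * U.1⁻¹ * w).det).measurable
  exact ((measurable_const.div (h.pow_const p)).const_mul _).ennreal_ofReal

instance instIsAddLeftInvariantLeb (p q : ℕ) : (leb p q).IsAddLeftInvariant :=
  inferInstanceAs (volume : Measure (Fin p → Fin q → ℝ)).IsAddLeftInvariant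

theorem lintegral_leb_affine {p q : ℕ} {c : ℝ} (hc : 0 < c) (m : Mat p q) {f : Mat p q → ℝ≥0∞}
    (hf : Measurable f) :
    ∫⁻ w, f (m + c • w) ∂leb p q
      = ENNReal.ofReal (c⁻¹ ^ (q * p)) * ∫⁻ y, f y ∂leb p q := by
  have hm : Measurable fun w : Mat p q => m + w :=
    (by fun_prop : Continuous fun w : Mat p q => m + w).measurable
  have h1 := lintegral_leb_mul_right (p := p) (g := c • (1 : Mat q q))
    (by rw [det_smul, det_one]; positivity) (hf.comp hm)
  have h2 : ∫⁻ y, f (m + y) ∂leb p q = ∫⁻ y, f y ∂leb p q := lintegral_add_left_eq_self _ m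
  simp only [Function.comp_def, Matrix.mul_smul, Matrix.mul_one, det_smul, det_one, mul_one,
    Fintype.card_fin, h2, abs_of_pos (pow_pos hc q)] at h1
  rw [h1, ← inv_pow, ← pow_mul]

theorem lintegral_mpcnProposal {p q : ℕ} (hqp : q ≤ p) (ρ : ℝ) (U : PD p) (x : Mat p q)
    {f : Mat p q → ℝ≥0∞} (hf : Measurable f) :
    ∫⁻ y, f y ∂mpcnProposal ρ U x
      = ∫⁻ w, f (√ρ • x + √(1 - ρ) • w) * ENNReal.ofReal (mixtureDensity U (gram U x) w)
        ∂leb p q := by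
  have hg : Measurable fun w : Mat p q => √ρ • x + √(1 - ρ) • w :=
    (by fun_prop : Continuous fun w : Mat p q => √ρ • x + √(1 - ρ) • w).measurable
  have hN := measurable_matrixNormalDensity (0 : Mat p q) U
  have hbind : Measurable fun V : PD q =>
      (matrixNormal 0 U V).map fun w => √ρ • x + √(1 - ρ) • w := by
    refine Measure.measurable_of_measurable_coe _ fun A hA => ?_
    have h := (mpcn_aux ρ U hA).comp (measurable_prodMk_left (x := x))
    exact h
  have hW : Measurable fun V : PD q =>
      ENNReal.ofReal (invWishartDensity (p : ℝ) (gram U x) V) :=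
    ((measurable_invWishartDensity q p).comp
      (measurable_prodMk_left (x := gram U x))).ennreal_ofReal
  have hfg : Measurable fun w => f (√ρ • x + √(1 - ρ) • w) := hf.comp hg
  have hNw : ∀ V : PD q, Measurable fun w : Mat p q =>
      ENNReal.ofReal (matrixNormalDensity 0 U V w) := fun V =>
    (hN.comp measurable_prodMk_left).ennreal_ofReal
  have e1 : ∀ V : PD q, ∫⁻ y, f y ∂((matrixNormal 0 U V).map fun w => √ρ • x + √(1 - ρ) • w)
      = ∫⁻ w, ENNReal.ofReal (matrixNormalDensity 0 U V w) * f (√ρ • x + √(1 - ρ) • w)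
        ∂leb p q := fun V => by
    rw [lintegral_map hf hg, matrixNormal, lintegral_withDensity_eq_lintegral_mul _ (hNw V) hfg]
    rfl
  have hpair : Measurable fun a : PD q × Mat p q =>
      ENNReal.ofReal (matrixNormalDensity 0 U a.1 a.2) * f (√ρ • x + √(1 - ρ) • a.2) :=
    hN.ennreal_ofReal.mul (hfg.comp measurable_snd)
  change ∫⁻ y, f y ∂((invWishart (p : ℝ) (gram U x)).bind fun V =>
    (matrixNormal 0 U V).map fun w => √ρ • x + √(1 - ρ) • w) = _
  rw [Measure.lintegral_bind hbind.aemeasurable hf.aemeasurable]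
  simp_rw [e1]
  rw [invWishart, lintegral_withDensity_eq_lintegral_mul _ hW hpair.lintegral_prod_right']
  simp only [Pi.mul_apply]
  have e2 : ∀ V : PD q, ENNReal.ofReal (invWishartDensity (p : ℝ) (gram U x) V) *
      ∫⁻ w, ENNReal.ofReal (matrixNormalDensity 0 U V w) * f (√ρ • x + √(1 - ρ) • w) ∂leb p q
      = ∫⁻ w, ENNReal.ofReal (invWishartDensity (p : ℝ) (gram U x) V) *
        (ENNReal.ofReal (matrixNormalDensity 0 U V w) * f (√ρ • x + √(1 - ρ) • w)) ∂leb p q :=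
    fun V => (lintegral_const_mul' _ _ ENNReal.ofReal_ne_top).symm
  simp_rw [e2]
  rw [lintegral_lintegral_swap ((hW.comp measurable_fst).mul hpair).aemeasurable]
  refine lintegral_congr fun w => ?_
  simp_rw [← mul_assoc]
  rw [lintegral_mul_const, lintegral_mixture hqp, mul_comm]
  exact hW.mul (hN.comp measurable_prodMk_right).ennreal_ofReal

theorem isMarkovKernel_mpcnProposal {p q : ℕ} (hqp : q ≤ p) (ρ : ℝ) (U : PD p) :
    IsMarkovKernel (mpcnProposal ρ U : Kernel (Mat p q) (Mat p q)) := by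
  refine ⟨fun x => ⟨?_⟩⟩
  have hg : Measurable fun w : Mat p q => √ρ • x + √(1 - ρ) • w :=
    (by fun_prop : Continuous fun w : Mat p q => √ρ • x + √(1 - ρ) • w).measurable
  have hbind : Measurable fun V : PD q =>
      (matrixNormal 0 U V).map fun w => √ρ • x + √(1 - ρ) • w := by
    refine Measure.measurable_of_measurable_coe _ fun A hA => ?_
    have h := (mpcn_aux ρ U hA).comp (measurable_prodMk_left (x := x))
    exact h
  change ((invWishart (p : ℝ) (gram U x)).bind fun V =>
    (matrixNormal 0 U V).map fun w => √ρ • x + √(1 - ρ) • w) Set.univ = 1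
  rw [Measure.bind_apply MeasurableSet.univ hbind.aemeasurable]
  have h1 : ∀ V : PD q, ((matrixNormal 0 U V).map fun w => √ρ • x + √(1 - ρ) • w) Set.univ = 1 :=
    fun V => by
      have := isProbabilityMeasure_matrixNormal U V
      rw [Measure.map_apply hg MeasurableSet.univ, Set.preimage_univ, measure_univ]
  have := isProbabilityMeasure_invWishart hqp (gram U x)
  simp [h1]

/-- `xᵀ U⁻¹ x + yᵀ U⁻¹ y - ρ^{1/2} (xᵀ U⁻¹ y + yᵀ U⁻¹ x)`. -/
def pairMat {p q : ℕ} (ρ : ℝ) (U : PD p) (x y : Mat p q) : Mat q q :=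
  xᵀ * U.1⁻¹ * x + yᵀ * U.1⁻¹ * y - √ρ • (xᵀ * U.1⁻¹ * y + yᵀ * U.1⁻¹ * x)

/-- The (symmetric) `ν_U`-density of the MpCN proposal at full-rank matrices. -/
def proposalDensity {p q : ℕ} (ρ : ℝ) (U : PD p) (x y : Mat p q) : ℝ :=
  (1 - ρ) ^ ((p : ℝ) * q / 2) * (mvGamma q p / mvGamma q ((p : ℝ) / 2) ^ 2) *
    ((xᵀ * U.1⁻¹ * x).det ^ ((p : ℝ) / 2) * (yᵀ * U.1⁻¹ * y).det ^ ((p : ℝ) / 2) /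
      (pairMat ρ U x y).det ^ p)

theorem proposalDensity_comm {p q : ℕ} (ρ : ℝ) (U : PD p) (x y : Mat p q) :
    proposalDensity ρ U x y = proposalDensity ρ U y x := by
  have : pairMat ρ U x y = pairMat ρ U y x := by
    rw [pairMat, pairMat, add_comm (xᵀ * U.1⁻¹ * x), add_comm (xᵀ * U.1⁻¹ * y)]
  rw [proposalDensity, proposalDensity, this, mul_comm ((xᵀ * U.1⁻¹ * x).det ^ _)]

theorem measurable_proposalDensity {p q : ℕ} (ρ : ℝ) (U : PD p) :
    Measurable fun a : Mat p q × Mat p q => ENNReal.ofReal (proposalDensity ρ U a.1 a.2) := by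
  have h1 : Measurable fun x : Mat p q => (xᵀ * U.1⁻¹ * x).det :=
    (by fun_prop : Continuous fun x : Mat p q => (xᵀ * U.1⁻¹ * x).det).measurable
  have h2 : Measurable fun a : Mat p q × Mat p q => (pairMat ρ U a.1 a.2).det := by
    unfold pairMat
    exact (by fun_prop : Continuous fun a : Mat p q × Mat p q => (a.1ᵀ * U.1⁻¹ * a.1 +
      a.2ᵀ * U.1⁻¹ * a.2 - √ρ • (a.1ᵀ * U.1⁻¹ * a.2 + a.2ᵀ * U.1⁻¹ * a.1)).det).measurable
  exact (((((h1.comp measurable_fst).pow_const _).mul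
    ((h1.comp measurable_snd).pow_const _)).div (h2.pow_const p)).const_mul _).ennreal_ofReal

/-- Solving for `w` and completing the square gives `pairMat`, symmetric because the coefficient
`1-ρ` of `xᵀU⁻¹x` is topped up by the `ρ` from the square. Full rank of `x` is needed for `gram U x`
to be the true Gram matrix and not its default value. -/
theorem mpcnProposal_eq_withDensity {p q : ℕ} (hqp : q ≤ p) {ρ : ℝ} (hρ0 : 0 ≤ ρ) (hρ1 : ρ < 1)
    (U : PD p) {x : Mat p q} (hx : (xᵀ * U.1⁻¹ * x).PosDef) :
    mpcnProposal ρ U x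
      = (nu q U).withDensity fun y => ENNReal.ofReal (proposalDensity ρ U x y) := by
  have hd : Measurable fun y => ENNReal.ofReal (proposalDensity ρ U x y) := by
    have h := (measurable_proposalDensity ρ U).comp (measurable_prodMk_left (x := x))
    exact h
  have hT : (gram U x).1 = xᵀ * U.1⁻¹ * x := by rw [gram_eq_toPD, coe_toPD hx]
  have hU := U.2.det_pos
  have hρ : 0 < 1 - ρ := by linarith
  have hc : 0 < √(1 - ρ) := Real.sqrt_pos.2 hρ
  refine Measure.ext_of_lintegral _ fun f hf => ?_
  rw [lintegral_mpcnProposal hqp ρ U x hf, lintegral_withDensity_eq_lintegral_mul _ hd hf, nu_eq,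
    lintegral_withDensity_eq_lintegral_mul _ (measurable_nuDensity q U) (hd.mul hf)]
  let F : Mat p q → ℝ≥0∞ := fun y => f y * ENNReal.ofReal (mixtureDensity U (gram U x)
    ((√(1 - ρ))⁻¹ • (y - √ρ • x)))
  have hF : Measurable F := by
    refine hf.mul ((measurable_mixtureDensity U (gram U x)).comp ?_)
    exact (by fun_prop : Continuous fun y : Mat p q =>
      (√(1 - ρ))⁻¹ • (y - √ρ • x)).measurable
  have e1 : ∀ w : Mat p q, f (√ρ • x + √(1 - ρ) • w) *
      ENNReal.ofReal (mixtureDensity U (gram U x) w) = F (√ρ • x + √(1 - ρ) • w) := fun w => by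
    simp only [F]
    rw [add_sub_cancel_left, smul_smul, inv_mul_cancel₀ hc.ne', one_smul]
  simp_rw [e1]
  rw [lintegral_leb_affine hc _ hF, ← lintegral_const_mul' _ _ ENNReal.ofReal_ne_top]
  refine lintegral_congr_ae ?_
  filter_upwards [ae_posDef_gramU hqp U] with y hy
  simp only [F, Pi.mul_apply]
  have e2 : ((1 - ρ)⁻¹ • pairMat ρ U x y) = (gram U x).1 + ((√(1 - ρ))⁻¹ • (y - √ρ • x))ᵀ * U.1⁻¹ *
      ((√(1 - ρ))⁻¹ • (y - √ρ • x)) := by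
    have e3 : (1 - ρ) • (xᵀ * U.1⁻¹ * x) + (y - √ρ • x)ᵀ * U.1⁻¹ * (y - √ρ • x)
        = pairMat ρ U x y := by
      have : √ρ * √ρ = ρ := Real.mul_self_sqrt hρ0
      rw [pairMat, transpose_sub, transpose_smul, Matrix.sub_mul, Matrix.sub_mul, Matrix.mul_sub,
        Matrix.mul_sub]
      simp only [Matrix.smul_mul, Matrix.mul_smul, smul_smul, this]
      module
    rw [← e3, hT, smul_add, smul_smul, inv_mul_cancel₀ hρ.ne', one_smul, transpose_smul]
    congr 1
    rw [Matrix.smul_mul, Matrix.smul_mul, Matrix.mul_smul, smul_smul, ← mul_inv,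
      Real.mul_self_sqrt hρ.le]
  -- A positive definite matrix plus a positive semidefinite one; this is where `ρ < 1` keeps the
  -- denominator positive.
  have hpos : 0 < (pairMat ρ U x y).det := by
    have h1 : ((1 - ρ)⁻¹ • pairMat ρ U x y).PosDef := by
      rw [e2]; exact (gram U x).2.add_posSemidef (posSemidef_gram U _)
    have h2 := h1.det_pos
    rw [det_smul] at h2
    exact pos_of_mul_pos_right h2 (by positivity)
  rw [mul_comm (f y), ← mul_assoc, ← ENNReal.ofReal_mul (by positivity), ← mul_assoc,
    ← ENNReal.ofReal_mul]
  · congr 2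
    rw [mixtureDensity, ← e2, nuDensity, proposalDensity, det_smul, Fintype.card_fin, hT, mul_pow,
      inv_pow, inv_pow, inv_pow, ← pow_mul]
    have hy' := Real.rpow_pos_of_pos hy.det_pos ((p : ℝ) / 2)
    have hx' := Real.rpow_pos_of_pos hx.det_pos ((p : ℝ) / 2)
    have hqp' : (q : ℝ) ≤ p := by exact_mod_cast hqp
    have hG : 0 < mvGamma q ((p : ℝ) / 2) := mvGamma_pos (by linarith)
    -- The Jacobian of `w ↦ y` contributes `(1-ρ)^(-pq/2)` and the `p`-th power of the determinant
    -- contributes `(1-ρ)^(pq)`; the net factor is `(1-ρ)^(pq/2)`.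
    have e5 : √(1 - ρ) ^ (q * p) = (1 - ρ) ^ ((p : ℝ) * q / 2) := by
      rw [Real.sqrt_eq_rpow, ← Real.rpow_natCast, ← Real.rpow_mul hρ.le]
      congr 1; push_cast; ring
    have e6 : (1 - ρ) ^ (q * p) = (1 - ρ) ^ ((p : ℝ) * q / 2) * (1 - ρ) ^ ((p : ℝ) * q / 2) := by
      rw [← Real.rpow_natCast, ← Real.rpow_add hρ]
      congr 1; push_cast; ring
    have h7 := Real.rpow_pos_of_pos hρ ((p : ℝ) * q / 2)
    rw [e5, e6]
    field_simp
  · have hqp' : (q : ℝ) ≤ p := by exact_mod_cast hqp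
    have hG : 0 < mvGamma q ((p : ℝ) / 2) := mvGamma_pos (by linarith)
    have := hy.det_pos
    unfold nuDensity
    positivity

/-- Tonelli and symmetry of the density; the rank-deficient matrices, where no density is claimed,
are `ν_U`-null. -/
theorem isReversible_mpcnProposal {p q : ℕ} (hqp : q ≤ p) {ρ : ℝ} (hρ0 : 0 ≤ ρ) (hρ1 : ρ < 1)
    (U : PD p) : (mpcnProposal ρ U : Kernel (Mat p q) (Mat p q)).IsReversible (nu q U) := by
  have key : ∀ A B : Set (Mat p q), MeasurableSet A → MeasurableSet B →
      ∫⁻ x in A, mpcnProposal ρ U x B ∂nu q U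
        = ∫⁻ x in A, ∫⁻ y in B, ENNReal.ofReal (proposalDensity ρ U x y) ∂nu q U ∂nu q U := by
    intro A B _ hB
    refine lintegral_congr_ae (ae_restrict_of_ae ?_)
    refine (nu_absolutelyContinuous q U).ae_le ?_
    filter_upwards [ae_posDef_gramU hqp U] with x hx
    rw [mpcnProposal_eq_withDensity hqp hρ0 hρ1 U hx, withDensity_apply _ hB]
  intro A B hA hB
  rw [key A B hA hB, key B A hB hA,
    lintegral_lintegral_swap (measurable_proposalDensity ρ U).aemeasurable]
  simp_rw [proposalDensity_comm]

/-! ### The uniform distribution on the orthogonal group -/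

instance instIsProbabilityMeasureUniformO (p : ℕ) : IsProbabilityMeasure (uniformO p) :=
  ⟨Measure.haarMeasure_self⟩

instance instIsHaarMeasureUniformO (p : ℕ) : (uniformO p).IsHaarMeasure :=
  Measure.isHaarMeasure_haarMeasure _

/-- Haar measure on a compact group is unique up to a scalar, which the total mass fixes. Applied to
translated and inverted Haar measure, this yields right and inversion invariance. -/
theorem eq_uniformO {p : ℕ} (m : Measure (Matrix.orthogonalGroup (Fin p) ℝ))
    [IsProbabilityMeasure m] [m.IsMulLeftInvariant] : m = uniformO p := by
  have h := Measure.isMulInvariant_eq_smul_of_compactSpace m (uniformO p)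
  have h1 : m Set.univ = _ := congrArg (fun n => n Set.univ) h
  simp only [measure_univ, Measure.smul_apply] at h1
  rw [h]
  ext A
  rw [Measure.smul_apply]
  have h2 : ((m.haarScalarFactor (uniformO p) : ℝ≥0) : ℝ≥0∞) = 1 := by
    simpa [ENNReal.smul_def] using h1.symm
  simp [ENNReal.smul_def, h2]

instance instIsMulRightInvariantUniformO (p : ℕ) : (uniformO p).IsMulRightInvariant := by
  refine ⟨fun g => ?_⟩
  have : IsProbabilityMeasure ((uniformO p).map (· * g)) :=
    Measure.isProbabilityMeasure_map (measurable_mul_const g).aemeasurable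
  exact eq_uniformO _

instance instIsInvInvariantUniformO (p : ℕ) : (uniformO p).IsInvInvariant := by
  refine ⟨?_⟩
  have : IsProbabilityMeasure (uniformO p).inv :=
    Measure.isProbabilityMeasure_map measurable_inv.aemeasurable
  exact eq_uniformO _

theorem lintegral_uniformO_mul_right {p : ℕ} (f : Matrix.orthogonalGroup (Fin p) ℝ → ℝ≥0∞)
    (g : Matrix.orthogonalGroup (Fin p) ℝ) :
    ∫⁻ u, f (u * g) ∂uniformO p = ∫⁻ u, f u ∂uniformO p :=
  lintegral_mul_right_eq_self f g

theorem lintegral_uniformO_mul_left {p : ℕ} (f : Matrix.orthogonalGroup (Fin p) ℝ → ℝ≥0∞)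
    (g : Matrix.orthogonalGroup (Fin p) ℝ) :
    ∫⁻ u, f (g * u) ∂uniformO p = ∫⁻ u, f u ∂uniformO p :=
  lintegral_mul_left_eq_self f g

theorem lintegral_uniformO_inv {p : ℕ} (f : Matrix.orthogonalGroup (Fin p) ℝ → ℝ≥0∞) :
    ∫⁻ u, f u⁻¹ ∂uniformO p = ∫⁻ u, f u ∂uniformO p :=
  lintegral_inv_eq_self f

/-- The first `q` columns of a matrix. -/
def cols {p q : ℕ} (hqp : q ≤ p) (u : Mat p p) : Mat p q := u.submatrix id (Fin.castLE hqp)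

theorem cols_mul {p q : ℕ} (hqp : q ≤ p) (u v : Mat p p) : cols hqp (u * v) = u * cols hqp v :=
  rfl

theorem cols_eq_mul {p q : ℕ} (hqp : q ≤ p) (u : Mat p p) : cols hqp u = u * cols hqp 1 := by
  rw [← cols_mul, Matrix.mul_one]

theorem cols_one_transpose_mul {p q n : ℕ} (hqp : q ≤ p) (v : Mat p n) :
    (cols hqp 1)ᵀ * v = v.submatrix (Fin.castLE hqp) id := by
  ext i j
  simp [cols, Matrix.mul_apply, Matrix.one_apply]

theorem measurable_cols {p q : ℕ} (hqp : q ≤ p) :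
    Measurable fun u : Matrix.orthogonalGroup (Fin p) ℝ => cols hqp u.1 :=
  (by unfold cols; fun_prop : Continuous fun u : Matrix.orthogonalGroup (Fin p) ℝ =>
    cols hqp u.1).measurable

theorem orthogonal_transpose_mul {p : ℕ} (u : Matrix.orthogonalGroup (Fin p) ℝ) :
    u.1ᵀ * u.1 = 1 := (mem_orthogonalGroup_iff' (Fin p) ℝ).1 u.2

theorem cols_transpose_mul_cols {p q : ℕ} (hqp : q ≤ p)
    (u : Matrix.orthogonalGroup (Fin p) ℝ) : (cols hqp u.1)ᵀ * cols hqp u.1 = 1 := by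
  rw [cols_eq_mul, transpose_mul, show (cols hqp 1)ᵀ * u.1ᵀ * (u.1 * cols hqp 1)
    = (cols hqp 1)ᵀ * (u.1ᵀ * u.1) * cols hqp 1 by simp only [Matrix.mul_assoc],
    orthogonal_transpose_mul, Matrix.mul_one, cols_one_transpose_mul]
  ext i j
  simp [cols, Matrix.one_apply]

/-- An orthonormal basis of the complement of the columns of `Z` completes them to an orthogonal
matrix. -/
theorem exists_orthogonal_cols {p q : ℕ} (hqp : q ≤ p) {Z : Mat p q} (hZ : Zᵀ * Z = 1) :
    ∃ u : Matrix.orthogonalGroup (Fin p) ℝ, cols hqp u.1 = Z := by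
  obtain ⟨m, rfl⟩ := Nat.exists_eq_add_of_le hqp
  obtain ⟨n, hn, hZn⟩ := exists_orthonormal_complement (m := m) rfl Z
  have hnZ : nᵀ * Z = 0 := by
    have := congrArg Matrix.transpose hZn
    simpa [Matrix.transpose_mul] using this
  let e : Fin q ⊕ Fin m ≃ Fin (q + m) := finSumFinEquiv
  let g : Matrix (Fin (q + m)) (Fin q ⊕ Fin m) ℝ := fromCols Z n
  have hgg : gᵀ * g = 1 := by
    rw [transpose_fromCols, fromRows_mul_fromCols, hn, hZn, hnZ, hZ, fromBlocks_one]
  refine ⟨⟨g.submatrix id e.symm, ?_⟩, ?_⟩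
  · rw [mem_orthogonalGroup_iff']
    have h1 : (g.submatrix id e.symm)ᵀ * g.submatrix id e.symm
        = (gᵀ * g).submatrix e.symm e.symm := rfl
    rw [h1, hgg]
    exact submatrix_one_equiv e.symm
  · ext i j
    have h1 : e.symm (Fin.castLE hqp j) = Sum.inl j := by
      rw [Equiv.symm_apply_eq]; rfl
    simp [cols, h1, g]

/-- With `S = zᵀz`, the columns of `z S^{-1/2}` are orthonormal. -/
theorem exists_polar {p q : ℕ} (hqp : q ≤ p) {z : Mat p q} (hz : (zᵀ * z).PosDef) :
    ∃ u : Matrix.orthogonalGroup (Fin p) ℝ, z = cols hqp u.1 * (toPD (zᵀ * z)).sqrt.1 := by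
  set S := toPD (zᵀ * z) with hS
  have hS1 : S.1 = zᵀ * z := coe_toPD hz
  have hsi : S.sqrt.1⁻¹ * S.sqrt.1 = 1 := Matrix.nonsing_inv_mul _ S.sqrt.isUnit_det
  have his : S.sqrt.1 * S.sqrt.1⁻¹ = 1 := Matrix.mul_nonsing_inv _ S.sqrt.isUnit_det
  obtain ⟨u, hu⟩ := exists_orthogonal_cols hqp (Z := z * S.sqrt.1⁻¹) (by
    rw [transpose_mul, transpose_nonsing_inv, S.sqrt.transpose_eq,
      show S.sqrt.1⁻¹ * zᵀ * (z * S.sqrt.1⁻¹) = S.sqrt.1⁻¹ * (zᵀ * z) * S.sqrt.1⁻¹ by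
        simp only [Matrix.mul_assoc], ← hS1, ← S.sqrt_mul_sqrt, ← Matrix.mul_assoc, hsi,
      Matrix.one_mul, his])
  exact ⟨u, by rw [hu, Matrix.mul_assoc, hsi, Matrix.mul_one]⟩

/-- A rotation of a `q`-frame from the right is induced by right multiplication in the full
orthogonal group, so right invariance of Haar measure can absorb it. -/
theorem exists_cols_mul_eq {p q : ℕ} (hqp : q ≤ p) {k : Mat q q} (hk : kᵀ * k = 1) :
    ∃ K : Matrix.orthogonalGroup (Fin p) ℝ, ∀ u : Mat p p,
      cols hqp (u * K.1) = cols hqp u * k := by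
  obtain ⟨K, hK⟩ := exists_orthogonal_cols hqp (Z := cols hqp 1 * k) (by
    rw [transpose_mul, show kᵀ * (cols hqp 1)ᵀ * (cols hqp 1 * k)
      = kᵀ * ((cols hqp (1 : Mat p p))ᵀ * cols hqp 1) * k by simp only [Matrix.mul_assoc]]
    have h := cols_transpose_mul_cols hqp (1 : Matrix.orthogonalGroup (Fin p) ℝ)
    rw [show ((1 : Matrix.orthogonalGroup (Fin p) ℝ)).1 = 1 from rfl] at h
    rw [h, Matrix.mul_one, hk])
  exact ⟨K, fun u => by rw [cols_mul, hK, cols_eq_mul hqp u, Matrix.mul_assoc]⟩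

theorem lintegral_nu_orthogonal_mul {p q : ℕ} (u : Matrix.orthogonalGroup (Fin p) ℝ)
    {f : Mat p q → ℝ≥0∞} (hf : Measurable f) :
    ∫⁻ x, f (u.1 * x) ∂nu q (PD.one p) = ∫⁻ x, f x ∂nu q (PD.one p) := by
  have hm : Measurable fun x : Mat p q => u.1 * x :=
    (by fun_prop : Continuous fun x : Mat p q => u.1 * x).measurable
  have hu := orthogonal_transpose_mul u
  have hdet : |u.1.det| = 1 := by
    have := congrArg Matrix.det hu
    rw [det_mul, det_transpose, det_one, ← pow_two, ← sq_abs] at this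
    exact (pow_eq_one_iff_of_nonneg (abs_nonneg _) two_ne_zero).1 this
  have h := lintegral_leb_mul_left (q := q) (g := u.1) (by
    intro h; rw [h] at hdet; simp at hdet) ((measurable_nuOneDensity p q).mul hf)
  rw [lintegral_nu_one (f := fun x => f (u.1 * x)) (hf.comp hm), lintegral_nu_one hf]
  simp only [hdet, inv_one, one_pow, ENNReal.ofReal_one, one_mul, Pi.mul_apply] at h
  rw [← h]
  refine lintegral_congr fun z => ?_
  rw [transpose_mul, show zᵀ * u.1ᵀ * (u.1 * z) = zᵀ * (u.1ᵀ * u.1) * z by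
    simp only [Matrix.mul_assoc], hu, Matrix.mul_one]

theorem measurable_cols_mul_sqrt {p q : ℕ} (hqp : q ≤ p) :
    Measurable fun a : PD q × Matrix.orthogonalGroup (Fin p) ℝ =>
      cols hqp a.2.1 * a.1.sqrt.1 := by
  have h1 : Measurable fun a : PD q × Matrix.orthogonalGroup (Fin p) ℝ => a.1.sqrt.1 :=
    measurable_subtype_coe.comp ((PD.measurable_sqrt q).comp measurable_fst)
  have h2 : Measurable fun a : PD q × Matrix.orthogonalGroup (Fin p) ℝ => cols hqp a.2.1 :=
    (measurable_cols hqp).comp measurable_snd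
  have h3 : Measurable fun w : Mat p q × Mat q q => w.1 * w.2 :=
    (by fun_prop : Continuous fun w : Mat p q × Mat q q => w.1 * w.2).measurable
  exact h3.comp (h2.prodMk h1)

/-- By left orthogonal invariance the integrand may be averaged over `u z`. For fixed `z` with polar
frame `u₀` this involves `u u₀`, and right invariance forgets `u₀`; what remains depends on `z`
through `zᵀz` only, so the Gram image of `ν_I` applies. -/
theorem lintegral_nu_polar {p q : ℕ} (hqp : q ≤ p) {f : Mat p q → ℝ≥0∞} (hf : Measurable f) :
    ∫⁻ x, f x ∂nu q (PD.one p)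
      = ∫⁻ S, ∫⁻ u, f (cols hqp u.1 * S.sqrt.1) ∂uniformO p ∂mu q := by
  have h1 : ∫⁻ x, f x ∂nu q (PD.one p)
      = ∫⁻ u, ∫⁻ x, f (u.1 * x) ∂nu q (PD.one p) ∂uniformO p := by
    simp_rw [lintegral_nu_orthogonal_mul _ hf]
    simp
  have hm : Measurable fun a : Matrix.orthogonalGroup (Fin p) ℝ × Mat p q => a.1.1 * a.2 := by
    have h3 : Measurable fun w : Mat p p × Mat p q => w.1 * w.2 :=
      (by fun_prop : Continuous fun w : Mat p p × Mat p q => w.1 * w.2).measurable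
    have h4 : Measurable fun u : Matrix.orthogonalGroup (Fin p) ℝ => (u.1 : Mat p p) :=
      continuous_subtype_val.measurable
    exact h3.comp ((h4.comp measurable_fst).prodMk measurable_snd)
  have hG : Measurable fun S : PD q => ∫⁻ u, f (cols hqp u.1 * S.sqrt.1) ∂uniformO p :=
    (hf.comp (measurable_cols_mul_sqrt hqp)).lintegral_prod_right' (ν := uniformO p)
  have hF : Measurable (Function.uncurry fun (u : Matrix.orthogonalGroup (Fin p) ℝ)
      (x : Mat p q) => f (u.1 * x)) := hf.comp hm
  rw [h1, lintegral_lintegral_swap hF.aemeasurable, ← lintegral_gram_nu hqp (PD.one p) hG]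
  refine lintegral_congr_ae ((nu_absolutelyContinuous q (PD.one p)).ae_le ?_)
  filter_upwards [ae_posDef_gram hqp] with z hz
  obtain ⟨u₀, hu₀⟩ := exists_polar hqp hz
  let g : Matrix.orthogonalGroup (Fin p) ℝ → ℝ≥0∞ := fun v =>
    f (cols hqp v.1 * (toPD (zᵀ * z)).sqrt.1)
  have e1 : ∀ u : Matrix.orthogonalGroup (Fin p) ℝ, f (u.1 * z) = g (u * u₀) := by
    intro u
    change f (u.1 * z) = f (cols hqp (u.1 * u₀.1) * (toPD (zᵀ * z)).sqrt.1)
    rw [cols_mul, Matrix.mul_assoc, ← hu₀]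
  rw [gram_one]
  exact (lintegral_congr e1).trans (lintegral_uniformO_mul_right g u₀)

/-! ### The law of the Gram matrix of the proposal -/

/-- The upper left `q × q` block `𝖴₁`. -/
def topBlock {p q : ℕ} (hqp : q ≤ p) (u : Mat p p) : Mat q q :=
  u.submatrix (Fin.castLE hqp) (Fin.castLE hqp)

theorem topBlock_eq {p q : ℕ} (hqp : q ≤ p) (u : Mat p p) :
    topBlock hqp u = (cols hqp 1)ᵀ * cols hqp u := by
  rw [cols_one_transpose_mul]; rfl

/-- `I + ε - ρ^{1/2} (𝖴₁ ε^{1/2} + ε^{1/2} 𝖴₁ᵀ)`. -/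
def incrementMat {q : ℕ} (ρ : ℝ) (e : PD q) (t : Mat q q) : Mat q q :=
  1 + e.1 - √ρ • (t * e.sqrt.1 + e.sqrt.1 * tᵀ)

/-- The `μ`-density of `𝓛`. -/
def incrementDensity {p q : ℕ} (hqp : q ≤ p) (ρ : ℝ) (e : PD q) : ℝ≥0∞ :=
  ENNReal.ofReal ((1 - ρ) ^ ((p : ℝ) * q / 2) * (mvGamma q p / mvGamma q ((p : ℝ) / 2) ^ 2)) *
    ∫⁻ u, ENNReal.ofReal (e.1.det ^ ((p : ℝ) / 2) /
      (incrementMat ρ e (topBlock hqp u.1)).det ^ p) ∂uniformO p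

theorem measurable_sqrt_coe (q : ℕ) : Measurable fun e : PD q => e.sqrt.1 :=
  measurable_subtype_coe.comp (PD.measurable_sqrt q)

theorem measurable_incrementMat_det {q : ℕ} (ρ : ℝ) :
    Measurable fun a : PD q × Mat q q => (incrementMat ρ a.1 a.2).det := by
  have h : Measurable fun a : (Mat q q × Mat q q) × Mat q q =>
      (1 + a.1.1 - √ρ • (a.2 * a.1.2 + a.1.2 * a.2ᵀ)).det :=
    (by fun_prop : Continuous fun a : (Mat q q × Mat q q) × Mat q q =>
      (1 + a.1.1 - √ρ • (a.2 * a.1.2 + a.1.2 * a.2ᵀ)).det).measurable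
  have h1 : Measurable fun a : PD q × Mat q q => a.1.1 :=
    measurable_subtype_coe.comp measurable_fst
  have h2 : Measurable fun a : PD q × Mat q q => a.1.sqrt.1 :=
    (measurable_sqrt_coe q).comp measurable_fst
  have h3 := h.comp ((h1.prodMk h2).prodMk measurable_snd)
  exact h3

theorem measurable_topBlock {p q : ℕ} (hqp : q ≤ p) :
    Measurable fun u : Matrix.orthogonalGroup (Fin p) ℝ => topBlock hqp u.1 :=
  (by unfold topBlock; fun_prop : Continuous fun u : Matrix.orthogonalGroup (Fin p) ℝ =>
    topBlock hqp u.1).measurable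

theorem measurable_incrementIntegrand {p q : ℕ} (ρ : ℝ) :
    Measurable fun a : PD q × Mat q q => ENNReal.ofReal (a.1.1.det ^ ((p : ℝ) / 2) /
      (incrementMat ρ a.1 a.2).det ^ p) := by
  have h1 : Measurable fun a : PD q × Mat q q => a.1.1.det :=
    (measurable_det_pd q).comp measurable_fst
  exact ((h1.pow_const _).div ((measurable_incrementMat_det ρ).pow_const p)).ennreal_ofReal

theorem measurable_incrementDensity {p q : ℕ} (hqp : q ≤ p) (ρ : ℝ) :
    Measurable (incrementDensity hqp ρ) := by
  have h1 : Measurable fun a : PD q × Matrix.orthogonalGroup (Fin p) ℝ =>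
      (a.1, topBlock hqp a.2.1) :=
    measurable_fst.prodMk ((measurable_topBlock hqp).comp measurable_snd)
  have h2 := ((measurable_incrementIntegrand (p := p) ρ).comp h1).lintegral_prod_right'
    (ν := uniformO p)
  exact h2.const_mul _

/-- The integral over frames is lifted to the orthogonal group, where inversion and two-sided
translations are available. -/
theorem incrementLaw_eq {p q : ℕ} (hqp : q ≤ p) (ρ : ℝ) :
    incrementLaw hqp ρ = (mu q).withDensity (incrementDensity hqp ρ) := by
  unfold incrementLaw
  congr 1
  ext1 e
  unfold incrementDensity
  congr 1
  have hs : Measurable fun u : Mat p q => u.submatrix (Fin.castLE hqp) id :=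
    (by fun_prop : Continuous fun u : Mat p q => u.submatrix (Fin.castLE hqp) id).measurable
  have h1 : Measurable fun u : Mat p q => ENNReal.ofReal (e.1.det ^ ((p : ℝ) / 2) /
      (incrementMat ρ e (u.submatrix (Fin.castLE hqp) id)).det ^ p) :=
    ((measurable_incrementIntegrand (p := p) ρ).comp (measurable_prodMk_left (x := e))).comp hs
  exact lintegral_map h1 (measurable_cols hqp)

theorem lintegral_incrementLaw {p q : ℕ} (hqp : q ≤ p) (ρ : ℝ) {f : PD q → ℝ≥0∞}
    (hf : Measurable f) :
    ∫⁻ e, f e ∂incrementLaw hqp ρ = ∫⁻ e, incrementDensity hqp ρ e * f e ∂mu q := by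
  rw [incrementLaw_eq, lintegral_withDensity_eq_lintegral_mul _
    (measurable_incrementDensity hqp ρ) hf]
  rfl

theorem PD.sqrt_inv {q : ℕ} (e : PD q) : e.inv.sqrt = e.sqrt.inv := by
  refine (PD.eq_sqrt ?_).symm
  rw [PD.inv, ← Matrix.mul_inv_rev, e.sqrt_mul_sqrt, PD.inv]

/-- Conjugating by `ε^{1/2}` exchanges `I` with `ε⁻¹` and strips one root from each cross term,
which amounts to transposing `t`. -/
theorem det_incrementMat_inv {q : ℕ} (ρ : ℝ) (e : PD q) (t : Mat q q) :
    (incrementMat ρ e.inv t).det = e.1.det⁻¹ * (incrementMat ρ e tᵀ).det := by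
  have hu := e.sqrt.isUnit_det
  have h1 : e.sqrt.1 * e.sqrt.1⁻¹ = 1 := Matrix.mul_nonsing_inv _ hu
  have h2 : e.sqrt.1⁻¹ * e.sqrt.1 = 1 := Matrix.nonsing_inv_mul _ hu
  have h3 : e.1 = e.sqrt.1 * e.sqrt.1 := e.sqrt_mul_sqrt.symm
  have h4 : e.inv.1 = e.sqrt.1⁻¹ * e.sqrt.1⁻¹ := by
    rw [← Matrix.mul_inv_rev, e.sqrt_mul_sqrt, PD.inv]
  have h5 : e.inv.sqrt.1 = e.sqrt.1⁻¹ := by rw [PD.sqrt_inv, PD.inv]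
  have key : e.sqrt.1 * incrementMat ρ e.inv t * e.sqrt.1 = incrementMat ρ e tᵀ := by
    rw [incrementMat, incrementMat, h4, h5, transpose_transpose]
    generalize e.sqrt.1 = s at *
    rw [h3]
    simp only [Matrix.mul_add, Matrix.add_mul, Matrix.mul_sub, Matrix.sub_mul, Matrix.mul_smul,
      Matrix.smul_mul, Matrix.mul_one]
    have e1 : s * (s⁻¹ * s⁻¹) * s = 1 := by
      rw [← Matrix.mul_assoc, h1, Matrix.one_mul, h2]
    have e2 : s * (t * s⁻¹) * s = s * t := by
      rw [Matrix.mul_assoc, Matrix.mul_assoc, h2, Matrix.mul_one]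
    have e3 : s * (s⁻¹ * tᵀ) * s = tᵀ * s := by
      rw [← Matrix.mul_assoc, h1, Matrix.one_mul]
    rw [e1, e2, e3, add_comm (s * s), add_comm (s * t)]
  rw [← key, det_mul, det_mul, ← e.det_sqrt_sq]
  have := e.sqrt.2.det_pos.ne'
  field_simp

/-- Inverting `u` transposes its upper left block and undoes the transposition in
`det_incrementMat_inv`. The remaining powers `-p/2` and `p` of `det ε` add up to `p/2`. -/
theorem incrementDensity_inv {p q : ℕ} (hqp : q ≤ p) (ρ : ℝ) (e : PD q) :
    incrementDensity hqp ρ e.inv = incrementDensity hqp ρ e := by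
  unfold incrementDensity
  congr 1
  rw [← lintegral_uniformO_inv]
  refine lintegral_congr fun u => ?_
  have h1 : topBlock hqp (u⁻¹).1 = (topBlock hqp u.1)ᵀ := rfl
  have he := e.2.det_pos
  rw [det_incrementMat_inv, h1, transpose_transpose, PD.det_inv, mul_pow]
  congr 1
  have h2 : e.1.det ^ p = e.1.det ^ ((p : ℝ) / 2) * e.1.det ^ ((p : ℝ) / 2) := by
    rw [← Real.rpow_add he, ← Real.rpow_natCast]; congr 1; ring
  rw [Real.inv_rpow he.le, inv_pow, h2]
  have := Real.rpow_pos_of_pos he ((p : ℝ) / 2)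
  field_simp

theorem map_inv_incrementLaw {p q : ℕ} (hqp : q ≤ p) (ρ : ℝ) :
    (incrementLaw hqp ρ).map PD.inv = incrementLaw hqp ρ := by
  refine Measure.ext_of_lintegral _ fun f hf => ?_
  have hd := measurable_incrementDensity hqp ρ
  rw [lintegral_map hf (PD.measurable_inv q), lintegral_incrementLaw hqp ρ
    (f := fun e => f e.inv) (hf.comp (PD.measurable_inv q)), lintegral_incrementLaw hqp ρ hf,
    ← (measurePreserving_inv_mu q).lintegral_comp
      (f := fun e => incrementDensity hqp ρ e * f e) (hd.mul hf)]
  simp only [incrementDensity_inv]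

/-- The orthogonal factor relating `ε^{1/2} T^{1/2}` to `(ε ∘ T)^{1/2}`. -/
theorem exists_sqrt_circ {q : ℕ} (e T : PD q) :
    ∃ k : Mat q q, kᵀ * k = 1 ∧ k * (PD.circ e T).sqrt.1 = e.sqrt.1 * T.sqrt.1 := by
  set S := PD.circ e T with hS
  have hsi : S.sqrt.1⁻¹ * S.sqrt.1 = 1 := Matrix.nonsing_inv_mul _ S.sqrt.isUnit_det
  have his : S.sqrt.1 * S.sqrt.1⁻¹ = 1 := Matrix.mul_nonsing_inv _ S.sqrt.isUnit_det
  -- `ε^{1/2} T^{1/2}` and `S^{1/2}` have the same Gram matrix `S`, so their quotient is orthogonal.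
  refine ⟨e.sqrt.1 * T.sqrt.1 * S.sqrt.1⁻¹, ?_, by rw [Matrix.mul_assoc, hsi, Matrix.mul_one]⟩
  have h1 : T.sqrt.1 * e.sqrt.1 * (e.sqrt.1 * T.sqrt.1) = S.sqrt.1 * S.sqrt.1 := by
    have h2 : S.1 = T.sqrt.1 * e.1 * T.sqrt.1 := rfl
    rw [S.sqrt_mul_sqrt, h2, ← e.sqrt_mul_sqrt]
    simp only [Matrix.mul_assoc]
  rw [transpose_mul, transpose_mul, transpose_nonsing_inv, S.sqrt.transpose_eq,
    e.sqrt.transpose_eq, T.sqrt.transpose_eq, show S.sqrt.1⁻¹ * (T.sqrt.1 * e.sqrt.1) *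
      (e.sqrt.1 * T.sqrt.1 * S.sqrt.1⁻¹) = S.sqrt.1⁻¹ * (T.sqrt.1 * e.sqrt.1 *
      (e.sqrt.1 * T.sqrt.1)) * S.sqrt.1⁻¹ by simp only [Matrix.mul_assoc], h1,
    ← Matrix.mul_assoc, hsi, Matrix.one_mul, his]

theorem pairMat_sqrt_mul {p q : ℕ} (ρ : ℝ) (U : PD p) (a b : Mat p q) :
    pairMat ρ U (U.sqrt.1 * a) (U.sqrt.1 * b)
      = aᵀ * a + bᵀ * b - √ρ • (aᵀ * b + bᵀ * a) := by
  have h : ∀ a b : Mat p q, (U.sqrt.1 * a)ᵀ * U.1⁻¹ * (U.sqrt.1 * b) = aᵀ * b := by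
    intro a b
    rw [transpose_mul, U.sqrt.transpose_eq]
    calc aᵀ * U.sqrt.1 * U.1⁻¹ * (U.sqrt.1 * b)
        = aᵀ * (U.sqrt.1 * U.1⁻¹ * U.sqrt.1) * b := by simp only [Matrix.mul_assoc]
      _ = aᵀ * b := by rw [U.sqrt_mul_inv_mul_sqrt, Matrix.mul_one]
  rw [pairMat, h, h, h, h]

theorem cols_mul_sqrt_gram {p q : ℕ} (hqp : q ≤ p) (u : Matrix.orthogonalGroup (Fin p) ℝ)
    (S : PD q) : (cols hqp u.1 * S.sqrt.1)ᵀ * (cols hqp u.1 * S.sqrt.1) = S.1 := by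
  rw [transpose_mul, S.sqrt.transpose_eq, show S.sqrt.1 * (cols hqp u.1)ᵀ *
    (cols hqp u.1 * S.sqrt.1) = S.sqrt.1 * ((cols hqp u.1)ᵀ * cols hqp u.1) * S.sqrt.1 by
      simp only [Matrix.mul_assoc], cols_transpose_mul_cols, Matrix.mul_one, S.sqrt_mul_sqrt]

/-- The right factor `K` converts `(ε ∘ T)^{1/2}` into `ε^{1/2} T^{1/2}`, and the left factor `u₀`
cancels against the frame of `x`. All four terms of `pairMat` then carry `T^{1/2}` on both sides,
with `𝖴₁ ε^{1/2}` or its transpose in the middle of the cross terms. -/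
theorem pairMat_cols {p q : ℕ} (hqp : q ≤ p) (ρ : ℝ) (U : PD p) (e T : PD q) {k : Mat q q}
    (hkS : k * (PD.circ e T).sqrt.1 = e.sqrt.1 * T.sqrt.1)
    {K u₀ : Matrix.orthogonalGroup (Fin p) ℝ}
    (hK : ∀ u : Mat p p, cols hqp (u * K.1) = cols hqp u * k)
    (u : Matrix.orthogonalGroup (Fin p) ℝ) :
    pairMat ρ U (U.sqrt.1 * (cols hqp u₀.1 * T.sqrt.1))
        (U.sqrt.1 * (cols hqp (u₀ * u * K).1 * (PD.circ e T).sqrt.1))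
      = T.sqrt.1 * incrementMat ρ e (topBlock hqp u.1) * T.sqrt.1 := by
  have h1 : (cols hqp u₀.1 * T.sqrt.1)ᵀ * (cols hqp (u₀ * u * K).1 * (PD.circ e T).sqrt.1)
      = T.sqrt.1 * (topBlock hqp u.1 * e.sqrt.1) * T.sqrt.1 := by
    change (cols hqp u₀.1 * T.sqrt.1)ᵀ * (cols hqp (u₀.1 * u.1 * K.1) * (PD.circ e T).sqrt.1) = _
    rw [hK, cols_mul, Matrix.mul_assoc (u₀.1 * cols hqp u.1), hkS, cols_eq_mul hqp u₀.1,
      topBlock_eq, transpose_mul, transpose_mul, T.sqrt.transpose_eq]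
    calc T.sqrt.1 * ((cols hqp 1)ᵀ * u₀.1ᵀ) * (u₀.1 * cols hqp u.1 * (e.sqrt.1 * T.sqrt.1))
        = T.sqrt.1 * (cols hqp 1)ᵀ * (u₀.1ᵀ * u₀.1) * cols hqp u.1 * e.sqrt.1 * T.sqrt.1 := by
          simp only [Matrix.mul_assoc]
      _ = _ := by
          rw [orthogonal_transpose_mul, Matrix.mul_one]; simp only [Matrix.mul_assoc]
  have h2 := congrArg Matrix.transpose h1
  rw [transpose_mul, transpose_transpose, transpose_mul (T.sqrt.1 * _),
    transpose_mul T.sqrt.1, transpose_mul (topBlock _ _), T.sqrt.transpose_eq,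
    e.sqrt.transpose_eq] at h2
  rw [pairMat_sqrt_mul, cols_mul_sqrt_gram, cols_mul_sqrt_gram, h1, h2, incrementMat, PD.circ]
  nth_rewrite 1 [← T.sqrt_mul_sqrt]
  simp only [Matrix.mul_add, Matrix.add_mul, Matrix.mul_sub, Matrix.sub_mul, Matrix.mul_smul,
    Matrix.smul_mul, Matrix.mul_one, Matrix.mul_assoc]

/-- The core of the reduction: in polar coordinates for `y` the frame is integrated out, and Haar
invariance leaves a function of `gram U x` and `ε` alone. -/
theorem lintegral_mpcnProposal_gram {p q : ℕ} (hqp : q ≤ p) {ρ : ℝ} (hρ0 : 0 ≤ ρ) (hρ1 : ρ < 1)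
    (U : PD p) {x : Mat p q} (hx : (xᵀ * U.1⁻¹ * x).PosDef) {f : PD q → ℝ≥0∞}
    (hf : Measurable f) :
    ∫⁻ y, f (gram U y) ∂mpcnProposal ρ U x
      = ∫⁻ e, incrementDensity hqp ρ e * f (PD.circ e (gram U x)) ∂mu q := by
  have hd : Measurable fun y => ENNReal.ofReal (proposalDensity ρ U x y) := by
    have h := (measurable_proposalDensity ρ U).comp (measurable_prodMk_left (x := x))
    exact h
  have hfg : Measurable fun y : Mat p q => f (gram U y) := hf.comp (measurable_gram U)
  have hUm : Measurable fun z : Mat p q => U.sqrt.1 * z :=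
    (by fun_prop : Continuous fun z : Mat p q => U.sqrt.1 * z).measurable
  have hρ : 0 < 1 - ρ := by linarith
  have hx' : x = U.sqrt.1 * (U.sqrt.1⁻¹ * x) := by
    rw [← Matrix.mul_assoc, Matrix.mul_nonsing_inv _ U.sqrt.isUnit_det, Matrix.one_mul]
  set z := U.sqrt.1⁻¹ * x with hz
  have hzz : xᵀ * U.1⁻¹ * x = zᵀ * z := by
    rw [hx']; exact gram_sqrt_mul_mat U z
  have hzP : (zᵀ * z).PosDef := hzz ▸ hx
  obtain ⟨u₀, hu₀⟩ := exists_polar hqp hzP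
  set T := gram U x with hT
  have hTz : toPD (zᵀ * z) = T := by rw [hT, gram_eq_toPD, hzz]
  rw [hTz] at hu₀
  have hTx : xᵀ * U.1⁻¹ * x = T.1 := by rw [hzz, ← hTz, coe_toPD hzP]
  let G : PD q → ℝ≥0∞ := fun S => ∫⁻ u, ENNReal.ofReal
    (proposalDensity ρ U x (U.sqrt.1 * (cols hqp u.1 * S.sqrt.1))) ∂uniformO p
  have hGm : Measurable G := by
    have h := (hd.comp hUm).comp (measurable_cols_mul_sqrt hqp)
    exact h.lintegral_prod_right' (ν := uniformO p)
  rw [mpcnProposal_eq_withDensity hqp hρ0 hρ1 U hx,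
    lintegral_withDensity_eq_lintegral_mul _ hd hfg,
    lintegral_nu_eq_one U (hd.mul hfg), lintegral_nu_polar hqp (f := fun z =>
      ((fun y => ENNReal.ofReal (proposalDensity ρ U x y)) * fun y => f (gram U y))
        (U.sqrt.1 * z)) ((hd.mul hfg).comp hUm)]
  have e1 : ∀ S : PD q, ∫⁻ u : Matrix.orthogonalGroup (Fin p) ℝ,
      ((fun y => ENNReal.ofReal (proposalDensity ρ U x y)) * fun y => f (gram U y))
        (U.sqrt.1 * (cols hqp u.1 * S.sqrt.1)) ∂uniformO p = G S * f S := by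
    intro S
    have h1 : ∀ u : Matrix.orthogonalGroup (Fin p) ℝ,
        gram U (U.sqrt.1 * (cols hqp u.1 * S.sqrt.1)) = S := fun u => by
      rw [gram_sqrt_mul, cols_mul_sqrt_gram, toPD_coe]
    simp only [Pi.mul_apply, h1]
    rw [lintegral_mul_const]
    have h := ((hd.comp hUm).comp (measurable_cols_mul_sqrt hqp)).comp
      (measurable_prodMk_left (x := S))
    exact h
  simp_rw [e1]
  -- The radial variable is written as `S = ε ∘ T`, at no cost by invariance of `μ`.
  rw [← (measurePreserving_circ T).lintegral_comp (f := fun S => G S * f S) (hGm.mul hf)]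
  refine lintegral_congr fun e => ?_
  congr 1
  obtain ⟨k, hk, hkS⟩ := exists_sqrt_circ e T
  obtain ⟨K, hK⟩ := exists_cols_mul_eq hqp hk
  have hqp' : (q : ℝ) ≤ p := by exact_mod_cast hqp
  have hG1 : 0 < mvGamma q ((p : ℝ) / 2) := mvGamma_pos (by linarith)
  have hG2 : 0 < mvGamma q (p : ℝ) := mvGamma_pos (by linarith)
  let g : Matrix.orthogonalGroup (Fin p) ℝ → ℝ≥0∞ := fun u => ENNReal.ofReal
    (proposalDensity ρ U x (U.sqrt.1 * (cols hqp u.1 * (PD.circ e T).sqrt.1)))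
  -- The shift `u ↦ u₀ u K` aligns the frame of `y` with that of `x` and corrects the square root of
  -- `ε ∘ T`.
  have h1 : G (PD.circ e T) = ∫⁻ u, g (u₀ * u * K) ∂uniformO p :=
    ((lintegral_uniformO_mul_left (fun v => g (v * K)) u₀).trans
      (lintegral_uniformO_mul_right g K)).symm
  rw [h1, incrementDensity, ← lintegral_const_mul' _ _ ENNReal.ofReal_ne_top]
  refine lintegral_congr fun u => ?_
  have h2 := pairMat_cols hqp ρ U e T hkS (u₀ := u₀) hK u
  rw [← hu₀, ← hx'] at h2
  have hT0 := T.2.det_pos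
  have he0 := e.2.det_pos
  -- The numerator holds `det(T)^(p/2)` twice, once from `x` and once from `ε ∘ T`; this cancels the
  -- `det(T)^p` of the denominator.
  have h3 : T.1.det ^ p = T.1.det ^ ((p : ℝ) / 2) * T.1.det ^ ((p : ℝ) / 2) := by
    rw [← Real.rpow_add hT0, ← Real.rpow_natCast]; congr 1; ring
  have h4 : (T.sqrt.1 * incrementMat ρ e (topBlock hqp u.1) * T.sqrt.1).det
      = T.1.det * (incrementMat ρ e (topBlock hqp u.1)).det := by
    rw [det_mul, det_mul, ← T.det_sqrt_sq]; ring
  have h5 := Real.rpow_pos_of_pos hT0 ((p : ℝ) / 2)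
  simp only [g]
  rw [← ENNReal.ofReal_mul (by positivity), proposalDensity, h2, h4, hTx, gram_sqrt_mul_mat,
    cols_mul_sqrt_gram, PD.det_circ, Real.mul_rpow he0.le hT0.le, mul_pow, h3]
  congr 2
  field_simp

/-! ### The induced proposal -/

theorem map_gram_mpcnProposal {p q : ℕ} (hqp : q ≤ p) {ρ : ℝ} (hρ0 : 0 ≤ ρ) (hρ1 : ρ < 1)
    (U : PD p) {x : Mat p q} (hx : (xᵀ * U.1⁻¹ * x).PosDef) :
    (mpcnProposal ρ U x).map (gram U) = inducedProposal hqp ρ (gram U x) := by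
  refine Measure.ext_of_lintegral _ fun f hf => ?_
  have hc := PD.measurable_circ_left (gram U x)
  have h1 : ∫⁻ S, f S ∂inducedProposal hqp ρ (gram U x)
      = ∫⁻ e, f (PD.circ e (gram U x)) ∂incrementLaw hqp ρ := lintegral_map hf hc
  rw [lintegral_map hf (measurable_gram U), lintegral_mpcnProposal_gram hqp hρ0 hρ1 U hx hf, h1,
    lintegral_incrementLaw hqp ρ (f := fun e => f (PD.circ e (gram U x))) (hf.comp hc)]

/-- No integral is evaluated: the mass equals that of the image of `Q(x, ·)` for a single full-rank
`x`. The first `q` columns of the identity serve, with `U = I`. -/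
theorem isProbabilityMeasure_incrementLaw {p q : ℕ} (hqp : q ≤ p) {ρ : ℝ} (hρ0 : 0 ≤ ρ)
    (hρ1 : ρ < 1) : IsProbabilityMeasure (incrementLaw hqp ρ) := by
  have hM := isMarkovKernel_mpcnProposal hqp ρ (PD.one p)
  let x : Mat p q := cols hqp 1
  have hx : (xᵀ * (PD.one p).1⁻¹ * x).PosDef := by
    have h := cols_transpose_mul_cols hqp (1 : Matrix.orthogonalGroup (Fin p) ℝ)
    have h1 : xᵀ * (PD.one p).1⁻¹ * x = 1 := by
      rw [PD.one, inv_one, Matrix.mul_one]; exact h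
    rw [h1]; exact PosDef.one
  have h := congrArg (fun m => m Set.univ) (map_gram_mpcnProposal hqp hρ0 hρ1 (PD.one p) hx)
  beta_reduce at h
  have hc := PD.measurable_circ_left (gram (PD.one p) x)
  have h1 : inducedProposal hqp ρ (gram (PD.one p) x) Set.univ = incrementLaw hqp ρ Set.univ :=
    Measure.map_apply hc MeasurableSet.univ
  rw [Measure.map_apply (measurable_gram _) MeasurableSet.univ, Set.preimage_univ, measure_univ,
    h1] at h
  exact ⟨h.symm⟩

theorem isMarkovKernel_inducedProposal {p q : ℕ} (hqp : q ≤ p) {ρ : ℝ} (hρ0 : 0 ≤ ρ)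
    (hρ1 : ρ < 1) : IsMarkovKernel (inducedProposal hqp ρ) := by
  have := isProbabilityMeasure_incrementLaw hqp hρ0 hρ1
  exact ⟨fun S => Measure.isProbabilityMeasure_map (PD.measurable_circ_left S).aemeasurable⟩

/-- Detailed balance is pulled back along the measure-preserving Gram map to that of the MpCN
proposal. Since `Q̃` does not involve `U`, the choice `U = I` is enough. -/
theorem isReversible_inducedProposal {p q : ℕ} (hqp : q ≤ p) {ρ : ℝ} (hρ0 : 0 ≤ ρ)
    (hρ1 : ρ < 1) : (inducedProposal hqp ρ).IsReversible (mu q) := by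
  have hg := measurePreserving_gram hqp (PD.one p)
  have key : ∀ A B : Set (PD q), MeasurableSet A → MeasurableSet B →
      ∫⁻ S in A, inducedProposal hqp ρ S B ∂mu q
        = ∫⁻ x in gram (PD.one p) ⁻¹' A, mpcnProposal ρ (PD.one p) x (gram (PD.one p) ⁻¹' B)
          ∂nu q (PD.one p) := by
    intro A B hA hB
    rw [← hg.setLIntegral_comp_preimage hA (Kernel.measurable_coe _ hB)]
    refine lintegral_congr_ae (ae_restrict_of_ae
      ((nu_absolutelyContinuous q (PD.one p)).ae_le ?_))
    filter_upwards [ae_posDef_gramU hqp (PD.one p)] with x hx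
    rw [← map_gram_mpcnProposal hqp hρ0 hρ1 _ hx, Measure.map_apply (measurable_gram _) hB]
  intro A B hA hB
  rw [key A B hA hB, key B A hB hA]
  exact isReversible_mpcnProposal hqp hρ0 hρ1 _ (measurable_gram _ hA) (measurable_gram _ hB)

/-! ### Metropolis–Hastings kernels under maps -/

section MHMap
variable {E F : Type*} [MeasurableSpace E] [MeasurableSpace F]

theorem mhKernel_apply (Q : Kernel E E) [IsSFiniteKernel Q] (d : E → ℝ≥0) (hd : Measurable d)
    (x : E) : mhKernel Q d hd x = (Q x).withDensity (fun y => (accept d x y : ℝ≥0∞)) +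
    (1 - ∫⁻ y, (accept d x y : ℝ≥0∞) ∂(Q x)) • Measure.dirac x := rfl

theorem measurable_accept_right {d : E → ℝ≥0} (hd : Measurable d) (x : E) :
    Measurable fun y => (accept d x y : ℝ≥0∞) := by
  have h := (measurable_accept hd).comp (measurable_prodMk_left (x := x))
  exact measurable_coe_nnreal_ennreal.comp h

/-- The acceptance probability factors through `g` in both arguments, so accepted moves and the
rejection mass are both transported. Only the identity for `Q` at the given point `x` is used. -/
theorem map_mhKernel {Q : Kernel E E} [IsSFiniteKernel Q] {Q' : Kernel F F} [IsSFiniteKernel Q']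
    {d : F → ℝ≥0} (hd : Measurable d) {g : E → F} (hg : Measurable g) {x : E}
    (hQ : (Q x).map g = Q' (g x)) :
    (mhKernel Q (fun x => d (g x)) (hd.comp hg) x).map g = mhKernel Q' d hd (g x) := by
  have ha := measurable_accept_right hd (g x)
  have hacc : ∀ y, accept (fun x => d (g x)) x y = accept d (g x) (g y) := fun y => rfl
  ext A hA
  rw [Measure.map_apply hg hA, mhKernel_apply, mhKernel_apply]
  simp only [Measure.coe_add, Pi.add_apply, Measure.smul_apply, smul_eq_mul]
  rw [withDensity_apply _ (hg hA), withDensity_apply _ hA, ← hQ, setLIntegral_map hA ha hg,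
    lintegral_map ha hg, Measure.dirac_apply' _ hA, Measure.dirac_apply' _ (hg hA)]
  rfl

/-- Subtraction in `ℝ≥0∞` truncates at zero; this bound makes the rejection weight the exact
complement. -/
theorem lintegral_accept_le_one (Q : Kernel E E) [IsMarkovKernel Q] (d : E → ℝ≥0) (x : E) :
    ∫⁻ y, (accept d x y : ℝ≥0∞) ∂(Q x) ≤ 1 := by
  calc ∫⁻ y, (accept d x y : ℝ≥0∞) ∂(Q x) ≤ ∫⁻ _, 1 ∂(Q x) := by
        refine lintegral_mono fun y => ?_
        rw [ENNReal.coe_le_one_iff, accept]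
        split_ifs
        · exact le_rfl
        · exact min_le_left _ _
    _ = 1 := by simp

theorem isMarkovKernel_mhKernel (Q : Kernel E E) [IsMarkovKernel Q] (d : E → ℝ≥0)
    (hd : Measurable d) : IsMarkovKernel (mhKernel Q d hd) := by
  refine ⟨fun x => ⟨?_⟩⟩
  rw [mhKernel_apply]
  simp only [Measure.coe_add, Pi.add_apply, Measure.smul_apply, smul_eq_mul]
  rw [withDensity_apply _ MeasurableSet.univ, Measure.restrict_univ, measure_univ, mul_one,
    add_tsub_cancel_of_le (lintegral_accept_le_one Q d x)]

end MHMap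

/-! ### Images of Markov chains -/

theorem measurable_iSup_comap {E Ω : Type*} [MeasurableSpace E] (X : ℕ → Ω → E) (n : ℕ) :
    Measurable[⨆ k : Fin (n + 1), MeasurableSpace.comap (X k) inferInstance] (X n) :=
  (comap_measurable (X n)).mono
    (le_iSup (fun k : Fin (n + 1) => MeasurableSpace.comap (X k) inferInstance) (Fin.last n)) le_rfl

theorem iSup_comap_comp_le {E F Ω : Type*} [MeasurableSpace E] [MeasurableSpace F]
    (X : ℕ → Ω → E) {g : E → F} (hg : Measurable g) (n : ℕ) :
    (⨆ k : Fin (n + 1), MeasurableSpace.comap (fun ω => g (X k ω)) inferInstance)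
      ≤ ⨆ k : Fin (n + 1), MeasurableSpace.comap (X k) inferInstance :=
  iSup_mono fun k => (hg.comp (comap_measurable (X k))).comap_le

/-- Tower property: a conditional expectation that is already measurable for the smaller σ-algebra
does not change when one conditions on less. This passes from the past of `X` to the past of its
image. -/
theorem condExp_eq_of_le {Ω : Type*} {m' m mΩ : MeasurableSpace Ω} {P : Measure Ω}
    [IsProbabilityMeasure P] (hmm : m' ≤ m) (hm : m ≤ mΩ) {f g : Ω → ℝ}
    (h : P[f | m] =ᵐ[P] g) (hg : StronglyMeasurable[m'] g) (hint : Integrable g P) :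
    P[f | m'] =ᵐ[P] g := by
  refine (condExp_condExp_of_le (f := f) hmm hm).symm.trans ((condExp_congr_ae h).trans ?_)
  rw [condExp_of_stronglyMeasurable (hmm.trans hm) hg hint]

theorem integrable_kernel_real {E Ω : Type*} [MeasurableSpace E] {mΩ : MeasurableSpace Ω}
    {P : Measure Ω} [IsProbabilityMeasure P] (κ : Kernel E E) [IsMarkovKernel κ] {Y : Ω → E}
    (hY : Measurable Y) {A : Set E} (hA : MeasurableSet A) :
    Integrable (fun ω => (κ (Y ω)).real A) P := by
  have h4 : Measurable fun y => (κ y).real A := (Kernel.measurable_coe κ hA).ennreal_toReal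
  refine Integrable.of_bound (h4.comp hY).aestronglyMeasurable 1 (ae_of_all _ fun ω => ?_)
  rw [Real.norm_eq_abs, abs_of_nonneg measureReal_nonneg]
  exact measureReal_le_one

section MarkovChains
variable {E F Ω : Type*} [MeasurableSpace E] [MeasurableSpace F] {mΩ : MeasurableSpace Ω}
  {P : Measure Ω} [IsProbabilityMeasure P]

theorem iSup_comap_le {X : ℕ → Ω → E} (hX : ∀ n, Measurable (X n)) (n : ℕ) :
    (⨆ k : Fin (n + 1), MeasurableSpace.comap (X k) inferInstance) ≤ mΩ :=
  iSup_le fun k => (hX k).comap_le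

theorem IsMarkovChain.measure_preimage {κ : Kernel E E} [IsMarkovKernel κ] {X : ℕ → Ω → E}
    (h : IsMarkovChain P κ X) (n : ℕ) {A : Set E} (hA : MeasurableSet A) :
    P.real (X (n + 1) ⁻¹' A) = ∫ ω, (κ (X n ω)).real A ∂P := by
  have h1 := integral_condExp (iSup_comap_le h.measurable n) (μ := P)
    (f := (X (n + 1) ⁻¹' A).indicator fun _ => (1 : ℝ))
  rw [integral_congr_ae (h.condExp_eq n A hA), integral_indicator (h.measurable (n + 1) hA)] at h1
  simpa using h1.symm

theorem IsMarkovChain.ae_mem {κ : Kernel E E} [IsMarkovKernel κ] {X : ℕ → Ω → E}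
    (h : IsMarkovChain P κ X) {G : Set E} (hG : MeasurableSet G) (h0 : ∀ᵐ ω ∂P, X 0 ω ∈ G)
    (hκ : ∀ x ∈ G, κ x Gᶜ = 0) (n : ℕ) : ∀ᵐ ω ∂P, X n ω ∈ G := by
  induction n with
  | zero => exact h0
  | succ n ih =>
    have h1 := h.measure_preimage n hG.compl
    have h2 : ∫ ω, (κ (X n ω)).real Gᶜ ∂P = 0 := by
      rw [integral_congr_ae (g := fun _ => (0 : ℝ)) ?_, integral_zero]
      filter_upwards [ih] with ω hω
      simp [Measure.real, hκ _ hω]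
    rw [h2, measureReal_eq_zero_iff] at h1
    rw [ae_iff]
    exact h1

/-- Lumpability: given the past of `X`, the next image depends on the present image only. The
intertwining is required just on a set `G` the chain almost surely never leaves, here the full-rank
matrices. -/
theorem IsMarkovChain.map {κ : Kernel E E} [IsMarkovKernel κ] {κ' : Kernel F F}
    [IsMarkovKernel κ'] {X : ℕ → Ω → E}
    (h : IsMarkovChain P κ X) {g : E → F} (hg : Measurable g) {G : Set E}
    (hG : ∀ n, ∀ᵐ ω ∂P, X n ω ∈ G) (hκ : ∀ x ∈ G, (κ x).map g = κ' (g x)) :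
    IsMarkovChain P κ' fun n ω => g (X n ω) where
  measurable n := hg.comp (h.measurable n)
  condExp_eq n A hA := by
    refine condExp_eq_of_le (iSup_comap_comp_le X hg n) (iSup_comap_le h.measurable n)
      ((h.condExp_eq n (g ⁻¹' A) (hg hA)).trans ?_) ?_
      (integrable_kernel_real κ' (hg.comp (h.measurable n)) hA)
    · filter_upwards [hG n] with ω hω
      rw [Measure.real, Measure.real, ← hκ _ hω, Measure.map_apply hg hA]
    · have h4 : Measurable fun y => (κ' y).real A := (Kernel.measurable_coe κ' hA).ennreal_toReal
      have h5 := h4.comp (measurable_iSup_comap (fun n ω => g (X n ω)) n)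
      exact h5.stronglyMeasurable

end MarkovChains

/-! ### Random walks -/

/-- Freezing: the pair formed by `Y` and the indicator of `s` is `m`-measurable, hence independent
of `ξ`, and Fubini on the product law integrates `ξ` out with `Y` held fixed. -/
theorem setLIntegral_kernel_of_indep {E F Ω : Type*} [MeasurableSpace E] [MeasurableSpace F]
    {m mΩ : MeasurableSpace Ω} {P : Measure Ω} [IsProbabilityMeasure P] (hm : m ≤ mΩ)
    {Y : Ω → E} (hY : Measurable[m] Y) {ξ : Ω → F} (hξ : Measurable ξ)
    (hind : Indep m (MeasurableSpace.comap ξ inferInstance) P) {f : F → E → E}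
    (hf : Measurable (Function.uncurry f)) {κ : Kernel E E}
    (hκ : ∀ x, κ x = (P.map ξ).map fun e => f e x) {A : Set E} (hA : MeasurableSet A)
    {s : Set Ω} (hs : MeasurableSet[m] s) :
    ∫⁻ ω in s, κ (Y ω) A ∂P = P ((fun ω => f (ξ ω) (Y ω)) ⁻¹' A ∩ s) := by
  have hs' : MeasurableSet s := hm s hs
  have hY' : Measurable Y := hY.mono hm le_rfl
  let c : Ω → ℝ≥0∞ := s.indicator 1
  have hc : Measurable[m] c := 
    @Measurable.indicator Ω ℝ≥0∞ s 1 m _ _ (@measurable_const _ _ _ m 1) hs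
  have hc' : Measurable c := hc.mono hm le_rfl
  have hZ : IndepFun (fun ω => (c ω, Y ω)) ξ P :=
    indep_of_indep_of_le_left hind (Measurable.comap_le (hc.prodMk hY))
  have hprod := (indepFun_iff_map_prod_eq_prod_map_map (hc'.prodMk hY').aemeasurable
    hξ.aemeasurable).1 hZ
  have hfc : Measurable fun z : (ℝ≥0∞ × E) × F => f z.2 z.1.2 := by
    have h1 : Measurable fun z : (ℝ≥0∞ × E) × F => z.1.2 := measurable_snd.comp measurable_fst
    have h := hf.comp (measurable_snd.prodMk h1)
    exact h
  have hφ : Measurable fun z : (ℝ≥0∞ × E) × F =>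
      z.1.1 * A.indicator (1 : E → ℝ≥0∞) (f z.2 z.1.2) :=
    (measurable_fst.comp measurable_fst).mul ((measurable_one.indicator hA).comp hfc)
  have hfx : ∀ x, Measurable fun e => f e x := fun x => hf.comp measurable_prodMk_right
  have hκA : ∀ x, ∫⁻ e, A.indicator (1 : E → ℝ≥0∞) (f e x) ∂P.map ξ = κ x A := by
    intro x
    rw [hκ, ← lintegral_map (measurable_one.indicator hA) (hfx x), lintegral_indicator_one hA]
  have hX : Measurable fun ω => f (ξ ω) (Y ω) := hf.comp (hξ.prodMk hY')
  calc ∫⁻ ω in s, κ (Y ω) A ∂P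
      = ∫⁻ ω, c ω * κ (Y ω) A ∂P := by
        rw [← lintegral_indicator hs']
        refine lintegral_congr fun ω => ?_
        by_cases h : ω ∈ s <;> simp [c, h]
    _ = ∫⁻ z, z.1 * κ z.2 A ∂P.map (fun ω => (c ω, Y ω)) :=
        (lintegral_map (f := fun z : ℝ≥0∞ × E => z.1 * κ z.2 A)
          (measurable_fst.mul ((Kernel.measurable_coe κ hA).comp measurable_snd))
          (hc'.prodMk hY')).symm
    _ = ∫⁻ z, ∫⁻ e, z.1 * A.indicator (1 : E → ℝ≥0∞) (f e z.2) ∂P.map ξ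
          ∂P.map (fun ω => (c ω, Y ω)) := by
        refine lintegral_congr fun z => ?_
        have h1 : Measurable (A.indicator (1 : E → ℝ≥0∞)) := measurable_one.indicator hA
        have h := h1.comp (hfx z.2)
        rw [← hκA]
        exact (lintegral_const_mul _ h).symm
    _ = ∫⁻ ω, c ω * A.indicator (1 : E → ℝ≥0∞) (f (ξ ω) (Y ω)) ∂P := by
        rw [← lintegral_prod _ hφ.aemeasurable, ← hprod,
          lintegral_map hφ ((hc'.prodMk hY').prodMk hξ)]
    _ = P ((fun ω => f (ξ ω) (Y ω)) ⁻¹' A ∩ s) := by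
        rw [← lintegral_indicator_one ((hX hA).inter hs')]
        refine lintegral_congr fun ω => ?_
        by_cases h : ω ∈ s <;> by_cases h' : f (ξ ω) (Y ω) ∈ A <;> simp [c, h, h']

theorem condExp_preimage_of_indep {E F Ω : Type*} [MeasurableSpace E] [MeasurableSpace F]
    {m mΩ : MeasurableSpace Ω} {P : Measure Ω} [IsProbabilityMeasure P] (hm : m ≤ mΩ)
    {Y : Ω → E} (hY : Measurable[m] Y) {ξ : Ω → F} (hξ : Measurable ξ)
    (hind : Indep m (MeasurableSpace.comap ξ inferInstance) P) {f : F → E → E}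
    (hf : Measurable (Function.uncurry f)) {κ : Kernel E E} [IsMarkovKernel κ]
    (hκ : ∀ x, κ x = (P.map ξ).map fun e => f e x) {A : Set E} (hA : MeasurableSet A) :
    P[((fun ω => f (ξ ω) (Y ω)) ⁻¹' A).indicator (fun _ => (1 : ℝ)) | m]
      =ᵐ[P] fun ω => (κ (Y ω)).real A := by
  have hY' : Measurable Y := hY.mono hm le_rfl
  have hX : Measurable fun ω => f (ξ ω) (Y ω) := hf.comp (hξ.prodMk hY')
  have h4 : Measurable fun y => (κ y).real A := (Kernel.measurable_coe κ hA).ennreal_toReal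
  have hint : Integrable (fun ω => (κ (Y ω)).real A) P := integrable_kernel_real κ hY' hA
  refine (ae_eq_condExp_of_forall_setIntegral_eq hm
    ((integrable_const (1 : ℝ)).indicator (hX hA)) (fun s _ _ => hint.integrableOn)
    (fun s hs _ => ?_) ?_).symm
  · have h1 := setLIntegral_kernel_of_indep hm hY hξ hind hf hκ hA hs
    have h2 : ∫ ω in s, (κ (Y ω)).real A ∂P = (∫⁻ ω in s, κ (Y ω) A ∂P).toReal :=
      integral_toReal ((Kernel.measurable_coe κ hA).comp hY').aemeasurable
        (ae_of_all _ fun ω => measure_lt_top _ _)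
    rw [h2, h1, integral_indicator (hX hA), setIntegral_const, smul_eq_mul, mul_one,
      Measure.real, Measure.restrict_apply (hX hA)]
  · exact (h4.comp hY).stronglyMeasurable.aestronglyMeasurable

/-- The position of a walk at time `n` is a function of the starting point and the first `n`
increments. -/
theorem measurable_position {q : ℕ} {Ω : Type*} {m : MeasurableSpace Ω} {ε T : ℕ → Ω → PD q}
    (step : ∀ n, 1 ≤ n → ∀ ω, T n ω = PD.circ (ε n ω) (T (n - 1) ω)) {N : ℕ}
    (hm : ∀ i ≤ N, Measurable (if i = 0 then T 0 else ε i)) : ∀ n ≤ N, Measurable (T n) := by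
  intro n
  induction n with
  | zero => intro hn; exact hm 0 hn
  | succ n ih =>
    intro hn
    have h1 := ih (Nat.le_of_succ_le hn)
    have h2 : Measurable (ε (n + 1)) := hm (n + 1) hn
    have h3 : T (n + 1) = fun ω => PD.circ (ε (n + 1) ω) (T n ω) :=
      funext fun ω => step (n + 1) n.succ_pos ω
    rw [h3]
    have h4 := (PD.measurable_circ q).comp (h2.prodMk h1)
    exact h4

namespace IsRandomWalk
variable {q : ℕ} {Ω : Type*} {mΩ : MeasurableSpace Ω} {P : Measure Ω}
  {L : Measure (PD q)} {ε T : ℕ → Ω → PD q}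

theorem measurable_family (h : IsRandomWalk P L ε T) (n : ℕ) :
    Measurable (if n = 0 then T 0 else ε n) := by
  split_ifs with hn
  · exact h.measurable_zero
  · exact h.measurable_increment n (Nat.one_le_iff_ne_zero.2 hn)

theorem measurable (h : IsRandomWalk P L ε T) (n : ℕ) : Measurable (T n) :=
  measurable_position h.step (fun i _ => h.measurable_family i) n le_rfl

/-- The positions up to time `n` are functions of the family members with index at most `n`, where
index `0` holds the starting point; the next increment has index `n + 1`. -/
theorem indep_increment (h : IsRandomWalk P L ε T) (n : ℕ) :
    Indep (⨆ k : Fin (n + 1), MeasurableSpace.comap (T k) inferInstance)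
      (MeasurableSpace.comap (ε (n + 1)) inferInstance) P := by
  have h1 := indep_iSup_of_disjoint
    (m := fun i => MeasurableSpace.comap (if i = 0 then T 0 else ε i) inferInstance)
    (fun i => (h.measurable_family i).comap_le) h.indep
    (S := Set.Iic n) (T := {n + 1}) (by simp)
  refine indep_of_indep_of_le_left (indep_of_indep_of_le_right h1 ?_) ?_
  · exact le_iSup₂_of_le (n + 1) rfl le_rfl
  · refine iSup_le fun k => Measurable.comap_le ?_
    refine measurable_position h.step (N := n) (fun i hi => ?_) k (Nat.lt_succ_iff.1 k.2)
    exact (comap_measurable _).mono (le_iSup₂_of_le i hi le_rfl) le_rfl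

/-- A random walk is a Markov chain whose kernel moves `S` to `ε ∘ S` with `ε ∼ L`. -/
theorem isMarkovChain [IsProbabilityMeasure P] (h : IsRandomWalk P L ε T)
    {κ : Kernel (PD q) (PD q)} [IsMarkovKernel κ]
    (hκ : ∀ S, κ S = L.map fun e => PD.circ e S) : IsMarkovChain P κ T where
  measurable := h.measurable
  condExp_eq n A hA := by
    have h3 : T (n + 1) = fun ω => PD.circ (ε (n + 1) ω) (T n ω) :=
      funext fun ω => h.step (n + 1) n.succ_pos ω
    rw [h3]
    refine condExp_preimage_of_indep (iSup_comap_le h.measurable n) (measurable_iSup_comap T n)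
      (h.measurable_increment (n + 1) n.succ_pos) (h.indep_increment n) (PD.measurable_circ q)
      (fun S => ?_) hA
    rw [h.map_increment (n + 1) n.succ_pos, hκ]

end IsRandomWalk

/-! ### Full rank -/

theorem posDef_gram_of_rank {p q : ℕ} (U : PD p) {x : Mat p q} (hx : x.rank = q) :
    (xᵀ * U.1⁻¹ * x).PosDef := by
  have hinj : Function.Injective x.mulVec := by
    rw [Matrix.mulVec_injective_iff]
    rw [Matrix.rank_eq_finrank_span_cols] at hx
    exact linearIndependent_iff_card_eq_finrank_span.2 (by simp [Set.finrank, hx])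
  have h := U.2.inv.conjTranspose_mul_mul_same hinj
  rwa [conjTranspose_eq_transpose_of_trivial] at h

theorem measurableSet_posDef_gram {p : ℕ} (q : ℕ) (U : PD p) :
    MeasurableSet {x : Mat p q | (xᵀ * U.1⁻¹ * x).PosDef} :=
  (by fun_prop : Continuous fun x : Mat p q => xᵀ * U.1⁻¹ * x).measurable (measurableSet_posDef q)

/-- Accepted moves have a law absolutely continuous with respect to Lebesgue measure, and a
rejection stays at the full-rank point `x`. -/
theorem mhKernel_mpcnProposal_compl_posDef {p q : ℕ} (hqp : q ≤ p) {ρ : ℝ} (hρ0 : 0 ≤ ρ)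
    (hρ1 : ρ < 1) (U : PD p) {d : Mat p q → ℝ≥0} (hd : Measurable d) {x : Mat p q}
    (hx : (xᵀ * U.1⁻¹ * x).PosDef) :
    mhKernel (mpcnProposal ρ U) d hd x {x | (xᵀ * U.1⁻¹ * x).PosDef}ᶜ = 0 := by
  have hG := measurableSet_posDef_gram q U
  have h1 : mpcnProposal ρ U x {x : Mat p q | (xᵀ * U.1⁻¹ * x).PosDef}ᶜ = 0 := by
    rw [mpcnProposal_eq_withDensity hqp hρ0 hρ1 U hx]
    exact ((withDensity_absolutelyContinuous _ _).trans (nu_absolutelyContinuous q U))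
      (ae_iff.1 (ae_posDef_gramU hqp U))
  rw [mhKernel_apply, Measure.add_apply, Measure.smul_apply,
    withDensity_absolutelyContinuous _ _ h1, Measure.dirac_apply' _ hG.compl,
    Set.indicator_of_notMem (Set.notMem_compl_iff.2 (by exact hx)), smul_zero, add_zero]

end MpCN

end

/-! ### Assembly of the theorem -/

theorem mainTheorem2 {p q : ℕ} (hqp : q ≤ p) (ρ : ℝ) (hρ0 : 0 ≤ ρ) (hρ1 : ρ < 1)
    (U : MpCN.PD p)
    -- the target `Π̃(dS) = π̃(S) μ(dS)` on `P⁺(q)`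
    (dens : MpCN.PD q → ℝ≥0) (hdens : Measurable dens)
    (hprob : IsProbabilityMeasure ((MpCN.mu q).withDensity fun S => (dens S : ℝ≥0∞)))
    -- the MpCN chain on `M(p,q)`: target `π̃(xᵀ U⁻¹ x) ν_U(dx)`, proposal `Q(·; ρ, U)`
    {Ω : Type*} [MeasurableSpace Ω] (P : Measure Ω) [IsProbabilityMeasure P]
    (X : ℕ → Ω → MpCN.Mat p q)
    (hX : MpCN.IsMarkovChain P
      (MpCN.mhKernel (MpCN.mpcnProposal ρ U) (fun x => dens (MpCN.gram U x))
        (hdens.comp (MpCN.measurable_gram U))) X)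
    (hX0 : ∀ᵐ ω ∂P, (X 0 ω).rank = q) :
    -- the MpCN kernel is the Metropolis–Hastings kernel of the triplet `(Π, Q, ν_U)`
    MpCN.IsMHTriplet ((MpCN.nu q U).withDensity fun x => (dens (MpCN.gram U x) : ℝ≥0∞))
      (MpCN.mpcnProposal ρ U) (MpCN.nu q U) (fun x => dens (MpCN.gram U x)) ∧
    -- `Sₙ = Xₙᵀ U⁻¹ Xₙ` is well defined as a `P⁺(q)`-valued process
    (∀ᵐ ω ∂P, ∀ n, (MpCN.gram U (X n ω)).1 = (X n ω)ᵀ * U.1⁻¹ * X n ω) ∧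
    -- `(Sₙ)` is a Metropolis–Hastings Markov chain for the triplet `(Π̃, Q̃, μ)`
    MpCN.IsMHTriplet ((MpCN.mu q).withDensity fun S => (dens S : ℝ≥0∞))
      (MpCN.inducedProposal hqp ρ) (MpCN.mu q) dens ∧
    MpCN.IsMarkovChain P (MpCN.mhKernel (MpCN.inducedProposal hqp ρ) dens hdens)
      (fun n ω => MpCN.gram U (X n ω)) ∧
    -- `Q̃` is the transition kernel of random walks with increment law `𝓛`, and `𝓛 = 𝓛₋₁`
    IsProbabilityMeasure (MpCN.incrementLaw hqp ρ) ∧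
    (MpCN.incrementLaw hqp ρ).map MpCN.PD.inv = MpCN.incrementLaw hqp ρ ∧
    (∀ {Ω' : Type*} [MeasurableSpace Ω'] (P' : Measure Ω') [IsProbabilityMeasure P']
      (ε T : ℕ → Ω' → MpCN.PD q),
      MpCN.IsRandomWalk P' (MpCN.incrementLaw hqp ρ) ε T →
      MpCN.IsMarkovChain P' (MpCN.inducedProposal hqp ρ) T) := by
  have hMQ := MpCN.isMarkovKernel_mpcnProposal hqp ρ U
  have hML := MpCN.isMarkovKernel_inducedProposal hqp hρ0 hρ1
  have hdg : Measurable fun x : MpCN.Mat p q => dens (MpCN.gram U x) :=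
    hdens.comp (MpCN.measurable_gram U)
  have hMK := MpCN.isMarkovKernel_mhKernel (MpCN.mpcnProposal ρ U)
    (fun x : MpCN.Mat p q => dens (MpCN.gram U x)) hdg
  have hMK' := MpCN.isMarkovKernel_mhKernel (MpCN.inducedProposal hqp ρ) dens hdens
  have hG : ∀ n, ∀ᵐ ω ∂P, X n ω ∈ {x : MpCN.Mat p q | (xᵀ * U.1⁻¹ * x).PosDef} :=
    hX.ae_mem (MpCN.measurableSet_posDef_gram q U)
      (hX0.mono fun ω hω => MpCN.posDef_gram_of_rank U hω)
      (fun x hx => MpCN.mhKernel_mpcnProposal_compl_posDef hqp hρ0 hρ1 U hdg hx)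
  refine ⟨⟨⟨?_⟩, hMQ, inferInstance, hdg, rfl,
    MpCN.isReversible_mpcnProposal hqp hρ0 hρ1 U⟩, ?_, ⟨hprob, hML, inferInstance, hdens, rfl,
    MpCN.isReversible_inducedProposal hqp hρ0 hρ1⟩, ?_,
    MpCN.isProbabilityMeasure_incrementLaw hqp hρ0 hρ1, MpCN.map_inv_incrementLaw hqp ρ, ?_⟩
  -- The upcast law has the mass of `Π̃`, because the Gram map carries `ν_U` to `μ`.
  · have h1 := hprob.measure_univ
    rw [withDensity_apply _ MeasurableSet.univ, Measure.restrict_univ] at h1 ⊢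
    rw [← h1]
    exact (MpCN.measurePreserving_gram hqp U).lintegral_comp hdens.coe_nnreal_ennreal
  · filter_upwards [ae_all_iff.2 hG] with ω hω n
    exact MpCN.coe_toPD (hω n)
  · exact hX.map (MpCN.measurable_gram U) hG fun x hx =>
      MpCN.map_mhKernel hdens (MpCN.measurable_gram U)
        (MpCN.map_gram_mpcnProposal hqp hρ0 hρ1 U hx)
  · intro Ω' _ P' _ ε T h
    exact h.isMarkovChain fun _ => rfl
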